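/- Let $G$ be a (finite-dimensional real) Lie group with Lie algebra $\mathfrak g$, let $M$ be a smooth manifold (without boundary) with a smooth left $G$-action, and let $\pi:P\to X$ be a smooth principal $G$-bundle (right action) over a compact smooth manifold $X$ without boundary. For $\xi\in\mathfrak g$ let $X_\xi(x)=\frac{d}{dt}\big|_{t=0}\exp(t\xi)x$ for $x\in M$ and $p\xi=\frac{d}{dt}\big|_{t=0}p\exp(t\xi)\in T_pP$ for $p\in P$. Fix a basis $e_1,\dots,e_m$ of $\mathfrak g$. Let $\Omega^\ell_G(M)$ be the space of polynomials $\alpha(\xi)=\sum_I\xi^I\alpha_I$ on $\mathfrak g$, where $\alpha_I\in\Omega^{\ell-2|I|}(M)$ and $\xi^I=(\xi^1)^{i_1}\cdots(\xi^m)^{i_m}$ for $\xi=\sum_i\xi^ie_i$, that are $G$-equivariant, i.e. $g^*(\alpha(\mathrm{Ad}_g\xi))=\alpha(\xi)$ for all $g\in G$, $\xi\in\mathfrak g$; and let $(d_G\alpha)(\xi)=d(\alpha(\xi))+\iota(X_\xi)\alpha(\xi)$. Let $\mathcal A(P)$ be the set of connection $1$-forms $A\in\Omega^1(P,\mathfrak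 g)$, that is, $A_{ph}(vh)=\mathrm{Ad}_{h^{-1}}A_p(v)$ and $A_p(p\xi)=\xi$. A smooth map $u:P\to M$ is called equivariant if $u(ph)=h^{-1}u(p)$. For $A\in\mathcal A(P)$ and a smooth equivariant map $u$ put $F_A=dA+\frac12[A\wedge A]=\sum_i\omega^ie_i$, $d_Au(p)v=du(p)v+X_{A_p(v)}(u(p))$, and $$\alpha(u,A)=((d_Au)^*\alpha)(F_A)=\sum_I\omega^I\wedge(d_Au)^*\alpha_I\in\Omega^\ell(P),\qquad \omega^I=(\omega^1)^{i_1}\wedge\cdots\wedge(\omega^m)^{i_m}.$$ (i) For all $\alpha\in\Omega^\ell_G(M)$, $A\in\mathcal A(P)$ and smooth equivariant $u:P\to M$, the form $\alpha(u,A)$ is smooth, equivariant (invariant under pullback by the right translations $p\mapsto pg$, $g\in G$) and horizontal (it vanishes if one argument is of the form $p\xi$). Hence it descends to $X$: there is a unique smooth $\ell$-form on $X$, still denoted by $\alpha(u,A)$, whose pullback under $\pi$ is $\alpha(u,A)$. (ii) If $\alpha\in\Omega^\ell_G(M)$ and $\beta\in\Omega^{\ell+1}_G(M)$ satisfy $d_G\alpha=\beta$,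 then $d\alpha(u,A)=\beta(u,A)$, both on $P$ and on $X$. (iii) Let $\alpha\in\Omega^\ell_G(M)$ with $d_G\alpha=0$, let $A_0,A_1\in\mathcal A(P)$, and let $u_0,u_1:P\to M$ be smooth equivariant maps that are equivariantly homotopic, i.e. joined by a smooth homotopy $[0,1]\times P\to M$ through equivariant maps. Then $\alpha(u_1,A_1)-\alpha(u_0,A_0)$ is an exact $\ell$-form on $X$ (it is $d\gamma$ for some $\gamma\in\Omega^{\ell-1}(X)$; it is zero if $\ell=0$). Consequently, if $X$ is oriented of dimension $k$ and $\alpha\in\Omega^k_G(M)$ is $d_G$-closed, then the pairing $\langle[\alpha],[u]\rangle:=\int_X\alpha(u,A)$ is well defined: if $\alpha'=\alpha+d_G\gamma$ with $\gamma\in\Omega^{k-1}_G(M)$ ($\alpha'=\alpha$ if $k=0$), and $u_0,u_1$ are equivariantly homotopic and $A_0,A_1\in\mathcal A(P)$ as in (iii), then $\int_X\alpha(u_0,A_0)=\int_X\alpha'(u_1,A_1)$. -/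

import Mathlib

open Set Filter Topology MulOpposite
open scoped Manifold ContDiff

namespace EquivariantForms

noncomputable section

/-! ### Exterior algebra of a vector space -/

section Wedge

variable {V : Type*} [AddCommGroup V] [Module ℝ V] [TopologicalSpace V]

/-- The tensor product `f ⊗ g` of two alternating forms of degrees `i` and `j`, `i + j = n`:
`(f ⊗ g)(v₁, …, vₙ) = f(v₁, …, vᵢ) g(vᵢ₊₁, …, vₙ)`. -/
def tensorForm {i j n : ℕ} (h : i + j = n) (f : V [⋀^Fin i]→L[ℝ] ℝ) (g : V [⋀^Fin j]→L[ℝ] ℝ) :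
    ContinuousMultilinearMap ℝ (fun _ : Fin n => V) ℝ where
  toFun v := f (fun a => v (Fin.cast h (Fin.castAdd j a))) *
    g (fun a => v (Fin.cast h (Fin.natAdd i a)))
  map_update_add' := by
    intro _ v k x y
    subst h
    have hd : ‹DecidableEq (Fin (i + j))› = instDecidableEqFin (i + j) := Subsingleton.elim _ _
    subst hd
    induction k using Fin.addCases with
    | left k =>
      have h1 (z : V) : (fun a => Function.update v (Fin.castAdd j k) z
          (Fin.cast rfl (Fin.castAdd j a))) = Function.update (fun a => v (Fin.castAdd j a)) k z := by
        ext a; by_cases ha : a = k <;> simp [ha]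
      have h2 (z : V) : (fun a => Function.update v (Fin.castAdd j k) z
          (Fin.cast rfl (Fin.natAdd i a))) = (fun a => v (Fin.natAdd i a)) := by
        ext a
        have : Fin.natAdd i a ≠ Fin.castAdd j k := by
          intro hh; have := congrArg Fin.val hh; simp at this; omega
        simp [this]
      simp only [h1, h2, f.map_update_add, add_mul]
    | right k =>
      have h1 (z : V) : (fun a => Function.update v (Fin.natAdd i k) z
          (Fin.cast rfl (Fin.natAdd i a))) = Function.update (fun a => v (Fin.natAdd i a)) k z := by
        ext a; by_cases ha : a = k <;> simp [ha]
      have h2 (z : V) : (fun a => Function.update v (Fin.natAdd i k) z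
          (Fin.cast rfl (Fin.castAdd j a))) = (fun a => v (Fin.castAdd j a)) := by
        ext a
        have : Fin.castAdd j a ≠ Fin.natAdd i k := by
          intro hh; have := congrArg Fin.val hh; simp at this; omega
        simp [this]
      simp only [h1, h2, g.map_update_add, mul_add]
  map_update_smul' := by
    intro _ v k c x
    subst h
    have hd : ‹DecidableEq (Fin (i + j))› = instDecidableEqFin (i + j) := Subsingleton.elim _ _
    subst hd
    induction k using Fin.addCases with
    | left k =>
      have h1 (z : V) : (fun a => Function.update v (Fin.castAdd j k) z
          (Fin.cast rfl (Fin.castAdd j a))) = Function.update (fun a => v (Fin.castAdd j a)) k z := by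
        ext a; by_cases ha : a = k <;> simp [ha]
      have h2 (z : V) : (fun a => Function.update v (Fin.castAdd j k) z
          (Fin.cast rfl (Fin.natAdd i a))) = (fun a => v (Fin.natAdd i a)) := by
        ext a
        have : Fin.natAdd i a ≠ Fin.castAdd j k := by
          intro hh; have := congrArg Fin.val hh; simp at this; omega
        simp [this]
      simp only [h1, h2, f.map_update_smul, smul_eq_mul, mul_assoc]
    | right k =>
      have h1 (z : V) : (fun a => Function.update v (Fin.natAdd i k) z
          (Fin.cast rfl (Fin.natAdd i a))) = Function.update (fun a => v (Fin.natAdd i a)) k z := by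
        ext a; by_cases ha : a = k <;> simp [ha]
      have h2 (z : V) : (fun a => Function.update v (Fin.natAdd i k) z
          (Fin.cast rfl (Fin.castAdd j a))) = (fun a => v (Fin.castAdd j a)) := by
        ext a
        have : Fin.castAdd j a ≠ Fin.natAdd i k := by
          intro hh; have := congrArg Fin.val hh; simp at this; omega
        simp [this]
      simp only [h1, h2, g.map_update_smul, smul_eq_mul]
      ring
  cont := by
    refine (f.cont.comp ?_).mul (g.cont.comp ?_) <;> fun_prop

/-- The wedge product of two forms of degrees `i` and `j`, `i + j = n`:
`(f ∧ g)(v₁, …, vₙ) = 1/(i! j!) ∑_σ sign(σ) f(v_{σ1}, …, v_{σi}) g(v_{σ(i+1)}, …, v_{σn})`. -/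
def wedge {i j n : ℕ} (h : i + j = n) (f : V [⋀^Fin i]→L[ℝ] ℝ) (g : V [⋀^Fin j]→L[ℝ] ℝ) :
    V [⋀^Fin n]→L[ℝ] ℝ :=
  ((i.factorial * j.factorial : ℝ)⁻¹) •
    ContinuousMultilinearMap.alternatization (tensorForm h f g)

/-- Left wedge multiplication `β ↦ f ∧ β` of inhomogeneous forms `β = (βₙ)ₙ` by a form `f` of
degree `i`: the component of degree `n` is `f ∧ βₙ₋ᵢ`, and is zero if `n < i`. -/
def wedgeLeft {i : ℕ} (f : V [⋀^Fin i]→L[ℝ] ℝ) (β : ∀ n : ℕ, V [⋀^Fin n]→L[ℝ] ℝ) (n : ℕ) :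
    V [⋀^Fin n]→L[ℝ] ℝ :=
  if h : i ≤ n then wedge (Nat.add_sub_of_le h) f (β (n - i)) else 0

/-- `θ^J ∧ β = (θ¹)^{j₁} ∧ ⋯ ∧ (θᵐ)^{jₘ} ∧ β` for two-forms `θ¹, …, θᵐ`, a multi-index
`J = (j₁, …, jₘ)` and an inhomogeneous form `β`. -/
def monomialWedge {m : ℕ} (θ : Fin m → V [⋀^Fin 2]→L[ℝ] ℝ) (J : Fin m → ℕ)
    (β : ∀ n : ℕ, V [⋀^Fin n]→L[ℝ] ℝ) : ∀ n : ℕ, V [⋀^Fin n]→L[ℝ] ℝ :=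
  (List.finRange m).foldr (fun i γ => (wedgeLeft (θ i))^[J i] γ) β

end Wedge

/-! ### Differential forms on manifolds without boundary

`TangentSpace I x` is by definition the model vector space `E`, and `mfderiv` is the tangent map
under this identification; a differential form is a field of alternating forms on it. -/

section Forms

variable {E : Type*} [NormedAddCommGroup E] [NormedSpace ℝ E]
  {H : Type*} [TopologicalSpace H] (I : ModelWithCorners ℝ E H)
  {M : Type*} [TopologicalSpace M] [ChartedSpace H M]
  {E' : Type*} [NormedAddCommGroup E'] [NormedSpace ℝ E']
  {H' : Type*} [TopologicalSpace H'] (I' : ModelWithCorners ℝ E' H')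
  {N : Type*} [TopologicalSpace N] [ChartedSpace H' N]

/-- (Not necessarily smooth) real `n`-forms on a manifold `M` with model vector space `E`. -/
abbrev DForm (E : Type*) [NormedAddCommGroup E] [NormedSpace ℝ E] (M : Type*) (n : ℕ) :=
  M → E [⋀^Fin n]→L[ℝ] ℝ

/-- The tangent map of `f` at `x`. -/
def tangentMapAt (f : M → N) (x : M) : E →L[ℝ] E' := mfderiv I I' f x

/-- The pullback `f^*θ`. -/
def pullback {n : ℕ} (f : M → N) (θ : DForm E' N n) : DForm E M n :=
  fun x => (θ (f x)).compContinuousLinearMap (tangentMapAt I I' f x)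

/-- The coordinate expression of `θ` in the chart around `c`, i.e. the pullback of `θ` under the
inverse of the chart. -/
def inChart {n : ℕ} (θ : DForm E M n) (c : M) : DForm E E n :=
  pullback 𝓘(ℝ, E) I (extChartAt I c).symm θ

/-- Smooth differential forms. -/
def IsSmoothForm {n : ℕ} (θ : DForm E M n) : Prop :=
  ∀ c : M, ContDiffOn ℝ ∞ (inChart I θ c) (extChartAt I c).target

/-- The exterior derivative `dθ`, computed at `x` in the chart around `x`. -/
def extd {n : ℕ} (θ : DForm E M n) : DForm E M (n + 1) := fun x =>
  (extDeriv (inChart I θ x) (extChartAt I x x)).compContinuousLinearMap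
    (tangentMapAt I 𝓘(ℝ, E) (extChartAt I x) x)

/-- The exterior derivative of an inhomogeneous form `θ = (θₙ)ₙ`. -/
def totalExtd (θ : ∀ n : ℕ, DForm E M n) : ∀ n : ℕ, DForm E M n
  | 0 => 0
  | n + 1 => extd I (θ n)

/-- The interior product of a vector field with an inhomogeneous form. -/
def totalInterior (v : M → E) (θ : ∀ n : ℕ, DForm E M n) (n : ℕ) : DForm E M n :=
  fun x => (θ (n + 1) x).curryLeft (v x)

/-- Exact smooth forms; only `0` is exact in degree `0`. -/
def IsExactForm : ∀ {n : ℕ}, DForm E M n → Prop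
  | 0, θ => θ = 0
  | _ + 1, θ => ∃ γ, IsSmoothForm I γ ∧ θ = extd I γ

end Forms

/-! ### Integration of top-degree forms -/

section Integration

variable {d : ℕ} {X : Type*} [TopologicalSpace X] [ChartedSpace (EuclideanSpace ℝ (Fin d)) X]

/-- A nowhere vanishing smooth form of top degree. It represents the orientation of `X` for which a
frame is positive if and only if the form is positive on it. -/
def IsOrientationForm (vol : DForm (EuclideanSpace ℝ (Fin d)) X d) : Prop :=
  IsSmoothForm (𝓡 d) vol ∧ ∀ x, vol x ≠ 0

/-- The integral `∫_X θ` of a form of top degree with respect to the orientation represented by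
`vol`, computed with a partition of unity `(f c)` subordinate to the charts. The sign is the
orientation character of the coordinate frame of the chart around `c`. -/
def formIntegral (vol : DForm (EuclideanSpace ℝ (Fin d)) X d)
    (f : SmoothPartitionOfUnity X (𝓡 d) X univ) (θ : DForm (EuclideanSpace ℝ (Fin d)) X d) : ℝ :=
  ∑ᶠ c : X, ∫ y in (extChartAt (𝓡 d) c).target,
    f c ((extChartAt (𝓡 d) c).symm y) *
      (SignType.sign (inChart (𝓡 d) vol c y (fun i => EuclideanSpace.single i 1)) : ℝ) *
      inChart (𝓡 d) θ c y (fun i => EuclideanSpace.single i 1)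

end Integration

/-! ### Lie group actions and the Cartan model -/

section Cartan

variable {EG : Type*} [NormedAddCommGroup EG] [NormedSpace ℝ EG]
  {HG : Type*} [TopologicalSpace HG] (IG : ModelWithCorners ℝ EG HG)
  {G : Type*} [TopologicalSpace G] [ChartedSpace HG G] [Group G]
  {EM : Type*} [NormedAddCommGroup EM] [NormedSpace ℝ EM]
  {HM : Type*} [TopologicalSpace HM] (IM : ModelWithCorners ℝ EM HM)
  {M : Type*} [TopologicalSpace M] [ChartedSpace HM M] [MulAction G M]

/-- The adjoint action `ξ ↦ g ξ g⁻¹` on the Lie algebra. -/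
def Ad (g : G) : GroupLieAlgebra IG G →L[ℝ] GroupLieAlgebra IG G :=
  mfderiv IG IG (fun h : G => g * h * g⁻¹) 1

/-- The infinitesimal (left) action `ξ ↦ X_ξ(x)`, the derivative of `g ↦ g x` at the identity. -/
def infAct (G : Type*) [TopologicalSpace G] [ChartedSpace HG G] [Group G] [MulAction G M] (x : M) :
    GroupLieAlgebra IG G →L[ℝ] EM :=
  mfderiv IG IM (fun g : G => g • x) 1

/-- A finite set of multi-indices that contains all `J` with `2 |J| ≤ ℓ`. -/
def multiIndices (m ℓ : ℕ) : Finset (Fin m → ℕ) :=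
  Fintype.piFinset fun _ => Finset.range (ℓ + 1)

/-- The value `∑_J ξ^J α_J` at `ξ = ∑ᵢ ξⁱ eᵢ` of the polynomial with coefficients `α_J`. -/
def polyEval {m : ℕ} (b : Module.Basis (Fin m) ℝ (GroupLieAlgebra IG G)) (ℓ : ℕ)
    (α : (Fin m → ℕ) → ∀ n : ℕ, DForm EM M n) (ξ : GroupLieAlgebra IG G) (n : ℕ) : DForm EM M n :=
  ∑ J ∈ multiIndices m ℓ, (∏ i, b.repr ξ i ^ J i) • α J n

/-- Equivariant differential forms of degree `ℓ` in the Cartan model: polynomials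
`α(ξ) = ∑_J ξ^J α_J` on the Lie algebra, `α_J` a smooth form of degree `ℓ - 2 |J|`, that are
`G`-equivariant, `g^* (α(g ξ g⁻¹)) = α(ξ)`. Here `coeff J n` is the degree `n` part of `α_J`. -/
structure EquivForm {m : ℕ} (b : Module.Basis (Fin m) ℝ (GroupLieAlgebra IG G))
    (M : Type*) [TopologicalSpace M] [ChartedSpace HM M] [MulAction G M] (ℓ : ℕ) where
  coeff : (Fin m → ℕ) → ∀ n : ℕ, DForm EM M n
  smooth : ∀ J n, IsSmoothForm IM (coeff J n)
  degree : ∀ J n, n + 2 * ∑ i, J i ≠ ℓ → coeff J n = 0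
  equivariant : ∀ (g : G) (ξ : GroupLieAlgebra IG G) (n : ℕ),
    pullback IM IM (fun x : M => g • x) (polyEval IG b ℓ coeff (Ad IG g ξ) n) =
      polyEval IG b ℓ coeff ξ n

variable {m : ℕ} {b : Module.Basis (Fin m) ℝ (GroupLieAlgebra IG G)}
variable {IG IM}

/-- The inhomogeneous form `α(ξ)`. -/
def EquivForm.eval {ℓ : ℕ} (α : EquivForm IG IM b M ℓ) (ξ : GroupLieAlgebra IG G) :
    ∀ n : ℕ, DForm EM M n :=
  polyEval IG b ℓ α.coeff ξ

/-- `(d_G α)(ξ) = d(α(ξ)) + ι(X_ξ) α(ξ)`. -/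
def EquivForm.dG {ℓ : ℕ} (α : EquivForm IG IM b M ℓ) (ξ : GroupLieAlgebra IG G) :
    ∀ n : ℕ, DForm EM M n :=
  totalExtd IM (α.eval ξ) + totalInterior (fun x => infAct IG IM G x ξ) (α.eval ξ)

/-- `d_G α = 0`. -/
def EquivForm.IsClosed {ℓ : ℕ} (α : EquivForm IG IM b M ℓ) : Prop :=
  ∀ ξ, α.dG ξ = 0

/-- `α` and `α'` differ by `d_G γ` for some equivariant form `γ` (in degree `0`: they agree). -/
def EquivForm.Cohomologous : ∀ {ℓ : ℕ}, EquivForm IG IM b M ℓ → EquivForm IG IM b M ℓ → Prop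
  | 0, α, α' => ∀ ξ, α'.eval ξ = α.eval ξ
  | ℓ + 1, α, α' => ∃ γ : EquivForm IG IM b M ℓ, ∀ ξ, α'.eval ξ = α.eval ξ + γ.dG ξ

end Cartan

/-! ### Principal bundles and connections -/

section Bundles

variable {EG : Type*} [NormedAddCommGroup EG] [NormedSpace ℝ EG]
  {HG : Type*} [TopologicalSpace HG] (IG : ModelWithCorners ℝ EG HG)
  {G : Type*} [TopologicalSpace G] [ChartedSpace HG G] [Group G]
  {EM : Type*} [NormedAddCommGroup EM] [NormedSpace ℝ EM]
  {HM : Type*} [TopologicalSpace HM] (IM : ModelWithCorners ℝ EM HM)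
  {M : Type*} [TopologicalSpace M] [ChartedSpace HM M] [MulAction G M]
  {EP : Type*} [NormedAddCommGroup EP] [NormedSpace ℝ EP]
  {HP : Type*} [TopologicalSpace HP] (IP : ModelWithCorners ℝ EP HP)
  {P : Type*} [TopologicalSpace P] [ChartedSpace HP P] [MulAction Gᵐᵒᵖ P]
  {EX : Type*} [NormedAddCommGroup EX] [NormedSpace ℝ EX]
  {HX : Type*} [TopologicalSpace HX] (IX : ModelWithCorners ℝ EX HX)
  {X : Type*} [TopologicalSpace X] [ChartedSpace HX X]

/-- `π : P → X` is a smooth principal `G`-bundle. The right action `p g` is `op g • p`. -/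
structure IsPrincipalBundle (G : Type*) [TopologicalSpace G] [ChartedSpace HG G] [Group G]
    [MulAction Gᵐᵒᵖ P] (π : P → X) : Prop where
  smooth_proj : ContMDiff IP IX ∞ π
  smooth_act : ContMDiff (IP.prod IG) IP ∞ (fun q : P × G => op q.2 • q.1)
  proj_act : ∀ (p : P) (g : G), π (op g • p) = π p
  locally_trivial : ∀ x : X, ∃ U : Set X, IsOpen U ∧ x ∈ U ∧
    ∃ e : OpenPartialHomeomorph P (X × G),
      e.source = π ⁻¹' U ∧ e.target = U ×ˢ univ ∧
      ContMDiffOn IP (IX.prod IG) ∞ e e.source ∧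
      ContMDiffOn (IX.prod IG) IP ∞ e.symm e.target ∧
      ∀ p ∈ e.source, (e p).1 = π p ∧ ∀ g : G, e (op g • p) = (π p, (e p).2 * g)

/-- The infinitesimal (right) action `ξ ↦ p ξ`, the derivative of `g ↦ p g` at the identity. -/
def vert (G : Type*) [TopologicalSpace G] [ChartedSpace HG G] [Group G] [MulAction Gᵐᵒᵖ P] (p : P) :
    GroupLieAlgebra IG G →L[ℝ] EP :=
  mfderiv IG IP (fun g : G => op g • p) 1

/-- A form on `P` is equivariant (invariant) if it is preserved by pullback under right
translations. -/
def IsEquivariantForm (G : Type*) [Group G] [MulAction Gᵐᵒᵖ P] {n : ℕ} (θ : DForm EP P n) : Prop :=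
  ∀ g : G, pullback IP IP (fun p : P => op g • p) θ = θ

/-- A form on `P` is horizontal if it vanishes whenever one of its arguments is vertical. -/
def IsHorizontalForm (G : Type*) [TopologicalSpace G] [ChartedSpace HG G] [Group G]
    [MulAction Gᵐᵒᵖ P] {n : ℕ} (θ : DForm EP P n) : Prop :=
  ∀ (p : P) (v : Fin n → EP) (i : Fin n) (ξ : GroupLieAlgebra IG G),
    v i = vert IG IP G p ξ → θ p v = 0

/-- `θ` descends to the smooth form `a` on the base, `π^* a = θ`. -/
def DescendsTo (π : P → X) {n : ℕ} (θ : DForm EP P n) (a : DForm EX X n) : Prop :=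
  IsSmoothForm IX a ∧ pullback IP IX π a = θ

/-- The real one-form `ℓ ∘ A` of a Lie-algebra valued one-form `A` and a linear functional `ℓ`. -/
def component [FiniteDimensional ℝ EP] (A : P → EP →L[ℝ] GroupLieAlgebra IG G)
    (l : GroupLieAlgebra IG G →ₗ[ℝ] ℝ) : DForm EP P 1 :=
  fun p => ContinuousAlternatingMap.ofSubsingleton ℝ EP ℝ (0 : Fin 1)
    (LinearMap.toContinuousLinearMap (l ∘ₗ (A p : EP →ₗ[ℝ] GroupLieAlgebra IG G)))

/-- Connection one-forms on `P`: `A_{ph}(v h) = h⁻¹ A_p(v) h` and `A_p(p ξ) = ξ`. -/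
structure Connection [FiniteDimensional ℝ EP] (G : Type*) [TopologicalSpace G] [ChartedSpace HG G]
    [Group G] (P : Type*) [TopologicalSpace P] [ChartedSpace HP P] [MulAction Gᵐᵒᵖ P] where
  form : P → EP →L[ℝ] GroupLieAlgebra IG G
  smooth : ∀ l : GroupLieAlgebra IG G →ₗ[ℝ] ℝ, IsSmoothForm IP (component IG form l)
  equivariant : ∀ (h : G) (p : P) (v : EP),
    form (op h • p) (tangentMapAt IP IP (fun q : P => op h • q) p v) = Ad IG h⁻¹ (form p v)
  vertical : ∀ (p : P) (ξ : GroupLieAlgebra IG G), form p (vert IG IP G p ξ) = ξ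

/-- Smooth equivariant maps `u : P → M`, `u (p h) = h⁻¹ u(p)`. -/
def IsEquivariantMap (G : Type*) [Group G] [MulAction G M] [MulAction Gᵐᵒᵖ P] (u : P → M) : Prop :=
  ContMDiff IP IM ∞ u ∧ ∀ (p : P) (h : G), u (op h • p) = h⁻¹ • u p

/-- Smooth equivariant homotopy of maps `P → M`, parametrized by `[0,1]`. -/
def EquivariantlyHomotopic (G : Type*) [Group G] [MulAction G M] [MulAction Gᵐᵒᵖ P]
    (u₀ u₁ : P → M) : Prop :=
  ∃ h : ℝ × P → M, ContMDiffOn (𝓘(ℝ, ℝ).prod IP) IM ∞ h (Icc (0 : ℝ) 1 ×ˢ univ) ∧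
    (∀ t ∈ Icc (0 : ℝ) 1, ∀ (p : P) (g : G), h (t, op g • p) = g⁻¹ • h (t, p)) ∧
    (∀ p, h (0, p) = u₀ p) ∧ ∀ p, h (1, p) = u₁ p

variable {m : ℕ} {b : Module.Basis (Fin m) ℝ (GroupLieAlgebra IG G)} [FiniteDimensional ℝ EP]
variable {IG IM IP}

/-- The components `θᵏ` of the curvature `F_A = dA + ½ [A ∧ A] = ∑ₖ θᵏ eₖ`:
`θᵏ = d aᵏ + ½ ∑ᵢⱼ cᵏᵢⱼ aⁱ ∧ aʲ` where `A = ∑ₖ aᵏ eₖ` and `[eᵢ, eⱼ] = ∑ₖ cᵏᵢⱼ eₖ`. -/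
def Connection.curvature (A : Connection IG IP G P)
    (b : Module.Basis (Fin m) ℝ (GroupLieAlgebra IG G)) (k : Fin m) : DForm EP P 2 :=
  fun p => extd IP (component IG A.form (b.coord k)) p +
    (1 / 2 : ℝ) • ∑ i, ∑ j, b.repr ⁅b i, b j⁆ k •
      wedge (rfl : 1 + 1 = 2) (component IG A.form (b.coord i) p) (component IG A.form (b.coord j) p)

variable (IM) in
/-- The covariant derivative `d_A u(p) v = du(p) v + X_{A_p(v)}(u(p))`. -/
def Connection.covDeriv (A : Connection IG IP G P) (u : P → M) (p : P) : EP →L[ℝ] EM :=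
  tangentMapAt IP IM u p + (infAct IG IM G (u p)).comp (A.form p)

/-- `α(u,A) = ((d_A u)^* α)(F_A) = ∑_J θ^J ∧ (d_A u)^* α_J`, a form of degree `ℓ` on `P`. -/
def EquivForm.subst {ℓ : ℕ} (α : EquivForm IG IM b M ℓ) (u : P → M) (A : Connection IG IP G P) :
    DForm EP P ℓ :=
  fun p => (∑ J ∈ multiIndices m ℓ, monomialWedge (fun k => A.curvature b k p) J
    (fun n => (α.coeff J n (u p)).compContinuousLinearMap (A.covDeriv IM u p))) ℓ

end Bundles

end

end EquivariantForms

open EquivariantForms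

namespace EquivariantForms

noncomputable section

open ContinuousAlternatingMap (alternatizeUncurryFin alternatizeUncurryFin_apply curryLeft_apply_apply
  curryLeftLI opNorm_le_bound)

/-! ### Exterior algebra: contraction, product rules, graded commutativity -/

section WedgeAlgebra

variable {V : Type*} [NormedAddCommGroup V] [NormedSpace ℝ V]
  {V' : Type*} [NormedAddCommGroup V'] [NormedSpace ℝ V']

/-! Substitution. Two-forms commute, so the operators "wedge with the curvature component F^k"
generate a commutative algebra, and a real polynomial may be evaluated on them
(`exists_algHom_wedgeOp`). A polynomial identity with vector coefficients that holds for every real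
ξ is an identity of coefficients, hence it survives the substitution of F for ξ
(`sum_apply_eq_sum_apply_of_eval`). This carries the algebra of the theorem: equivariance of the
polynomial α becomes invariance of α(u,A), because translation by g changes F by Ad(g⁻¹) and d_A u
by g⁻¹; and the identity d_G α = β becomes dα(u,A) = β(u,A).

Horizontality. The map d_A u kills pξ because g · u(pg) is constant in g. The curvature kills pξ for
two reasons: on two vertical vectors it is the Maurer–Cartan equation along the orbit; on a vertical
and a horizontal vector, A is constant along the coordinate directions of a plot (z, ζ) ↦ s(z) g(ζ)
(`curvature_curryLeft_vert`). A form that is smooth, invariant and horizontal descends, since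
locally it is recovered from its pullback under a section (`exists_descendsTo`).

The differential. Forms on X can be tested, at one point at a time, on a local section s of P. The
section can be chosen so that s^*A vanishes at the given point y (`exists_horizontal_section`). At y
the terms [A ∧ A] disappear: F pulls back to d(s^*A), and dF pulls back to 0. Moreover s^*(d_A
u)^*α_J is the pullback of α_J under the action plot (z, ζ) ↦ g(ζ) u(s(z)), composed with the linear
map (id, s^*A), which at y differs from the inclusion of the first factor only to first order. Its
derivative at y is therefore the pullback of dα_J plus the sum over k of F^k ∧ ι(X_{e_k}) α_J
(`extDTot_pull_covDeriv`). Multiplying by F^J and summing gives exactly the substitution of F into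
d(α(ξ)) + ι(X_ξ) α(ξ), which is `extDeriv_pullback_subst`. The identity on P follows by pullback
under π.

Homotopy. On the cylinder ℝ × P → ℝ × X the connection (1 - t) A₀ + t A₁ and the homotopy,
reparametrized so as to be defined for all real t, give a form on ℝ × X. It is closed by the
previous part with β = 0, and its slices at t = 0 and t = 1 are the two forms to be compared, by
naturality (`slice_pullback`). Integration over the fibre [0,1] gives a primitive of the difference
(`extd_fiberIntegral`); in degree 0 the form is constant in t.

The pairing. If α' - α = d_G γ, then α'(u,A) - α(u,A) = dγ(u,A). It remains that the integral does
not see the partition of unity, which is the change of variables formula, and that it annihilates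
exact forms, which is Stokes' theorem, reduced by a partition of unity to the vanishing of the
integral of a derivative of a compactly supported function. -/

lemma tensorForm_apply {i j n : ℕ} (h : i + j = n) (f : V [⋀^Fin i]→L[ℝ] ℝ)
    (g : V [⋀^Fin j]→L[ℝ] ℝ) (v : Fin n → V) :
    tensorForm h f g v = f (fun a => v (Fin.cast h (Fin.castAdd j a))) *
      g (fun a => v (Fin.cast h (Fin.natAdd i a))) := rfl

lemma wedge_apply {i j n : ℕ} (h : i + j = n) (f : V [⋀^Fin i]→L[ℝ] ℝ)
    (g : V [⋀^Fin j]→L[ℝ] ℝ) (v : Fin n → V) :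
    wedge h f g v = (i.factorial * j.factorial : ℝ)⁻¹ *
      ∑ σ : Equiv.Perm (Fin n), ((Equiv.Perm.sign σ : ℤ) : ℝ) *
        (f (fun a => v (σ (Fin.cast h (Fin.castAdd j a)))) *
          g (fun a => v (σ (Fin.cast h (Fin.natAdd i a))))) := by
  simp [wedge, ContinuousMultilinearMap.alternatization_apply_apply, tensorForm_apply,
    Units.smul_def]

lemma prod_split {i j n : ℕ} (h : i + j = n) (x : Fin n → ℝ) :
    (∏ a, x (Fin.cast h (Fin.castAdd j a))) * ∏ a, x (Fin.cast h (Fin.natAdd i a)) =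
      ∏ a, x a := by
  subst h
  simp [Fin.prod_univ_add]

/-- The wedge product as a continuous bilinear map. -/
def wedgeCLM {i j n : ℕ} (h : i + j = n) :
    (V [⋀^Fin i]→L[ℝ] ℝ) →L[ℝ] (V [⋀^Fin j]→L[ℝ] ℝ) →L[ℝ] V [⋀^Fin n]→L[ℝ] ℝ :=
  LinearMap.mkContinuous₂
    (LinearMap.mk₂ ℝ (wedge h)
      (fun f f' g => by
        ext v
        simp only [wedge_apply, ContinuousAlternatingMap.add_apply, add_mul, mul_add, Finset.sum_add_distrib])
      (fun c f g => by
        ext v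
        simp only [wedge_apply, ContinuousAlternatingMap.smul_apply, smul_eq_mul, Finset.mul_sum]
        exact Finset.sum_congr rfl fun σ _ => by ring)
      (fun f g g' => by
        ext v
        simp only [wedge_apply, ContinuousAlternatingMap.add_apply, mul_add, Finset.sum_add_distrib])
      (fun c f g => by
        ext v
        simp only [wedge_apply, ContinuousAlternatingMap.smul_apply, smul_eq_mul, Finset.mul_sum]
        exact Finset.sum_congr rfl fun σ _ => by ring))
    ((i.factorial * j.factorial : ℝ)⁻¹ * n.factorial) (fun f g => by
      refine opNorm_le_bound _ (by positivity) fun v => ?_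
      rw [LinearMap.mk₂_apply, wedge_apply, norm_mul, Real.norm_of_nonneg (by positivity),
        mul_assoc, mul_assoc, mul_assoc]
      refine mul_le_mul_of_nonneg_left ?_ (by positivity)
      refine (norm_sum_le _ _).trans ?_
      have key : ∀ σ ∈ (Finset.univ : Finset (Equiv.Perm (Fin n))),
          ‖((Equiv.Perm.sign σ : ℤ) : ℝ) * (f (fun a => v (σ (Fin.cast h (Fin.castAdd j a)))) *
          g (fun a => v (σ (Fin.cast h (Fin.natAdd i a)))))‖ ≤ ‖f‖ * (‖g‖ * ∏ a, ‖v a‖) := by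
        intro σ _
        have hs : ‖((Equiv.Perm.sign σ : ℤ) : ℝ)‖ = 1 := by
          rcases Int.units_eq_one_or (Equiv.Perm.sign σ) with h | h <;> simp [h]
        rw [norm_mul, hs, one_mul, norm_mul]
        have h1 := f.le_opNorm (fun a => v (σ (Fin.cast h (Fin.castAdd j a))))
        have h2 := g.le_opNorm (fun a => v (σ (Fin.cast h (Fin.natAdd i a))))
        have h3 : ∏ a, ‖v a‖ = (∏ a, ‖v (σ (Fin.cast h (Fin.castAdd j a)))‖) *
            ∏ a, ‖v (σ (Fin.cast h (Fin.natAdd i a)))‖ := by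
          rw [prod_split h (fun a => ‖v (σ a)‖), Equiv.prod_comp σ (fun a => ‖v a‖)]
        rw [h3]
        calc _ ≤ _ := mul_le_mul h1 h2 (norm_nonneg _) (by positivity)
          _ = _ := by ring
      refine (Finset.sum_le_card_nsmul _ _ _ key).trans (le_of_eq ?_)
      simp [Fintype.card_perm])

@[simp] lemma wedgeCLM_apply {i j n : ℕ} (h : i + j = n) (f : V [⋀^Fin i]→L[ℝ] ℝ)
    (g : V [⋀^Fin j]→L[ℝ] ℝ) : wedgeCLM h f g = wedge h f g := rfl

lemma wedge_compContinuousLinearMap {i j n : ℕ} (h : i + j = n) (f : V [⋀^Fin i]→L[ℝ] ℝ)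
    (g : V [⋀^Fin j]→L[ℝ] ℝ) (L : V' →L[ℝ] V) :
    (wedge h f g).compContinuousLinearMap L =
      wedge h (f.compContinuousLinearMap L) (g.compContinuousLinearMap L) := by
  ext v
  simp [wedge_apply, Function.comp_def]

/-- Every permutation of `Fin (n + 1)` is uniquely a permutation that fixes `0` followed by the
cycle that moves `0` to a given point. -/
lemma bijective_cycleRange_mul (n : ℕ) :
    Function.Bijective (fun q : Fin (n + 1) × Equiv.Perm (Fin n) =>
      q.1.cycleRange.symm * Equiv.Perm.decomposeFin.symm (0, q.2)) := by
  rw [Fintype.bijective_iff_injective_and_card]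
  refine ⟨?_, by simp [Fintype.card_perm, Nat.factorial_succ]⟩
  rintro ⟨p, e⟩ ⟨p', e'⟩ hq
  have h0 := congrArg (fun σ : Equiv.Perm (Fin (n + 1)) => σ 0) hq
  simp only [Equiv.Perm.mul_apply, Equiv.Perm.decomposeFin_symm_apply_zero,
    Fin.cycleRange_symm_zero] at h0
  subst h0
  have h1 := mul_left_cancel hq
  simpa using h1

/-- Sorting the permutations by the image p of the first slot of f splits the sum into the sign
(-1)^p, a vector v_p fed to f, and a permutation of the remaining vectors. The factor i + 1 is the
quotient of (i + 1)! and i!. The product rules below use this recursion in the degree of f instead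
of sums over permutations. -/
lemma succ_smul_wedge {i j n : ℕ} (h : i + j = n) (h' : i + 1 + j = n + 1)
    (f : V [⋀^Fin (i + 1)]→L[ℝ] ℝ) (g : V [⋀^Fin j]→L[ℝ] ℝ) :
    ((i : ℝ) + 1) • wedge h' f g =
      alternatizeUncurryFin (((wedgeCLM h).flip g).comp f.curryLeft) := by
  ext v
  rw [ContinuousAlternatingMap.smul_apply, wedge_apply, alternatizeUncurryFin_apply, smul_eq_mul, ← mul_assoc,
    ← (bijective_cycleRange_mul n).sum_comp, Fintype.sum_prod_type, Finset.mul_sum]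
  refine Finset.sum_congr rfl fun p _ => ?_
  simp only [ContinuousLinearMap.comp_apply, ContinuousLinearMap.flip_apply, wedgeCLM_apply,
    wedge_apply, Finset.mul_sum, Finset.smul_sum]
  refine Finset.sum_congr rfl fun e _ => ?_
  have hsign : ((Equiv.Perm.sign (p.cycleRange.symm * Equiv.Perm.decomposeFin.symm (0, e)) : ℤ) : ℝ)
      = (-1) ^ (p : ℕ) * ((Equiv.Perm.sign e : ℤ) : ℝ) := by
    rw [Equiv.Perm.sign_mul, Equiv.Perm.decomposeFin.symm_sign, Equiv.Perm.sign_symm,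
      Fin.sign_cycleRange]
    simp
  have hf : (fun a : Fin (i + 1) => v ((p.cycleRange.symm * Equiv.Perm.decomposeFin.symm (0, e))
      (Fin.cast h' (Fin.castAdd j a)))) = Matrix.vecCons (v p)
        (fun a : Fin i => p.removeNth v (e (Fin.cast h (Fin.castAdd j a)))) := by
    ext a
    refine Fin.cases ?_ (fun a => ?_) a
    · have : Fin.cast h' (Fin.castAdd j (0 : Fin (i + 1))) = 0 := by ext; simp
      simp [this]
    · have : Fin.cast h' (Fin.castAdd j a.succ) = (Fin.cast h (Fin.castAdd j a)).succ := by
        ext; simp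
      simp [this, Fin.removeNth, Equiv.Perm.decomposeFin_symm_apply_succ]
  have hg : (fun a : Fin j => v ((p.cycleRange.symm * Equiv.Perm.decomposeFin.symm (0, e))
      (Fin.cast h' (Fin.natAdd (i + 1) a)))) =
        (fun a : Fin j => p.removeNth v (e (Fin.cast h (Fin.natAdd i a)))) := by
    ext a
    have : Fin.cast h' (Fin.natAdd (i + 1) a) = (Fin.cast h (Fin.natAdd i a)).succ := by
      ext; simp; omega
    simp [this, Fin.removeNth, Equiv.Perm.decomposeFin_symm_apply_succ]
  rw [hsign, hf, hg, curryLeft_apply_apply, Nat.factorial_succ]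
  have hi : (i : ℝ) + 1 ≠ 0 := by positivity
  push_cast
  simp only [zsmul_eq_mul, Int.cast_pow, Int.cast_neg, Int.cast_one]
  field_simp

/-- The summand that removes slot 0 is F x; in all others x stays in front and the shift of the
index produces the minus sign. With F the derivative of a form this is the algebra behind Cartan's
formula. -/
lemma curryLeft_alternatizeUncurryFin {n : ℕ} (F : V →L[ℝ] V [⋀^Fin (n + 1)]→L[ℝ] ℝ) (x : V) :
    (alternatizeUncurryFin F).curryLeft x = F x - alternatizeUncurryFin
      (((ContinuousLinearMap.apply ℝ (V [⋀^Fin n]→L[ℝ] ℝ) x).comp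
        (curryLeftLI (𝕜 := ℝ) (E := V) (F := ℝ)).toContinuousLinearMap).comp F) := by
  ext v
  rw [curryLeft_apply_apply, alternatizeUncurryFin_apply, ContinuousAlternatingMap.sub_apply, alternatizeUncurryFin_apply,
    Fin.sum_univ_succ, sub_eq_add_neg, ← Finset.sum_neg_distrib]
  congr 1
  · simp [Fin.removeNth]
  · refine Finset.sum_congr rfl fun k _ => ?_
    have : (k.succ.removeNth (Matrix.vecCons x v) : Fin (n + 1) → V) =
        Matrix.vecCons x (k.removeNth v) := by
      ext a
      refine Fin.cases ?_ (fun a => ?_) a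
      · simp [Fin.removeNth]
      · simp [Fin.removeNth]
    simp [this, pow_succ]

lemma curryLeft_alternatizeUncurryFin_zero (F : V →L[ℝ] V [⋀^Fin 0]→L[ℝ] ℝ) (x : V) :
    (alternatizeUncurryFin F).curryLeft x = F x := by
  ext v
  rw [curryLeft_apply_apply, alternatizeUncurryFin_apply]
  simp [Fin.removeNth]

lemma wedge_zero_left {j : ℕ} (h : 0 + j = j) (f : V [⋀^Fin 0]→L[ℝ] ℝ)
    (g : V [⋀^Fin j]→L[ℝ] ℝ) : wedge h f g = f 0 • g := by
  ext v
  rw [wedge_apply, ContinuousAlternatingMap.smul_apply, smul_eq_mul]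
  have key : ∀ σ : Equiv.Perm (Fin j), ((Equiv.Perm.sign σ : ℤ) : ℝ) *
      (f (fun a => v (σ (Fin.cast h (Fin.castAdd j a)))) *
        g (fun a => v (σ (Fin.cast h (Fin.natAdd 0 a))))) = f 0 * g v := by
    intro σ
    have h1 : (fun a => v (σ (Fin.cast h (Fin.castAdd j a)))) = 0 := Subsingleton.elim _ _
    have h2 : (fun a => v (σ (Fin.cast h (Fin.natAdd 0 a)))) = v ∘ σ := by
      ext a
      congr 2
      ext
      simp
    rw [h1, h2]
    have h3 : g (v ∘ σ) = Equiv.Perm.sign σ • g v := g.toAlternatingMap.map_perm v σ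
    rw [h3]
    rcases Int.units_eq_one_or (Equiv.Perm.sign σ) with h | h <;> simp [h]
  rw [Finset.sum_congr rfl fun σ _ => key σ]
  simp only [Finset.sum_const, Finset.card_univ, Fintype.card_perm, Fintype.card_fin, nsmul_eq_mul,
    Nat.factorial_zero, Nat.cast_one, one_mul]
  have : (j.factorial : ℝ) ≠ 0 := by positivity
  field_simp

/-- Contraction of an inhomogeneous form with a vector. -/
def contract (x : V) (β : ∀ n : ℕ, V [⋀^Fin n]→L[ℝ] ℝ) (n : ℕ) : V [⋀^Fin n]→L[ℝ] ℝ :=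
  (β (n + 1)).curryLeft x

/-- A form of positive degree is determined by its contractions. Identities between wedge products
are proved below by contracting both sides and induction on the degree. -/
lemma form_ext {β γ : ∀ n : ℕ, V [⋀^Fin n]→L[ℝ] ℝ} (n : ℕ)
    (h : ∀ x, contract x β n = contract x γ n) : β (n + 1) = γ (n + 1) := by
  ext v
  have := congrArg (fun f => f (Matrix.vecTail v)) (h (v 0))
  simp only [contract, curryLeft_apply_apply] at this
  rwa [show Matrix.vecCons (v 0) (Matrix.vecTail v) = v from Matrix.cons_head_tail v] at this

/-- Frees the degree of the second factor from the truncated subtraction in the definition: any j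
with i + j = n may be used. -/
lemma wedgeLeft_apply {i j n : ℕ} (h : i + j = n) (f : V [⋀^Fin i]→L[ℝ] ℝ)
    (β : ∀ n : ℕ, V [⋀^Fin n]→L[ℝ] ℝ) : wedgeLeft f β n = wedge h f (β j) := by
  subst h
  have : ∀ k (hk : i + k = i + j), wedge hk f (β k) = wedge rfl f (β j) := by
    intro k hk
    obtain rfl : k = j := by omega
    rfl
  simp only [wedgeLeft, Nat.le_add_right, dite_true]
  exact this _ _

lemma wedgeLeft_apply_of_lt {i n : ℕ} (h : n < i) (f : V [⋀^Fin i]→L[ℝ] ℝ)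
    (β : ∀ n : ℕ, V [⋀^Fin n]→L[ℝ] ℝ) : wedgeLeft f β n = 0 := by
  simp [wedgeLeft, h]

/-- The degree `n` part of `f ∧ β` as a continuous linear function of `f`. -/
def wedgeLeftCLM (i n : ℕ) (β : ∀ n : ℕ, V [⋀^Fin n]→L[ℝ] ℝ) :
    (V [⋀^Fin i]→L[ℝ] ℝ) →L[ℝ] V [⋀^Fin n]→L[ℝ] ℝ :=
  if h : i ≤ n then (wedgeCLM (Nat.add_sub_of_le h)).flip (β (n - i)) else 0

@[simp] lemma wedgeLeftCLM_apply {i n : ℕ} (β : ∀ n : ℕ, V [⋀^Fin n]→L[ℝ] ℝ)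
    (f : V [⋀^Fin i]→L[ℝ] ℝ) : wedgeLeftCLM i n β f = wedgeLeft f β n := by
  by_cases h : i ≤ n <;> simp [wedgeLeftCLM, wedgeLeft, h]

/-- The operator `β ↦ f ∧ β`, linear in `f`. -/
def wedgeOp (i : ℕ) : (V [⋀^Fin i]→L[ℝ] ℝ) →ₗ[ℝ]
    Module.End ℝ (∀ n : ℕ, V [⋀^Fin n]→L[ℝ] ℝ) where
  toFun f :=
    { toFun := wedgeLeft f
      map_add' := fun β γ => by
        ext1 n
        by_cases h : i ≤ n
        · simpa [wedgeLeft, h] using ((wedgeCLM (V := V) (Nat.add_sub_of_le h)) f).map_add _ _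
        · simp [wedgeLeft, h]
      map_smul' := fun c β => by
        ext1 n
        by_cases h : i ≤ n
        · simp only [wedgeLeft, h, dite_true, Pi.smul_apply, RingHom.id_apply]
          exact ((wedgeCLM (V := V) (Nat.add_sub_of_le h)) f).map_smul c _
        · simp [wedgeLeft, h] }
  map_add' f g := by
    refine LinearMap.ext fun β => funext fun n => ?_
    simpa using (wedgeLeftCLM i n β).map_add f g
  map_smul' c f := by
    refine LinearMap.ext fun β => funext fun n => ?_
    have := (wedgeLeftCLM i n β).map_smul c f
    rwa [wedgeLeftCLM_apply, wedgeLeftCLM_apply] at this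

@[simp] lemma wedgeOp_apply {i : ℕ} (f : V [⋀^Fin i]→L[ℝ] ℝ)
    (β : ∀ n : ℕ, V [⋀^Fin n]→L[ℝ] ℝ) : wedgeOp i f β = wedgeLeft f β := rfl

lemma succ_smul_wedgeLeft {i : ℕ} (f : V [⋀^Fin (i + 1)]→L[ℝ] ℝ)
    (β : ∀ n : ℕ, V [⋀^Fin n]→L[ℝ] ℝ) (n : ℕ) :
    ((i : ℝ) + 1) • wedgeLeft f β (n + 1) =
      alternatizeUncurryFin ((wedgeLeftCLM i n β).comp f.curryLeft) := by
  by_cases h : i ≤ n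
  · rw [wedgeLeft_apply (show i + 1 + (n - i) = n + 1 by omega),
      succ_smul_wedge (show i + (n - i) = n by omega)]
    simp [wedgeLeftCLM, h]
  · rw [wedgeLeft_apply_of_lt (by omega)]
    have : (wedgeLeftCLM i n β).comp f.curryLeft = 0 := by simp [wedgeLeftCLM, h]
    rw [this, smul_zero]
    exact (map_zero (ContinuousAlternatingMap.alternatizeUncurryFinCLM ℝ V ℝ)).symm

lemma wedgeLeft_zero_deg (f : V [⋀^Fin 0]→L[ℝ] ℝ) (β : ∀ n : ℕ, V [⋀^Fin n]→L[ℝ] ℝ) :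
    wedgeLeft f β = f 0 • β := by
  ext1 n
  rw [wedgeLeft_apply (Nat.zero_add n), wedge_zero_left]
  rfl

lemma curryLeft_curryLeft_swap {i : ℕ} (f : V [⋀^Fin (i + 2)]→L[ℝ] ℝ) (x y : V) :
    (f.curryLeft x).curryLeft y = -(f.curryLeft y).curryLeft x := by
  have h := f.curryLeft_same (x + y)
  simp only [map_add, ContinuousAlternatingMap.curryLeft_add, ContinuousLinearMap.add_apply,
    ContinuousAlternatingMap.curryLeft_same, zero_add, add_zero] at h
  exact eq_neg_of_add_eq_zero_right h

/-- Contraction is an antiderivation. Induction on the degree of f: up to a factor, f ∧ β is the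
alternatization of v ↦ ι_v f ∧ β, to which the induction hypothesis applies, and ι_x ι_v = - ι_v
ι_x. -/
lemma contract_wedgeLeft {i : ℕ} (f : V [⋀^Fin (i + 1)]→L[ℝ] ℝ) (x : V)
    (β : ∀ n : ℕ, V [⋀^Fin n]→L[ℝ] ℝ) :
    contract x (wedgeLeft f β) =
      wedgeLeft (f.curryLeft x) β + (-1 : ℝ) ^ (i + 1) • wedgeLeft f (contract x β) := by
  induction i generalizing β with
  | zero =>
    ext1 n
    have h1 : wedgeLeft f β (n + 1) =
        alternatizeUncurryFin ((wedgeLeftCLM 0 n β).comp f.curryLeft) := by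
      simpa using succ_smul_wedgeLeft f β n
    rw [contract, h1]
    cases n with
    | zero =>
      rw [curryLeft_alternatizeUncurryFin_zero]
      simp [wedgeLeft_apply_of_lt (show 0 < 1 by omega)]
    | succ n =>
      have h2 : wedgeLeft f (contract x β) (n + 1) =
          alternatizeUncurryFin ((wedgeLeftCLM 0 n (contract x β)).comp f.curryLeft) := by
        simpa using succ_smul_wedgeLeft f (contract x β) n
      rw [curryLeft_alternatizeUncurryFin]
      simp only [Pi.add_apply, Pi.smul_apply, h2]
      have h6 : ((ContinuousLinearMap.apply ℝ (V [⋀^Fin n]→L[ℝ] ℝ) x).comp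
          (curryLeftLI (𝕜 := ℝ) (E := V) (F := ℝ)).toContinuousLinearMap).comp
            ((wedgeLeftCLM 0 (n + 1) β).comp f.curryLeft) =
          (wedgeLeftCLM 0 n (contract x β)).comp f.curryLeft := by
        ext1 v
        simp [wedgeLeft_zero_deg, contract]
      rw [h6, ContinuousLinearMap.comp_apply, wedgeLeftCLM_apply]
      module
  | succ i ih =>
    ext1 n
    have hi : ((i + 1 : ℕ) : ℝ) + 1 ≠ 0 := by positivity
    -- Multiplication by the degree i + 2 of f makes the recursion applicable. On the other side
    -- (ι_x f) ∧ β occurs once from the first term and i + 1 times from the alternatization.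
    apply smul_right_injective _ hi
    simp only
    have h0 : (((i + 1 : ℕ) : ℝ) + 1) • contract x (wedgeLeft f β) n =
        ((((i + 1 : ℕ) : ℝ) + 1) • wedgeLeft f β (n + 1)).curryLeft x := by
      rw [ContinuousAlternatingMap.curryLeft_smul]; rfl
    rw [h0, succ_smul_wedgeLeft]
    cases n with
    | zero =>
      rw [curryLeft_alternatizeUncurryFin_zero]
      simp [wedgeLeft_apply_of_lt (show 0 < i + 1 + 1 by omega),
        wedgeLeft_apply_of_lt (show 0 < i + 1 by omega)]
    | succ n =>
      rw [curryLeft_alternatizeUncurryFin]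
      have h3 : (((ContinuousLinearMap.apply ℝ (V [⋀^Fin n]→L[ℝ] ℝ) x).comp
          (curryLeftLI (𝕜 := ℝ) (E := V) (F := ℝ)).toContinuousLinearMap).comp
            ((wedgeLeftCLM (i + 1) (n + 1) β).comp f.curryLeft)) =
          -((wedgeLeftCLM i n β).comp (f.curryLeft x).curryLeft) + (-1 : ℝ) ^ (i + 1) •
            ((wedgeLeftCLM (i + 1) n (contract x β)).comp f.curryLeft) := by
        ext1 v
        have := congrFun (ih (f.curryLeft v) β) n
        simp only [contract, curryLeft_curryLeft_swap f v x, Pi.add_apply, Pi.smul_apply] at this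
        simp only [ContinuousLinearMap.comp_apply, ContinuousLinearMap.add_apply,
          ContinuousLinearMap.neg_apply, ContinuousLinearMap.smul_apply, wedgeLeftCLM_apply]
        have h4 : wedgeLeft (-((f.curryLeft x).curryLeft v)) β n =
            - wedgeLeft ((f.curryLeft x).curryLeft v) β n := by
          rw [← wedgeLeftCLM_apply, map_neg, wedgeLeftCLM_apply]
        rw [h4] at this
        exact this
      rw [h3, ContinuousAlternatingMap.alternatizeUncurryFin_add,
        ContinuousAlternatingMap.alternatizeUncurryFin_smul, ← succ_smul_wedgeLeft,
        ← ContinuousAlternatingMap.alternatizeUncurryFinCLM_apply, map_neg,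
        ContinuousAlternatingMap.alternatizeUncurryFinCLM_apply, ← succ_smul_wedgeLeft]
      simp only [Pi.add_apply, Pi.smul_apply, ContinuousLinearMap.comp_apply, wedgeLeftCLM_apply]
      push_cast
      module

lemma contract_wedgeLeft_one (a : V [⋀^Fin 1]→L[ℝ] ℝ) (x : V)
    (β : ∀ n : ℕ, V [⋀^Fin n]→L[ℝ] ℝ) :
    contract x (wedgeLeft a β) = a (fun _ => x) • β - wedgeLeft a (contract x β) := by
  rw [contract_wedgeLeft, wedgeLeft_zero_deg, curryLeft_apply_apply]
  rw [show (Matrix.vecCons x 0 : Fin 1 → V) = fun _ => x by ext k; simp]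
  module

lemma contract_wedgeLeft_two (f : V [⋀^Fin 2]→L[ℝ] ℝ) (x : V)
    (β : ∀ n : ℕ, V [⋀^Fin n]→L[ℝ] ℝ) :
    contract x (wedgeLeft f β) = wedgeLeft (f.curryLeft x) β + wedgeLeft f (contract x β) := by
  rw [contract_wedgeLeft]
  norm_num

lemma contract_add (x : V) (β γ : ∀ n : ℕ, V [⋀^Fin n]→L[ℝ] ℝ) :
    contract x (β + γ) = contract x β + contract x γ := rfl

lemma contract_smul (x : V) (c : ℝ) (β : ∀ n : ℕ, V [⋀^Fin n]→L[ℝ] ℝ) :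
    contract x (c • β) = c • contract x β := rfl

lemma contract_neg (x : V) (β : ∀ n : ℕ, V [⋀^Fin n]→L[ℝ] ℝ) :
    contract x (-β) = -contract x β := rfl

lemma wedgeLeft_add {i : ℕ} (f : V [⋀^Fin i]→L[ℝ] ℝ) (β γ : ∀ n : ℕ, V [⋀^Fin n]→L[ℝ] ℝ) :
    wedgeLeft f (β + γ) = wedgeLeft f β + wedgeLeft f γ := (wedgeOp i f).map_add β γ

lemma wedgeLeft_sub {i : ℕ} (f : V [⋀^Fin i]→L[ℝ] ℝ) (β γ : ∀ n : ℕ, V [⋀^Fin n]→L[ℝ] ℝ) :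
    wedgeLeft f (β - γ) = wedgeLeft f β - wedgeLeft f γ := (wedgeOp i f).map_sub β γ

lemma wedgeLeft_smul {i : ℕ} (f : V [⋀^Fin i]→L[ℝ] ℝ) (c : ℝ)
    (β : ∀ n : ℕ, V [⋀^Fin n]→L[ℝ] ℝ) :
    wedgeLeft f (c • β) = c • wedgeLeft f β := (wedgeOp i f).map_smul c β

/-- Contracting with x reduces the claim to the same claim for ι_x β, one degree lower; the
remaining terms cancel in pairs. -/
lemma wedgeLeft_one_one (a c : V [⋀^Fin 1]→L[ℝ] ℝ) (β : ∀ n : ℕ, V [⋀^Fin n]→L[ℝ] ℝ) :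
    wedgeLeft a (wedgeLeft c β) = - wedgeLeft c (wedgeLeft a β) := by
  ext1 n
  induction n generalizing β with
  | zero => simp [wedgeLeft_apply_of_lt]
  | succ n ih =>
    refine form_ext n fun x => ?_
    simp only [contract_wedgeLeft_one, contract_neg, wedgeLeft_sub, wedgeLeft_smul, Pi.sub_apply,
      Pi.neg_apply, Pi.smul_apply, ih (contract x β)]
    module

lemma wedgeLeft_one_two (a : V [⋀^Fin 1]→L[ℝ] ℝ) (f : V [⋀^Fin 2]→L[ℝ] ℝ)
    (β : ∀ n : ℕ, V [⋀^Fin n]→L[ℝ] ℝ) :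
    wedgeLeft a (wedgeLeft f β) = wedgeLeft f (wedgeLeft a β) := by
  ext1 n
  induction n generalizing β with
  | zero => simp [wedgeLeft_apply_of_lt]
  | succ n ih =>
    refine form_ext n fun x => ?_
    simp only [contract_wedgeLeft_one, contract_wedgeLeft_two, wedgeLeft_sub, wedgeLeft_smul,
      wedgeLeft_add, Pi.sub_apply, Pi.add_apply, Pi.smul_apply, ih (contract x β),
      wedgeLeft_one_one a (f.curryLeft x), Pi.neg_apply]
    module

/-- Commutativity of even forms is what permits the substitution of curvature components for the
variables of a polynomial. -/
lemma wedgeLeft_two_two (f g : V [⋀^Fin 2]→L[ℝ] ℝ) (β : ∀ n : ℕ, V [⋀^Fin n]→L[ℝ] ℝ) :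
    wedgeLeft f (wedgeLeft g β) = wedgeLeft g (wedgeLeft f β) := by
  ext1 n
  induction n generalizing β with
  | zero => simp [wedgeLeft_apply_of_lt]
  | succ n ih =>
    refine form_ext n fun x => ?_
    simp only [contract_wedgeLeft_two, wedgeLeft_add, Pi.add_apply, ih (contract x β),
      wedgeLeft_one_two (f.curryLeft x) g, wedgeLeft_one_two (g.curryLeft x) f]
    module

/-- A homogeneous form as an inhomogeneous form. -/
def single {i : ℕ} (f : V [⋀^Fin i]→L[ℝ] ℝ) : ∀ n : ℕ, V [⋀^Fin n]→L[ℝ] ℝ :=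
  Pi.single i f

end WedgeAlgebra

end

end EquivariantForms

namespace EquivariantForms

noncomputable section

open ContinuousAlternatingMap (alternatizeUncurryFin alternatizeUncurryFin_apply curryLeft_apply_apply
  curryLeftLI opNorm_le_bound)

/-! ### Pullback of inhomogeneous forms under linear maps -/

section Pull

variable {V : Type*} [NormedAddCommGroup V] [NormedSpace ℝ V]
  {V' : Type*} [NormedAddCommGroup V'] [NormedSpace ℝ V']

/-- The pullback of inhomogeneous forms under a linear map. -/
def pull (L : V' →L[ℝ] V) :
    (∀ n : ℕ, V [⋀^Fin n]→L[ℝ] ℝ) →ₗ[ℝ] ∀ n : ℕ, V' [⋀^Fin n]→L[ℝ] ℝ where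
  toFun β n := (β n).compContinuousLinearMap L
  map_add' _ _ := rfl
  map_smul' _ _ := rfl

lemma pull_apply (L : V' →L[ℝ] V) (β : ∀ n : ℕ, V [⋀^Fin n]→L[ℝ] ℝ) (n : ℕ) :
    pull L β n = (β n).compContinuousLinearMap L := rfl

lemma pull_wedgeLeft {i : ℕ} (L : V' →L[ℝ] V) (f : V [⋀^Fin i]→L[ℝ] ℝ)
    (β : ∀ n : ℕ, V [⋀^Fin n]→L[ℝ] ℝ) :
    pull L (wedgeLeft f β) = wedgeLeft (f.compContinuousLinearMap L) (pull L β) := by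
  ext1 n
  by_cases h : i ≤ n
  · simp [pull_apply, wedgeLeft, h, wedge_compContinuousLinearMap]
  · rw [pull_apply, wedgeLeft_apply_of_lt (by omega), wedgeLeft_apply_of_lt (by omega)]
    rfl

lemma pull_monomialWedge {m : ℕ} (L : V' →L[ℝ] V) (θ : Fin m → V [⋀^Fin 2]→L[ℝ] ℝ)
    (J : Fin m → ℕ) (β : ∀ n : ℕ, V [⋀^Fin n]→L[ℝ] ℝ) :
    pull L (monomialWedge θ J β) =
      monomialWedge (fun k => (θ k).compContinuousLinearMap L) J (pull L β) := by
  unfold monomialWedge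
  induction List.finRange m with
  | nil => rfl
  | cons i l ih =>
    simp only [List.foldr_cons]
    rw [← ih]
    generalize List.foldr _ β l = γ
    induction J i with
    | zero => rfl
    | succ k ih' =>
      rw [Function.iterate_succ_apply', Function.iterate_succ_apply', pull_wedgeLeft, ih']

lemma contract_pull (L : V' →L[ℝ] V) (x : V') (β : ∀ n : ℕ, V [⋀^Fin n]→L[ℝ] ℝ) :
    contract x (pull L β) = pull L (contract (L x) β) := by
  ext1 n
  exact ContinuousAlternatingMap.curryLeft_compContinuousLinearMap _ _ _

lemma contract_smul_left (c : ℝ) (x : V) (β : ∀ n : ℕ, V [⋀^Fin n]→L[ℝ] ℝ) :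
    contract (c • x) β = c • contract x β := by
  ext1 n
  simp [contract]

lemma contract_add_left (x y : V) (β : ∀ n : ℕ, V [⋀^Fin n]→L[ℝ] ℝ) :
    contract (x + y) β = contract x β + contract y β := by
  ext1 n
  simp [contract]

lemma contract_contract (x y : V) (β : ∀ n : ℕ, V [⋀^Fin n]→L[ℝ] ℝ) :
    contract x (contract y β) = - contract y (contract x β) := by
  ext1 n
  exact curryLeft_curryLeft_swap _ _ _

lemma contract_self (x : V) (β : ∀ n : ℕ, V [⋀^Fin n]→L[ℝ] ℝ) :
    contract x (contract x β) = 0 := by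
  ext1 n
  exact ContinuousAlternatingMap.curryLeft_same _ _

/-- Pullback under a rank one perturbation of a linear map. -/
lemma pull_add_smulRight (L : V' →L[ℝ] V) (a : V' →L[ℝ] ℝ) (X : V)
    (β : ∀ n : ℕ, V [⋀^Fin n]→L[ℝ] ℝ) :
    pull (L + a.smulRight X) β = pull L β + wedgeLeft
      (ContinuousAlternatingMap.ofSubsingleton ℝ V' ℝ (0 : Fin 1) a) (pull L (contract X β)) := by
  ext1 n
  induction n generalizing β with
  | zero =>
    ext v
    rw [Pi.add_apply, wedgeLeft_apply_of_lt (by omega), add_zero, pull_apply, pull_apply,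
      ContinuousAlternatingMap.compContinuousLinearMap_apply,
      ContinuousAlternatingMap.compContinuousLinearMap_apply]
    congr 1
    exact Subsingleton.elim _ _
  | succ n ih =>
    refine form_ext n fun x => ?_
    rw [contract_add, contract_wedgeLeft_one, contract_pull, contract_pull, contract_pull]
    have h1 : (L + a.smulRight X) x = L x + a x • X := by simp
    rw [h1, contract_add_left, contract_smul_left, contract_contract (L x) X]
    -- The induction hypothesis is applied to ι_{Lx} β and to ι_X β. The expansion stops after the
    -- term linear in a because ι_X ι_X = 0.
    simp only [map_add, map_smul, map_neg, Pi.add_apply, Pi.smul_apply, ih, Pi.sub_apply,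
      contract_add, contract_smul, contract_self, map_zero, smul_zero, add_zero]
    have h2 := (wedgeOp 1 (ContinuousAlternatingMap.ofSubsingleton ℝ V' ℝ (0 : Fin 1) a)).map_neg
      (pull L (contract X (contract (L x) β)))
    simp only [wedgeOp_apply] at h2
    rw [h2]
    simp
    abel

end Pull

/-! ### The Leibniz rule for inhomogeneous forms on a vector space -/

section Leibniz

variable {V : Type*} [NormedAddCommGroup V] [NormedSpace ℝ V]

/-- Alternatization of an inhomogeneous form that depends linearly on an additional vector. -/
def altTot (G : ∀ n : ℕ, V →L[ℝ] V [⋀^Fin n]→L[ℝ] ℝ) : ∀ n : ℕ, V [⋀^Fin n]→L[ℝ] ℝ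
  | 0 => 0
  | n + 1 => alternatizeUncurryFin (G n)

/-- Contraction with `x` of a form with values in a space of linear maps. -/
def contractCLM (x : V) (n : ℕ) : (V [⋀^Fin (n + 1)]→L[ℝ] ℝ) →L[ℝ] V [⋀^Fin n]→L[ℝ] ℝ :=
  (ContinuousLinearMap.apply ℝ (V [⋀^Fin n]→L[ℝ] ℝ) x).comp
    (curryLeftLI (𝕜 := ℝ) (E := V) (F := ℝ)).toContinuousLinearMap

lemma contractCLM_apply (x : V) (n : ℕ) (f : V [⋀^Fin (n + 1)]→L[ℝ] ℝ) :
    contractCLM x n f = f.curryLeft x := rfl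

/-- The formula for contracting an alternatization, uniform in the degree: in degree 0 the
correction term is absent, which matches the value 0 of `altTot` there. -/
lemma contract_altTot (x : V) (G : ∀ n : ℕ, V →L[ℝ] V [⋀^Fin n]→L[ℝ] ℝ) :
    contract x (altTot G) =
      (fun n => G n x) - altTot (fun n => (contractCLM x n).comp (G (n + 1))) := by
  ext1 n
  cases n with
  | zero => simp [contract, altTot, curryLeft_alternatizeUncurryFin_zero]
  | succ n => simp [contract, altTot, curryLeft_alternatizeUncurryFin, contractCLM]

/-- The half of the Leibniz rule in which the left factor is differentiated; no sign arises because
the differentiating vector already stands in front. -/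
lemma alternatizeUncurryFin_wedgeLeft {i : ℕ} (F : V →L[ℝ] V [⋀^Fin i]→L[ℝ] ℝ)
    (β : ∀ n : ℕ, V [⋀^Fin n]→L[ℝ] ℝ) :
    altTot (fun n => (wedgeLeftCLM i n β).comp F) = wedgeLeft (alternatizeUncurryFin F) β := by
  ext1 n
  induction n generalizing β i with
  | zero => rw [wedgeLeft_apply_of_lt (by omega)]; rfl
  | succ n ih =>
    refine form_ext n fun x => ?_
    rw [contract_altTot, contract_wedgeLeft]
    cases i with
    | zero =>
      have h1 : (fun n => (contractCLM x n).comp ((wedgeLeftCLM 0 (n + 1) β).comp F)) =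
          fun n => (wedgeLeftCLM 0 n (contract x β)).comp F := by
        ext1 k
        ext1 v
        simp [wedgeLeft_zero_deg, contract, contractCLM_apply]
      rw [h1, curryLeft_alternatizeUncurryFin_zero]
      simp only [Pi.sub_apply, Pi.add_apply, Pi.smul_apply, ih F (contract x β),
        ContinuousLinearMap.comp_apply, wedgeLeftCLM_apply]
      module
    | succ i =>
      have h1 : (fun n => (contractCLM x n).comp ((wedgeLeftCLM (i + 1) (n + 1) β).comp F)) =
          fun n => (wedgeLeftCLM i n β).comp ((contractCLM x i).comp F) +
            (-1 : ℝ) ^ (i + 1) • (wedgeLeftCLM (i + 1) n (contract x β)).comp F := by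
        ext1 k
        ext1 v
        have := congrFun (contract_wedgeLeft (F v) x β) k
        simpa [contract, contractCLM_apply] using this
      have h2 : altTot (fun n => (wedgeLeftCLM i n β).comp ((contractCLM x i).comp F) +
            (-1 : ℝ) ^ (i + 1) • (wedgeLeftCLM (i + 1) n (contract x β)).comp F) =
          altTot (fun n => (wedgeLeftCLM i n β).comp ((contractCLM x i).comp F)) +
          (-1 : ℝ) ^ (i + 1) • altTot (fun n => (wedgeLeftCLM (i + 1) n (contract x β)).comp F) := by
        ext1 k
        cases k with
        | zero => simp [altTot]
        | succ k =>
          simp only [altTot, ContinuousAlternatingMap.alternatizeUncurryFin_add, Pi.add_apply,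
            ContinuousAlternatingMap.alternatizeUncurryFin_smul, Pi.smul_apply]
      have h3 : (alternatizeUncurryFin F).curryLeft x =
          F x - alternatizeUncurryFin ((contractCLM x i).comp F) :=
        curryLeft_alternatizeUncurryFin F x
      rw [h1, h2, h3]
      simp only [Pi.sub_apply, Pi.add_apply, Pi.smul_apply, ih F (contract x β),
        ih ((contractCLM x i).comp F) β,
        ContinuousLinearMap.comp_apply, wedgeLeftCLM_apply, ← wedgeOp_apply (i := i + 1) _ β,
        map_sub, LinearMap.sub_apply]
      simp only [wedgeOp_apply]
      rw [pow_succ _ (i + 1)]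
      module

/-- The map `v ↦ f ∧ G(v)` in degree `n`. -/
def wedgeRightCLM {i : ℕ} (f : V [⋀^Fin i]→L[ℝ] ℝ) (G : ∀ n : ℕ, V →L[ℝ] V [⋀^Fin n]→L[ℝ] ℝ)
    (n : ℕ) : V →L[ℝ] V [⋀^Fin n]→L[ℝ] ℝ :=
  if h : i ≤ n then (wedgeCLM (Nat.add_sub_of_le h) f).comp (G (n - i)) else 0

lemma wedgeRightCLM_apply {i : ℕ} (f : V [⋀^Fin i]→L[ℝ] ℝ)
    (G : ∀ n : ℕ, V →L[ℝ] V [⋀^Fin n]→L[ℝ] ℝ) (n : ℕ) (v : V) :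
    wedgeRightCLM f G n v = wedgeLeft f (fun k => G k v) n := by
  by_cases h : i ≤ n <;> simp [wedgeRightCLM, wedgeLeft, h]

lemma altTot_add (G G' : ∀ n : ℕ, V →L[ℝ] V [⋀^Fin n]→L[ℝ] ℝ) :
    altTot (fun n => G n + G' n) = altTot G + altTot G' := by
  ext1 k
  cases k with
  | zero => simp [altTot]
  | succ k => simp only [altTot, ContinuousAlternatingMap.alternatizeUncurryFin_add, Pi.add_apply]

lemma altTot_smul (c : ℝ) (G : ∀ n : ℕ, V →L[ℝ] V [⋀^Fin n]→L[ℝ] ℝ) :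
    altTot (fun n => c • G n) = c • altTot G := by
  ext1 k
  cases k with
  | zero => simp [altTot]
  | succ k => simp only [altTot, ContinuousAlternatingMap.alternatizeUncurryFin_smul, Pi.smul_apply]

/-- The other half: the differentiating vector has to move past the i slots of f, whence the sign.
-/
lemma altTot_wedgeRightCLM {i : ℕ} (f : V [⋀^Fin i]→L[ℝ] ℝ)
    (G : ∀ n : ℕ, V →L[ℝ] V [⋀^Fin n]→L[ℝ] ℝ) :
    altTot (wedgeRightCLM f G) = (-1 : ℝ) ^ i • wedgeLeft f (altTot G) := by
  ext1 n
  induction n generalizing i G with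
  | zero =>
    cases i with
    | zero => simp [wedgeLeft_zero_deg, altTot]
    | succ i => rw [Pi.smul_apply, wedgeLeft_apply_of_lt (by omega), smul_zero]; rfl
  | succ n ih =>
    refine form_ext n fun x => ?_
    rw [contract_altTot, contract_smul]
    have h0 : (fun k => wedgeRightCLM f G k x) = wedgeLeft f (fun k => G k x) := by
      ext1 k
      rw [wedgeRightCLM_apply]
    cases i with
    | zero =>
      have h1 : (fun n => (contractCLM x n).comp (wedgeRightCLM f G (n + 1))) =
          wedgeRightCLM f (fun n => (contractCLM x n).comp (G (n + 1))) := by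
        ext1 k
        ext1 v
        simp [wedgeLeft_zero_deg, wedgeRightCLM_apply, contractCLM_apply]
      rw [h0, h1]
      simp only [Pi.sub_apply, ih, Pi.smul_apply]
      simp only [wedgeLeft_zero_deg, contract_smul, contract_altTot]
      simp only [Pi.sub_apply, Pi.smul_apply]
      module
    | succ i =>
      have h1 : (fun n => (contractCLM x n).comp (wedgeRightCLM f G (n + 1))) =
          fun n => wedgeRightCLM (f.curryLeft x) G n +
            (-1 : ℝ) ^ (i + 1) •
              wedgeRightCLM f (fun n => (contractCLM x n).comp (G (n + 1))) n := by
        ext1 k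
        ext1 v
        have := congrFun (contract_wedgeLeft f x (fun k => G k v)) k
        simp only [ContinuousLinearMap.comp_apply, ContinuousLinearMap.add_apply,
          ContinuousLinearMap.smul_apply, wedgeRightCLM_apply, contractCLM_apply]
        exact this
      rw [h0, h1, altTot_add, altTot_smul, contract_wedgeLeft, contract_altTot, wedgeLeft_sub]
      simp only [Pi.sub_apply, Pi.add_apply, ih, Pi.smul_apply]
      have hs : ((-1 : ℝ) ^ (i + 1)) * (-1) ^ (i + 1) = 1 := by
        rw [← mul_pow]; norm_num
      simp only [smul_add, smul_smul, hs, one_smul, smul_sub]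
      rw [pow_succ]
      module

/-- The exterior derivative of an inhomogeneous form on a vector space. -/
def extDTot (β : V → ∀ n : ℕ, V [⋀^Fin n]→L[ℝ] ℝ) (y : V) : ∀ n : ℕ, V [⋀^Fin n]→L[ℝ] ℝ :=
  altTot (fun n => fderiv ℝ (fun z => β z n) y)

lemma extDTot_succ (β : V → ∀ n : ℕ, V [⋀^Fin n]→L[ℝ] ℝ) (y : V) (n : ℕ) :
    extDTot β y (n + 1) = extDeriv (fun z => β z n) y := rfl

lemma hasFDerivAt_wedgeLeft {i : ℕ} {f : V → V [⋀^Fin i]→L[ℝ] ℝ}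
    {β : V → ∀ n : ℕ, V [⋀^Fin n]→L[ℝ] ℝ} {y : V} (hf : DifferentiableAt ℝ f y)
    (hβ : ∀ n, DifferentiableAt ℝ (fun z => β z n) y) (n : ℕ) :
    HasFDerivAt (fun z => wedgeLeft (f z) (β z) n)
      ((wedgeLeftCLM i n (β y)).comp (fderiv ℝ f y) +
        wedgeRightCLM (f y) (fun n => fderiv ℝ (fun z => β z n) y) n) y := by
  by_cases h : i ≤ n
  · have h1 := (wedgeCLM (V := V) (Nat.add_sub_of_le h)).hasFDerivAt_of_bilinear
      hf.hasFDerivAt (hβ (n - i)).hasFDerivAt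
    simp only [wedgeLeft, h, dite_true]
    refine h1.congr_fderiv ?_
    ext1 v
    simp [ContinuousLinearMap.precompR, ContinuousLinearMap.precompL, wedgeRightCLM_apply,
      wedgeLeft, h, add_comm]
  · simp only [wedgeLeft, h, dite_false]
    refine (hasFDerivAt_const _ _).congr_fderiv ?_
    ext1 v
    simp [wedgeRightCLM, wedgeLeftCLM, h]

lemma extDTot_wedgeLeft {i : ℕ} {f : V → V [⋀^Fin i]→L[ℝ] ℝ}
    {β : V → ∀ n : ℕ, V [⋀^Fin n]→L[ℝ] ℝ} {y : V} (hf : DifferentiableAt ℝ f y)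
    (hβ : ∀ n, DifferentiableAt ℝ (fun z => β z n) y) :
    extDTot (fun z => wedgeLeft (f z) (β z)) y =
      wedgeLeft (extDeriv f y) (β y) + (-1 : ℝ) ^ i • wedgeLeft (f y) (extDTot β y) := by
  rw [extDTot]
  simp only [(hasFDerivAt_wedgeLeft hf hβ _).fderiv]
  rw [altTot_add, alternatizeUncurryFin_wedgeLeft, altTot_wedgeRightCLM]
  rfl

lemma ContDiffAt.wedgeLeft {W : Type*} [NormedAddCommGroup W] [NormedSpace ℝ W] {i : ℕ}
    {f : W → V [⋀^Fin i]→L[ℝ] ℝ} {k : WithTop ℕ∞}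
    {β : W → ∀ n : ℕ, V [⋀^Fin n]→L[ℝ] ℝ} {y : W} (hf : ContDiffAt ℝ k f y)
    (hβ : ∀ n, ContDiffAt ℝ k (fun z => β z n) y) (n : ℕ) :
    ContDiffAt ℝ k (fun z => EquivariantForms.wedgeLeft (f z) (β z) n) y := by
  by_cases h : i ≤ n
  · simp only [EquivariantForms.wedgeLeft, h, dite_true]
    exact ((wedgeCLM (V := V) (Nat.add_sub_of_le h)).contDiff.contDiffAt.comp y hf).clm_apply
      (hβ (n - i))
  · simp only [EquivariantForms.wedgeLeft, h, dite_false]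
    exact contDiffAt_const

lemma ContDiffAt.monomialWedge {W : Type*} [NormedAddCommGroup W] [NormedSpace ℝ W] {m : ℕ}
    {θ : Fin m → W → V [⋀^Fin 2]→L[ℝ] ℝ} {k : WithTop ℕ∞} (J : Fin m → ℕ)
    {β : W → ∀ n : ℕ, V [⋀^Fin n]→L[ℝ] ℝ} {y : W} (hθ : ∀ i, ContDiffAt ℝ k (θ i) y)
    (hβ : ∀ n, ContDiffAt ℝ k (fun z => β z n) y) (n : ℕ) :
    ContDiffAt ℝ k (fun z => EquivariantForms.monomialWedge (fun i => θ i z) J (β z) n) y := by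
  unfold EquivariantForms.monomialWedge
  induction List.finRange m generalizing n with
  | nil => exact hβ n
  | cons i l ih =>
    simp only [List.foldr_cons]
    -- The inner product is hidden behind a name, so that the induction on the exponent J i does not
    -- touch the other occurrences of J.
    generalize hγ : (fun z => List.foldr
      (fun i γ => (EquivariantForms.wedgeLeft (θ i z))^[J i] γ) (β z) l) = γ at ih
    have hγ' : ∀ z, List.foldr (fun i γ => (EquivariantForms.wedgeLeft (θ i z))^[J i] γ) (β z) l
      = γ z := fun z => congrFun hγ z
    simp only [hγ'] at ih ⊢
    induction J i generalizing n with
    | zero => exact ih n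
    | succ k ih' =>
      simp only [Function.iterate_succ_apply']
      exact ContDiffAt.wedgeLeft (hθ i) ih' n

/-- Two-forms have even degree, so no signs appear, and the Leibniz rule only uses the differentials
of the θ_i at the point y. Closedness at the single point y is all that the Bianchi identity along a
horizontal plot provides. -/
lemma extDTot_monomialWedge {m : ℕ}
    {θ : Fin m → V → V [⋀^Fin 2]→L[ℝ] ℝ} (J : Fin m → ℕ)
    {β : V → ∀ n : ℕ, V [⋀^Fin n]→L[ℝ] ℝ} {y : V} (hθ : ∀ i, ContDiffAt ℝ 1 (θ i) y)
    (hβ : ∀ n, ContDiffAt ℝ 1 (fun z => β z n) y) (h0 : ∀ i, extDeriv (θ i) y = 0) :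
    extDTot (fun z => monomialWedge (fun i => θ i z) J (β z)) y =
      monomialWedge (fun i => θ i y) J (extDTot β y) := by
  suffices H : ∀ l : List (Fin m), (∀ n, ContDiffAt ℝ 1 (fun z => List.foldr
      (fun i γ => (wedgeLeft (θ i z))^[J i] γ) (β z) l n) y) ∧
      extDTot (fun z => List.foldr (fun i γ => (wedgeLeft (θ i z))^[J i] γ) (β z) l) y =
      List.foldr (fun i γ => (wedgeLeft (θ i y))^[J i] γ) (extDTot β y) l from (H _).2
  intro l
  induction l with
  | nil => exact ⟨hβ, rfl⟩
  | cons i l ih =>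
    simp only [List.foldr_cons]
    generalize hγ : (fun z => List.foldr
      (fun i γ => (wedgeLeft (θ i z))^[J i] γ) (β z) l) = γ at ih
    have hγ' : ∀ z, List.foldr (fun i γ => (wedgeLeft (θ i z))^[J i] γ) (β z) l
      = γ z := fun z => congrFun hγ z
    simp only [hγ'] at ih ⊢
    rw [← ih.2]
    have hz : wedgeLeft (0 : V [⋀^Fin 3]→L[ℝ] ℝ) = 0 := by
      ext1 β'
      have := congrArg (fun φ => φ β') (map_zero (wedgeOp (V := V) 3))
      exact this
    induction J i with
    | zero => exact ⟨ih.1, rfl⟩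
    | succ k ih' =>
      simp only [Function.iterate_succ_apply']
      refine ⟨ContDiffAt.wedgeLeft (hθ i) ih'.1, ?_⟩
      rw [extDTot_wedgeLeft ((hθ i).differentiableAt one_ne_zero)
        (fun n => (ih'.1 n).differentiableAt one_ne_zero), h0, ih'.2, hz]
      simp

end Leibniz

/-! ### Substitution of commuting operators into polynomial identities -/

section Substitution

open MvPolynomial

/-- Polynomials can only be evaluated in a commutative algebra. The subalgebra generated by the
commuting elements is one, and its inclusion into A finishes the construction. -/
lemma exists_algHom_of_commute {m : ℕ} {A : Type*} [Ring A] [Algebra ℝ A] (W : Fin m → A)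
    (hW : ∀ i j, W i * W j = W j * W i) :
    ∃ φ : MvPolynomial (Fin m) ℝ →ₐ[ℝ] A, ∀ i, φ (X i) = W i := by
  let S := Algebra.adjoin ℝ (Set.range W)
  letI : CommRing S := Algebra.adjoinCommRingOfComm ℝ (by
    rintro _ ⟨i, rfl⟩ _ ⟨j, rfl⟩
    exact hW i j)
  let w : Fin m → S := fun i => ⟨W i, Algebra.subset_adjoin ⟨i, rfl⟩⟩
  refine ⟨S.val.comp (aeval w), fun i => ?_⟩
  simp [w]

/-- A polynomial identity with vector coefficients that holds for all real arguments remains valid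
after substitution of operators for the variables. -/
lemma sum_apply_eq_zero_of_eval {m : ℕ} {C D : Type*} [AddCommGroup C] [Module ℝ C]
    [AddCommGroup D] [Module ℝ D] {ι : Type*} (s : Finset ι) (q : ι → MvPolynomial (Fin m) ℝ)
    (c : ι → C) (h : ∀ ξ : Fin m → ℝ, ∑ k ∈ s, eval ξ (q k) • c k = 0)
    (φ : MvPolynomial (Fin m) ℝ →ₗ[ℝ] Module.End ℝ D) (T : C →ₗ[ℝ] D) :
    ∑ k ∈ s, φ (q k) (T (c k)) = 0 := by
  classical
  have h1 : ∀ J, ∑ k ∈ s, coeff J (q k) • c k = 0 := by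
    intro J
    -- The coefficient space may be infinite-dimensional, so it is tested by linear functionals.
    -- What remains is a scalar polynomial that vanishes on all of ℝ^m, hence is zero.
    rw [← Module.forall_dual_apply_eq_zero_iff ℝ]
    intro l
    have h2 : ∑ k ∈ s, MvPolynomial.C (l (c k)) * q k = (0 : MvPolynomial (Fin m) ℝ) := by
      refine MvPolynomial.funext fun ξ => ?_
      have := congrArg l (h ξ)
      simpa [mul_comm] using this
    have := congrArg (coeff J) h2
    simp only [coeff_sum, coeff_C_mul, coeff_zero] at this
    simpa [mul_comm] using this
  let U := s.biUnion fun k => (q k).support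
  have h3 : ∀ k ∈ s, q k = ∑ J ∈ U, coeff J (q k) • monomial J (1 : ℝ) := by
    intro k hk
    conv_lhs => rw [(q k).as_sum]
    refine (Finset.sum_subset (Finset.subset_biUnion_of_mem (fun k => (q k).support) hk) ?_).trans
      (Finset.sum_congr rfl fun J _ => by simp [smul_monomial])
    intro J _ hJ
    rw [notMem_support_iff.1 hJ, monomial_zero]
  calc ∑ k ∈ s, φ (q k) (T (c k))
      = ∑ k ∈ s, ∑ J ∈ U, φ (monomial J 1) (T (coeff J (q k) • c k)) := by
        refine Finset.sum_congr rfl fun k hk => ?_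
        conv_lhs => rw [h3 k hk]
        simp [LinearMap.sum_apply]
    _ = ∑ J ∈ U, φ (monomial J 1) (T (∑ k ∈ s, coeff J (q k) • c k)) := by
        rw [Finset.sum_comm]
        simp [map_sum]
    _ = 0 := by simp [h1]

variable {V : Type*} [NormedAddCommGroup V] [NormedSpace ℝ V]

lemma monomialWedge_eq {m : ℕ} (θ : Fin m → V [⋀^Fin 2]→L[ℝ] ℝ) (J : Fin m → ℕ)
    (β : ∀ n : ℕ, V [⋀^Fin n]→L[ℝ] ℝ) :
    monomialWedge θ J β = ((List.finRange m).map fun i => wedgeOp 2 (θ i) ^ J i).prod β := by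
  unfold monomialWedge
  induction List.finRange m with
  | nil => rfl
  | cons i l ih =>
    simp only [List.foldr_cons, List.map_cons, List.prod_cons, Module.End.mul_apply, ih,
      Module.End.pow_apply]
    rfl

/-- The polynomials q i are the variables for a plain substitution, and linear forms when the
curvature has been transformed by the adjoint action. -/
lemma monomialWedge_eq_algHom {m : ℕ} (θ : Fin m → V [⋀^Fin 2]→L[ℝ] ℝ)
    (q : Fin m → MvPolynomial (Fin m) ℝ)
    (φ : MvPolynomial (Fin m) ℝ →ₐ[ℝ] Module.End ℝ (∀ n : ℕ, V [⋀^Fin n]→L[ℝ] ℝ))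
    (hφ : ∀ i, φ (q i) = wedgeOp 2 (θ i)) (J : Fin m → ℕ)
    (β : ∀ n : ℕ, V [⋀^Fin n]→L[ℝ] ℝ) :
    monomialWedge θ J β = φ (∏ i, q i ^ J i) β := by
  rw [monomialWedge_eq, Fin.prod_univ_def, map_list_prod, List.map_map]
  congr 3
  ext1 i
  simp [hφ]

lemma exists_algHom_wedgeOp {m : ℕ} (θ : Fin m → V [⋀^Fin 2]→L[ℝ] ℝ) :
    ∃ φ : MvPolynomial (Fin m) ℝ →ₐ[ℝ] Module.End ℝ (∀ n : ℕ, V [⋀^Fin n]→L[ℝ] ℝ),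
      ∀ i, φ (X i) = wedgeOp 2 (θ i) :=
  exists_algHom_of_commute (A := Module.End ℝ (∀ n : ℕ, V [⋀^Fin n]→L[ℝ] ℝ)) _ fun i j => LinearMap.ext fun β => wedgeLeft_two_two (θ i) (θ j) β

end Substitution

end

end EquivariantForms

namespace EquivariantForms

noncomputable section

/-! ### Smooth dependence of a pulled back form on the form and on the linear map -/

section CompSmooth

variable {V : Type*} [NormedAddCommGroup V] [NormedSpace ℝ V]
  {V' : Type*} [NormedAddCommGroup V'] [NormedSpace ℝ V']
  {W : Type*} [NormedAddCommGroup W] [NormedSpace ℝ W]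

/-- Alternatization of continuous multilinear forms as a continuous linear map. -/
def alternatizationCLM (V : Type*) [NormedAddCommGroup V] [NormedSpace ℝ V] (n : ℕ) :
    ContinuousMultilinearMap ℝ (fun _ : Fin n => V) ℝ →L[ℝ] V [⋀^Fin n]→L[ℝ] ℝ :=
  LinearMap.mkContinuous
    { toFun := fun f => ContinuousMultilinearMap.alternatization f
      map_add' := map_add _
      map_smul' := fun c f => by
        ext v
        simp [ContinuousMultilinearMap.alternatization_apply_apply, Finset.mul_sum,
          Units.smul_def, mul_left_comm] }
    n.factorial (fun f => by
      refine ContinuousAlternatingMap.opNorm_le_bound _ (by positivity) fun v => ?_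
      rw [LinearMap.coe_mk, AddHom.coe_mk, ContinuousMultilinearMap.alternatization_apply_apply]
      refine (norm_sum_le _ _).trans ?_
      have key : ∀ σ ∈ (Finset.univ : Finset (Equiv.Perm (Fin n))),
          ‖Equiv.Perm.sign σ • f (v ∘ σ)‖ ≤ ‖f‖ * ∏ a, ‖v a‖ := by
        intro σ _
        have h1 := f.le_opNorm (v ∘ σ)
        have h2 : ∏ a, ‖(v ∘ σ) a‖ = ∏ a, ‖v a‖ := Equiv.prod_comp σ (fun a => ‖v a‖)
        rw [h2] at h1
        rcases Int.units_eq_one_or (Equiv.Perm.sign σ) with h | h <;> simpa [h] using h1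
      refine (Finset.sum_le_card_nsmul _ _ _ key).trans (le_of_eq ?_)
      simp [Fintype.card_perm, mul_assoc])

lemma alternatizationCLM_coe {n : ℕ} (f : V [⋀^Fin n]→L[ℝ] ℝ) :
    alternatizationCLM V n f.toContinuousMultilinearMap = (n.factorial : ℝ) • f := by
  ext v
  change ContinuousMultilinearMap.alternatization f.toContinuousMultilinearMap v = _
  rw [ContinuousMultilinearMap.alternatization_apply_apply]
  have key : ∀ σ ∈ (Finset.univ : Finset (Equiv.Perm (Fin n))),
      Equiv.Perm.sign σ • f.toContinuousMultilinearMap (v ∘ σ) = f v := by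
    intro σ _
    have h3 : f (v ∘ σ) = Equiv.Perm.sign σ • f v := f.toAlternatingMap.map_perm v σ
    change Equiv.Perm.sign σ • f (v ∘ σ) = f v
    rw [h3, smul_smul]
    simp
  rw [Finset.sum_congr rfl key]
  simp [Fintype.card_perm]

/-- For multilinear forms, composition is linear in the form and a continuous multilinear map of the
linear maps, hence smooth. Alternating forms inherit this because alternatization divided by n! is a
left inverse of the passage to multilinear forms. -/
lemma ContDiffAt.compForm {k : WithTop ℕ∞} {n : ℕ} {f : W → V [⋀^Fin n]→L[ℝ] ℝ}
    {L : W → V' →L[ℝ] V} {y : W} (hf : ContDiffAt ℝ k f y) (hL : ContDiffAt ℝ k L y) :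
    ContDiffAt ℝ k (fun z => (f z).compContinuousLinearMap (L z)) y := by
  have h1 : (fun z => (f z).compContinuousLinearMap (L z)) = fun z => (n.factorial : ℝ)⁻¹ •
      alternatizationCLM V' n
        (ContinuousMultilinearMap.compContinuousLinearMapContinuousMultilinear ℝ
          (fun _ : Fin n => V') (fun _ : Fin n => V) ℝ (fun _ => L z)
          (ContinuousAlternatingMap.toContinuousMultilinearMapCLM ℝ (f z))) := by
    ext1 z
    have h2 := alternatizationCLM_coe ((f z).compContinuousLinearMap (L z))
    have h3 : ((f z).compContinuousLinearMap (L z)).toContinuousMultilinearMap =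
        ContinuousMultilinearMap.compContinuousLinearMapContinuousMultilinear ℝ
          (fun _ : Fin n => V') (fun _ : Fin n => V) ℝ (fun _ => L z)
          (ContinuousAlternatingMap.toContinuousMultilinearMapCLM ℝ (f z)) := rfl
    rw [← h3, h2, smul_smul, inv_mul_cancel₀ (by positivity), one_smul]
  rw [h1]
  refine ContDiffAt.const_smul _ ((alternatizationCLM V' n).contDiff.contDiffAt.comp y ?_)
  refine ContDiffAt.clm_apply ?_ ?_
  · exact (ContinuousMultilinearMap.contDiff _).contDiffAt.comp y (contDiffAt_pi.2 fun _ => hL)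
  · exact (ContinuousLinearMap.contDiff _).contDiffAt.comp y hf

lemma contDiffAt_extDeriv {n : ℕ} {f : V → V [⋀^Fin n]→L[ℝ] ℝ} {y : V}
    (hf : ContDiffAt ℝ ∞ f y) : ContDiffAt ℝ ∞ (extDeriv f) y := by
  have h := ContDiffAt.comp y (g := ContinuousAlternatingMap.alternatizeUncurryFinCLM ℝ V ℝ)
    (ContinuousLinearMap.contDiff _).contDiffAt (hf.fderiv_right (m := ∞) (by simp))
  exact h

end CompSmooth

/-! ### Exterior derivative on manifolds, tested on plots (smooth maps from a vector space) -/

section Plots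

lemma two_le_infty : (2 : WithTop ℕ∞) ≤ ∞ :=
  WithTop.coe_le_coe.2 (le_top : (2 : ℕ∞) ≤ ⊤)

variable {E₁ : Type*} [NormedAddCommGroup E₁] [NormedSpace ℝ E₁]
  {E₂ : Type*} [NormedAddCommGroup E₂] [NormedSpace ℝ E₂]
  {E : Type*} [NormedAddCommGroup E] [NormedSpace ℝ E]
  {H : Type*} [TopologicalSpace H] {I : ModelWithCorners ℝ E H}
  {M : Type*} [TopologicalSpace M] [ChartedSpace H M]
  {E' : Type*} [NormedAddCommGroup E'] [NormedSpace ℝ E']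
  {H' : Type*} [TopologicalSpace H'] {I' : ModelWithCorners ℝ E' H'}
  {N : Type*} [TopologicalSpace N] [ChartedSpace H' N]
  {E'' : Type*} [NormedAddCommGroup E''] [NormedSpace ℝ E'']
  {H'' : Type*} [TopologicalSpace H''] {I'' : ModelWithCorners ℝ E'' H''}
  {Q : Type*} [TopologicalSpace Q] [ChartedSpace H'' Q]

lemma tangentMapAt_comp {g : N → Q} {f : M → N} {x : M} (hg : MDifferentiableAt I' I'' g (f x))
    (hf : MDifferentiableAt I I' f x) :
    tangentMapAt I I'' (g ∘ f) x = (tangentMapAt I' I'' g (f x)).comp (tangentMapAt I I' f x) :=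
  mfderiv_comp x hg hf

lemma tangentMapAt_congr {f g : M → N} {x : M} (h : f =ᶠ[𝓝 x] g) :
    tangentMapAt I I' f x = tangentMapAt I I' g x :=
  h.mfderiv_eq

lemma tangentMapAt_id (x : M) : tangentMapAt I I (id : M → M) x = ContinuousLinearMap.id ℝ E :=
  mfderiv_id

lemma tangentMapAt_const (c : N) (x : M) : tangentMapAt I I' (fun _ : M => c) x = 0 :=
  mfderiv_const

lemma tangentMapAt_eq_fderiv (f : E₁ → E₂) (y : E₁) :
    tangentMapAt 𝓘(ℝ, E₁) 𝓘(ℝ, E₂) f y = fderiv ℝ f y :=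
  mfderiv_eq_fderiv

lemma pullback_apply {n : ℕ} (f : M → N) (θ : DForm E' N n) (x : M) :
    pullback I I' f θ x = (θ (f x)).compContinuousLinearMap (tangentMapAt I I' f x) := rfl

lemma comp_comp {F₁ F₂ F₃ : Type*} [NormedAddCommGroup F₁] [NormedSpace ℝ F₁]
    [NormedAddCommGroup F₂] [NormedSpace ℝ F₂] [NormedAddCommGroup F₃] [NormedSpace ℝ F₃]
    {n : ℕ} (θ : F₃ [⋀^Fin n]→L[ℝ] ℝ) (L : F₂ →L[ℝ] F₃) (L' : F₁ →L[ℝ] F₂) :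
    (θ.compContinuousLinearMap L).compContinuousLinearMap L' =
      θ.compContinuousLinearMap (L.comp L') := rfl

lemma comp_id {F₁ : Type*} [NormedAddCommGroup F₁] [NormedSpace ℝ F₁]
    {n : ℕ} (θ : F₁ [⋀^Fin n]→L[ℝ] ℝ) :
    θ.compContinuousLinearMap (ContinuousLinearMap.id ℝ F₁) = θ := rfl

lemma pullback_comp_apply {n : ℕ} {g : N → Q} {f : M → N} {x : M}
    (hg : MDifferentiableAt I' I'' g (f x)) (hf : MDifferentiableAt I I' f x)
    (θ : DForm E'' Q n) :
    pullback I I'' (g ∘ f) θ x = pullback I I' f (pullback I' I'' g θ) x := by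
  rw [pullback_apply, tangentMapAt_comp hg hf]
  rfl

lemma pullback_congr {n : ℕ} {f g : M → N} {x : M} (h : f =ᶠ[𝓝 x] g) (θ : DForm E' N n) :
    pullback I I' f θ x = pullback I I' g θ x := by
  rw [pullback_apply, pullback_apply, tangentMapAt_congr h, h.self_of_nhds]

lemma pullback_add {n : ℕ} (f : M → N) (θ θ' : DForm E' N n) :
    pullback I I' f (θ + θ') = pullback I I' f θ + pullback I I' f θ' := rfl

lemma pullback_sub {n : ℕ} (f : M → N) (θ θ' : DForm E' N n) :
    pullback I I' f (θ - θ') = pullback I I' f θ - pullback I I' f θ' := rfl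

lemma pullback_sum {n : ℕ} {ι : Type*} (s : Finset ι) (f : M → N) (θ : ι → DForm E' N n) :
    pullback I I' f (∑ k ∈ s, θ k) = ∑ k ∈ s, pullback I I' f (θ k) := by
  classical
  induction s using Finset.induction_on with
  | empty => simp; rfl
  | insert a s ha ih => rw [Finset.sum_insert ha, Finset.sum_insert ha, pullback_add, ih]

variable [I.Boundaryless] [IsManifold I ∞ M] [I'.Boundaryless] [IsManifold I' ∞ N]

lemma mdifferentiableAt_chart {c x : M} (hx : x ∈ (extChartAt I c).source) :
    MDifferentiableAt I 𝓘(ℝ, E) (extChartAt I c) x :=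
  (contMDiffAt_extChartAt' (n := ∞) (by simpa using hx)).mdifferentiableAt (by simp)

lemma contMDiffAt_chart_symm {c : M} {y : E} (hy : y ∈ (extChartAt I c).target) :
    ContMDiffAt 𝓘(ℝ, E) I ∞ (extChartAt I c).symm y :=
  (contMDiffOn_extChartAt_symm c).contMDiffAt (extChartAt_target_mem_nhds' hy)

lemma mdifferentiableAt_chart_symm {c : M} {y : E} (hy : y ∈ (extChartAt I c).target) :
    MDifferentiableAt 𝓘(ℝ, E) I (extChartAt I c).symm y :=
  (contMDiffAt_chart_symm hy).mdifferentiableAt (by simp)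

lemma chart_source_mem_nhds {c x : M} (hx : x ∈ (extChartAt I c).source) :
    (extChartAt I c).source ∈ 𝓝 x := (isOpen_extChartAt_source c).mem_nhds hx

lemma tangentMapAt_chart_self (x : M) :
    tangentMapAt I 𝓘(ℝ, E) (extChartAt I x) x = ContinuousLinearMap.id ℝ E :=
  mfderiv_extChartAt_self

lemma tangentMapAt_symm_comp_chart {c x : M} (hx : x ∈ (extChartAt I c).source) :
    (tangentMapAt 𝓘(ℝ, E) I (extChartAt I c).symm (extChartAt I c x)).comp
      (tangentMapAt I 𝓘(ℝ, E) (extChartAt I c) x) = ContinuousLinearMap.id ℝ E := by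
  rw [← tangentMapAt_comp (mdifferentiableAt_chart_symm ((extChartAt I c).map_source hx))
    (mdifferentiableAt_chart hx), ← tangentMapAt_id (I := I) x]
  refine tangentMapAt_congr ?_
  filter_upwards [chart_source_mem_nhds hx] with z hz
  exact (extChartAt I c).left_inv hz

lemma tangentMapAt_chart_symm_self (x : M) :
    tangentMapAt 𝓘(ℝ, E) I (extChartAt I x).symm (extChartAt I x x) =
      ContinuousLinearMap.id ℝ E := by
  have := tangentMapAt_symm_comp_chart (I := I) (mem_extChartAt_source x)
  rwa [tangentMapAt_chart_self, ContinuousLinearMap.comp_id] at this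

lemma ContMDiffAt.eventually_mdifferentiableAt {f : M → N} {x : M}
    (hf : ContMDiffAt I I' ∞ f x) :
    ∀ᶠ z in 𝓝 x, MDifferentiableAt I I' f z := by
  have h1 : ContMDiffAt I I' 1 f x := hf.of_le (by simp)
  haveI : IsManifold I 1 M := IsManifold.of_le (n := ∞) (by simp)
  haveI : IsManifold I' 1 N := IsManifold.of_le (n := ∞) (by simp)
  filter_upwards [(contMDiffAt_iff_contMDiffAt_nhds (by simp)).1 h1] with z hz
  exact hz.mdifferentiableAt one_ne_zero

/-- The pullback under a plot, expressed in a chart. -/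
lemma pullback_eventuallyEq_chart {n : ℕ} {f : E₁ → M} {y : E₁}
    (hf : ContMDiffAt 𝓘(ℝ, E₁) I ∞ f y) {c : M} (hc : f y ∈ (extChartAt I c).source)
    (θ : DForm E M n) :
    pullback 𝓘(ℝ, E₁) I f θ =ᶠ[𝓝 y] fun z =>
      (inChart I θ c (extChartAt I c (f z))).compContinuousLinearMap
        (fderiv ℝ (extChartAt I c ∘ f) z) := by
  have h1 := hf.continuousAt.preimage_mem_nhds (chart_source_mem_nhds hc)
  filter_upwards [eventually_eventually_nhds.2 h1, ContMDiffAt.eventually_mdifferentiableAt hf]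
    with z hz hd
  have hz0 : f z ∈ (extChartAt I c).source := hz.self_of_nhds
  rw [← tangentMapAt_eq_fderiv, tangentMapAt_comp (mdifferentiableAt_chart hz0) hd, inChart,
    pullback_apply _ _ (extChartAt I c (f z)), comp_comp, ← ContinuousLinearMap.comp_assoc, tangentMapAt_symm_comp_chart hz0,
    ContinuousLinearMap.id_comp, (extChartAt I c).left_inv hz0]
  rfl

lemma contDiffAt_chart_comp {f : E₁ → M} {y : E₁}
    (hf : ContMDiffAt 𝓘(ℝ, E₁) I ∞ f y) {c : M} (hc : f y ∈ (extChartAt I c).source) :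
    ContDiffAt ℝ ∞ (extChartAt I c ∘ f) y :=
  ((contMDiffAt_extChartAt' (n := ∞) (by simpa using hc)).comp y hf).contDiffAt

lemma IsSmoothForm.contDiffAt_inChart {n : ℕ} {θ : DForm E M n} (hθ : IsSmoothForm I θ) {c : M}
    {y : E} (hy : y ∈ (extChartAt I c).target) : ContDiffAt ℝ ∞ (inChart I θ c) y :=
  (hθ c).contDiffAt (extChartAt_target_mem_nhds' hy)

lemma isSmoothForm_of_contDiffAt {n : ℕ} {θ : DForm E M n}
    (h : ∀ c, ∀ y ∈ (extChartAt I c).target, ContDiffAt ℝ ∞ (inChart I θ c) y) :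
    IsSmoothForm I θ := fun c y hy => (h c y hy).contDiffWithinAt

lemma IsSmoothForm.contDiffAt_pullback {n : ℕ} {θ : DForm E M n} (hθ : IsSmoothForm I θ)
    {f : E₁ → M} {y : E₁} (hf : ContMDiffAt 𝓘(ℝ, E₁) I ∞ f y) :
    ContDiffAt ℝ ∞ (pullback 𝓘(ℝ, E₁) I f θ) y := by
  have hc : f y ∈ (extChartAt I (f y)).source := mem_extChartAt_source _
  have hφ := contDiffAt_chart_comp hf hc
  refine ContDiffAt.congr_of_eventuallyEq ?_ (pullback_eventuallyEq_chart hf hc θ)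
  refine ContDiffAt.compForm ?_ (hφ.fderiv_right (m := ∞) (by simp))
  exact ContDiffAt.comp y (hθ.contDiffAt_inChart ((extChartAt I (f y)).map_source hc)) hφ

/-- In the chart around f y the pullback is that of a form on a vector space, where naturality of d
is known. The inverse of a chart is itself a plot, so independence of the chart, smoothness of dθ
and naturality on manifolds are all consequences. -/
lemma extDeriv_pullback_plot {n : ℕ} {θ : DForm E M n} (hθ : IsSmoothForm I θ)
    {f : E₁ → M} {y : E₁} (hf : ContMDiffAt 𝓘(ℝ, E₁) I ∞ f y) :
    extDeriv (pullback 𝓘(ℝ, E₁) I f θ) y = pullback 𝓘(ℝ, E₁) I f (extd I θ) y := by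
  have hc : f y ∈ (extChartAt I (f y)).source := mem_extChartAt_source _
  have hφ := contDiffAt_chart_comp hf hc
  rw [(pullback_eventuallyEq_chart hf hc θ).extDeriv_eq]
  have h1 : extDeriv (fun z => (inChart I θ (f y) ((extChartAt I (f y) ∘ f) z)
      ).compContinuousLinearMap (fderiv ℝ (extChartAt I (f y) ∘ f) z)) y = _ := extDeriv_pullback
    ((hθ.contDiffAt_inChart ((extChartAt I (f y)).map_source hc)).differentiableAt (by simp)) hφ
    (by rw [minSmoothness_of_isRCLikeNormedField]; exact two_le_infty)
  refine h1.trans ?_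
  rw [pullback_apply, extd, comp_comp,
    ← tangentMapAt_comp (mdifferentiableAt_chart hc) (hf.mdifferentiableAt (by simp)),
    tangentMapAt_eq_fderiv]
  rfl

lemma inChart_pullback_eventuallyEq {n : ℕ} {θ : DForm E' N n} {f : M → N} {c : M} {y : E}
    (hy : y ∈ (extChartAt I c).target)
    (hf : ContMDiffAt I I' ∞ f ((extChartAt I c).symm y)) :
    inChart I (pullback I I' f θ) c =ᶠ[𝓝 y]
      pullback 𝓘(ℝ, E) I' (f ∘ (extChartAt I c).symm) θ := by
  have h1 := (contMDiffAt_chart_symm (I := I) hy).continuousAt.eventually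
    (ContMDiffAt.eventually_mdifferentiableAt hf)
  filter_upwards [h1, extChartAt_target_mem_nhds' hy] with z hz hz'
  exact (pullback_comp_apply hz (mdifferentiableAt_chart_symm hz') θ).symm

lemma IsSmoothForm.pullback {n : ℕ} {θ : DForm E' N n} (hθ : IsSmoothForm I' θ) {f : M → N}
    (hf : ContMDiff I I' ∞ f) : IsSmoothForm I (pullback I I' f θ) :=
  isSmoothForm_of_contDiffAt fun _ _ hy =>
    (hθ.contDiffAt_pullback ((hf _).comp _ (contMDiffAt_chart_symm hy))).congr_of_eventuallyEq
      (inChart_pullback_eventuallyEq hy (hf _))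

/-- The definition of dθ uses a different chart at every point; by naturality, applied to the
inverse of one chart, that chart computes dθ on its whole domain. -/
lemma inChart_extd {n : ℕ} {θ : DForm E M n} (hθ : IsSmoothForm I θ) {c : M} {y : E}
    (hy : y ∈ (extChartAt I c).target) :
    inChart I (extd I θ) c y = extDeriv (inChart I θ c) y :=
  (extDeriv_pullback_plot hθ (contMDiffAt_chart_symm hy)).symm

lemma IsSmoothForm.extd {n : ℕ} {θ : DForm E M n} (hθ : IsSmoothForm I θ) :
    IsSmoothForm I (extd I θ) := by
  refine isSmoothForm_of_contDiffAt fun c y hy => ?_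
  refine (contDiffAt_extDeriv (hθ.contDiffAt_inChart hy)).congr_of_eventuallyEq ?_
  filter_upwards [extChartAt_target_mem_nhds' hy] with z hz
  exact inChart_extd hθ hz

/-- In the tangent space model the chart around x has the identity as tangent map at x, so a form
and its expression in this chart have the same value there. -/
lemma eq_of_inChart_eq {n : ℕ} {θ θ' : DForm E M n} {x : M}
    (h : inChart I θ x (extChartAt I x x) = inChart I θ' x (extChartAt I x x)) :
    θ x = θ' x := by
  simp only [inChart, pullback_apply, tangentMapAt_chart_symm_self, extChartAt_to_inv] at h
  exact h

lemma extd_pullback {n : ℕ} {θ : DForm E' N n} (hθ : IsSmoothForm I' θ) {f : M → N}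
    (hf : ContMDiff I I' ∞ f) :
    extd I (pullback I I' f θ) = pullback I I' f (extd I' θ) := by
  ext1 x
  refine eq_of_inChart_eq (I := I) ?_
  have hy := mem_extChartAt_target (I := I) x
  rw [inChart_extd (hθ.pullback hf) hy,
    (inChart_pullback_eventuallyEq hy (hf _)).extDeriv_eq,
    extDeriv_pullback_plot hθ ((hf _).comp _ (contMDiffAt_chart_symm hy)),
    (inChart_pullback_eventuallyEq hy (hf _)).eq_of_nhds]

lemma isSmoothForm_zero {n : ℕ} : IsSmoothForm I (0 : DForm E M n) :=
  fun _ => contDiffOn_const (c := (0 : E [⋀^Fin n]→L[ℝ] ℝ))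

lemma IsSmoothForm.add {n : ℕ} {θ θ' : DForm E M n} (h : IsSmoothForm I θ)
    (h' : IsSmoothForm I θ') : IsSmoothForm I (θ + θ') := fun c => (h c).add (h' c)

lemma IsSmoothForm.sub {n : ℕ} {θ θ' : DForm E M n} (h : IsSmoothForm I θ)
    (h' : IsSmoothForm I θ') : IsSmoothForm I (θ - θ') := fun c => (h c).sub (h' c)

lemma IsSmoothForm.const_smul {n : ℕ} {θ : DForm E M n} (h : IsSmoothForm I θ) (r : ℝ) :
    IsSmoothForm I (r • θ) := fun c => (h c).const_smul r

lemma IsSmoothForm.sum {n : ℕ} {ι : Type*} (s : Finset ι) {θ : ι → DForm E M n}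
    (h : ∀ k ∈ s, IsSmoothForm I (θ k)) : IsSmoothForm I (∑ k ∈ s, θ k) := by
  classical
  induction s using Finset.induction_on with
  | empty => simpa using isSmoothForm_zero
  | insert a s ha ih =>
    rw [Finset.sum_insert ha]
    exact (h a (by simp)).add (ih fun k hk => h k (by simp [hk]))

lemma extd_add {n : ℕ} {θ θ' : DForm E M n} (h : IsSmoothForm I θ) (h' : IsSmoothForm I θ') :
    extd I (θ + θ') = extd I θ + extd I θ' := by
  ext1 x
  have hy := mem_extChartAt_target (I := I) x
  refine eq_of_inChart_eq (I := I) (θ' := extd I θ + extd I θ') ?_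
  have h1 : inChart I (extd I θ + extd I θ') x (extChartAt I x x) =
    inChart I (extd I θ) x (extChartAt I x x) + inChart I (extd I θ') x (extChartAt I x x) := rfl
  rw [h1, inChart_extd (h.add h') hy, inChart_extd h hy, inChart_extd h' hy]
  exact extDeriv_add ((h.contDiffAt_inChart hy).differentiableAt (by simp))
    ((h'.contDiffAt_inChart hy).differentiableAt (by simp))

lemma extd_smul {n : ℕ} {θ : DForm E M n} (h : IsSmoothForm I θ) (r : ℝ) :
    extd I (r • θ) = r • extd I θ := by
  ext1 x
  have hy := mem_extChartAt_target (I := I) x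
  refine eq_of_inChart_eq (I := I) (θ' := r • extd I θ) ?_
  have h1 : inChart I (r • extd I θ) x (extChartAt I x x) =
    r • inChart I (extd I θ) x (extChartAt I x x) := rfl
  rw [h1, inChart_extd (h.const_smul r) hy, inChart_extd h hy]
  exact extDeriv_smul r (inChart I θ x)

lemma extd_zero {n : ℕ} : extd I (0 : DForm E M n) = 0 := by
  simpa using extd_smul (I := I) (isSmoothForm_zero (M := M) (n := n)) 0

lemma extd_sum {n : ℕ} {ι : Type*} (s : Finset ι) {θ : ι → DForm E M n}
    (h : ∀ k ∈ s, IsSmoothForm I (θ k)) : extd I (∑ k ∈ s, θ k) = ∑ k ∈ s, extd I (θ k) := by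
  classical
  induction s using Finset.induction_on with
  | empty => simpa using extd_zero
  | insert a s ha ih =>
    rw [Finset.sum_insert ha, Finset.sum_insert ha, extd_add (h a (by simp))
      (IsSmoothForm.sum s fun k hk => h k (by simp [hk])), ih fun k hk => h k (by simp [hk])]

end Plots

end

end EquivariantForms

namespace EquivariantForms

noncomputable section

/-! ### Adjoint action, infinitesimal action and the Maurer–Cartan equation -/

section LieGroups

open VectorField

variable {EG : Type*} [NormedAddCommGroup EG] [NormedSpace ℝ EG]
  {HG : Type*} [TopologicalSpace HG] {IG : ModelWithCorners ℝ EG HG}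
  {G : Type*} [TopologicalSpace G] [ChartedSpace HG G] [Group G] [LieGroup IG ∞ G]
  {EM : Type*} [NormedAddCommGroup EM] [NormedSpace ℝ EM]
  {HM : Type*} [TopologicalSpace HM] {IM : ModelWithCorners ℝ EM HM}
  {M : Type*} [TopologicalSpace M] [ChartedSpace HM M]
  [MulAction G M] [ContMDiffSMul IG IM ∞ G M]

variable (IG G) in
-- The bracket of invariant vector fields is set up under this smoothness assumption, which over ℝ
-- means class C³.
lemma lieGroup_minSmoothness : LieGroup IG (minSmoothness ℝ 3) G := by
  rw [minSmoothness_of_isRCLikeNormedField]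
  exact LieGroup.of_le (n := ∞) (WithTop.coe_le_coe.2 (le_top : (3 : ℕ∞) ≤ ⊤))

lemma contMDiff_mulLeft (g : G) : ContMDiff IG IG ∞ (fun h : G => g * h) :=
  contMDiff_const.mul contMDiff_id

lemma contMDiff_conj (g : G) : ContMDiff IG IG ∞ (fun h : G => g * h * g⁻¹) :=
  (contMDiff_const.mul contMDiff_id).mul contMDiff_const

lemma contMDiff_smul_left (J : ModelWithCorners ℝ EG HG) [ContMDiffSMul J IM ∞ G M] (g : G) :
    ContMDiff IM IM ∞ (fun x : M => g • x) :=
  (ContMDiffSMul.contMDiff_smul (I := J) (I' := IM) (n := ∞) (G := G) (M := M)).comp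
    (contMDiff_const.prodMk contMDiff_id)

lemma contMDiff_smul_right (x : M) : ContMDiff IG IM ∞ (fun g : G => g • x) :=
  (ContMDiffSMul.contMDiff_smul (I := IG) (I' := IM) (n := ∞) (G := G) (M := M)).comp
    (contMDiff_id.prodMk contMDiff_const)

/-- Derivative at h = 1 of the identity g (h x) = (g h g⁻¹) (g x). -/
lemma tangentMapAt_smul_infAct (g : G) (x : M) (ξ : GroupLieAlgebra IG G) :
    tangentMapAt IM IM (fun y : M => g • y) x (infAct IG IM G x ξ) =
      infAct IG IM G (g • x) (Ad IG g ξ) := by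
  have h1 : (fun y : M => g • y) ∘ (fun h : G => h • x) =
      (fun h : G => h • (g • x)) ∘ (fun h : G => g * h * g⁻¹) := by
    ext1 h
    simp [smul_smul]
  have e1 : ∀ z : M, MDifferentiableAt IM IM (fun y : M => g • y) z := fun z =>
    (contMDiff_smul_left IG (IM := IM) g z).mdifferentiableAt (by simp)
  have e2 : ∀ (y : M) (z : G), MDifferentiableAt IG IM (fun h : G => h • y) z := fun y z =>
    (contMDiff_smul_right (IG := IG) (IM := IM) y z).mdifferentiableAt (by simp)
  have e3 : MDifferentiableAt IG IG (fun h : G => g * h * g⁻¹) 1 :=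
    (contMDiff_conj g 1).mdifferentiableAt (by simp)
  have h2 := tangentMapAt_comp (e1 _) (e2 x 1)
  have h3 := tangentMapAt_comp (e2 (g • x) _) e3
  rw [h1, h3] at h2
  have h5 : tangentMapAt IG IM (fun h : G => h • (g • x)) (g * 1 * g⁻¹) =
      tangentMapAt IG IM (fun h : G => h • (g • x)) 1 := by
    rw [mul_one, mul_inv_cancel]
  have h6 : tangentMapAt IM IM (fun y : M => g • y) ((1 : G) • x) =
      tangentMapAt IM IM (fun y : M => g • y) x := by rw [one_smul]
  rw [h5, h6] at h2
  exact (DFunLike.congr_fun h2 ξ).symm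

lemma tangentMapAt_mulLeft_mulInvariantVectorField (h : G) (ξ : GroupLieAlgebra IG G) :
    mulInvariantVectorField ξ h = tangentMapAt IG IG (fun k : G => h * k) 1 ξ := rfl

variable [FiniteDimensional ℝ EG]

/-- Derivative at k = 1 of the identity g (h k) g⁻¹ = (g h g⁻¹) (g k g⁻¹). -/
lemma tangentMapAt_conj_mulInvariantVectorField (g h : G) (ξ : GroupLieAlgebra IG G) :
    tangentMapAt IG IG (fun k : G => g * k * g⁻¹) h (mulInvariantVectorField ξ h) =
      mulInvariantVectorField (Ad IG g ξ) (g * h * g⁻¹) := by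
  have h1 : (fun k : G => g * k * g⁻¹) ∘ (fun k : G => h * k) =
      (fun k : G => g * h * g⁻¹ * k) ∘ (fun k : G => g * k * g⁻¹) := by
    ext1 k
    simp only [Function.comp_apply]
    group
  have e1 : ∀ z : G, MDifferentiableAt IG IG (fun k : G => g * k * g⁻¹) z := fun z =>
    (contMDiff_conj g z).mdifferentiableAt (by simp)
  have e2 : ∀ (y : G) (z : G), MDifferentiableAt IG IG (fun h : G => y * h) z := fun y z =>
    (contMDiff_mulLeft y z).mdifferentiableAt (by simp)
  have h2 := tangentMapAt_comp (e1 _) (e2 h 1)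
  have h3 := tangentMapAt_comp (e2 (g * h * g⁻¹) _) (e1 1)
  rw [h1, h3] at h2
  have h5 : tangentMapAt IG IG (fun k : G => g * h * g⁻¹ * k) (g * 1 * g⁻¹) =
      tangentMapAt IG IG (fun k : G => g * h * g⁻¹ * k) 1 := by
    rw [mul_one, mul_inv_cancel]
  have h6 : tangentMapAt IG IG (fun k : G => g * k * g⁻¹) (h * 1) =
      tangentMapAt IG IG (fun k : G => g * k * g⁻¹) h := by rw [mul_one]
  rw [h5, h6] at h2
  exact (DFunLike.congr_fun h2 ξ).symm

lemma tangentMapAt_conj_comp (g h : G) :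
    (tangentMapAt IG IG (fun k : G => g⁻¹ * k * g) (g * h * g⁻¹)).comp
      (tangentMapAt IG IG (fun k : G => g * k * g⁻¹) h) = ContinuousLinearMap.id ℝ EG := by
  have e1 : ∀ (g z : G), MDifferentiableAt IG IG (fun k : G => g * k * g⁻¹) z := fun g z =>
    (contMDiff_conj g z).mdifferentiableAt (by simp)
  have e2 : MDifferentiableAt IG IG (fun k : G => g⁻¹ * k * g) (g * h * g⁻¹) := by
    simpa using e1 g⁻¹ (g * h * g⁻¹)
  have h1 := tangentMapAt_comp (I := IG) (I' := IG) (I'' := IG) (x := h)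
    (g := fun k : G => g⁻¹ * k * g) (f := fun k : G => g * k * g⁻¹) e2 (e1 g h)
  have h2 : (fun k : G => g⁻¹ * k * g) ∘ (fun k : G => g * k * g⁻¹) = id := by
    ext1 k
    simp [mul_assoc]
  rw [h2, tangentMapAt_id] at h1
  exact h1.symm

lemma isInvertible_tangentMapAt_conj (g h : G) :
    (tangentMapAt IG IG (fun k : G => g * k * g⁻¹) h).IsInvertible := by
  refine ContinuousLinearMap.IsInvertible.of_inverse
    (g := tangentMapAt IG IG (fun k : G => g⁻¹ * k * g) (g * h * g⁻¹)) ?_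
    (tangentMapAt_conj_comp g h)
  have := tangentMapAt_conj_comp (IG := IG) g⁻¹ (g * h * g⁻¹)
  simp only [inv_inv] at this
  rwa [show g⁻¹ * (g * h * g⁻¹) * g = h by group] at this

lemma mpullback_conj_mulInvariantVectorField (g : G) (ξ : GroupLieAlgebra IG G) :
    mpullback IG IG (fun k : G => g * k * g⁻¹) (mulInvariantVectorField (Ad IG g ξ)) =
      mulInvariantVectorField ξ := by
  ext h
  have h1 := tangentMapAt_conj_mulInvariantVectorField (IG := IG) g h ξ
  rw [mpullback_apply, ← h1]
  exact congrArg (fun L : EG →L[ℝ] EG => L (mulInvariantVectorField ξ h))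
    (isInvertible_tangentMapAt_conj (IG := IG) g h).inverse_comp_self

/-- Conjugation by g pulls the invariant field of Ad_g ξ back to that of ξ, and pullback under it
respects brackets of vector fields. The value at the identity is the claim. -/
lemma Ad_bracket (g : G) (ξ η : GroupLieAlgebra IG G) :
    Ad IG g ⁅ξ, η⁆ = ⁅Ad IG g ξ, Ad IG g η⁆ := by
  haveI := lieGroup_minSmoothness IG G
  have h1 := mpullback_mlieBracket (I := IG) (I' := IG) (n := ∞)
    (f := fun k : G => g * k * g⁻¹) (x₀ := 1)
    (mdifferentiableAt_mulInvariantVectorField (Ad IG g ξ))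
    (mdifferentiableAt_mulInvariantVectorField (Ad IG g η)) (contMDiff_conj g 1)
    (by rw [minSmoothness_of_isRCLikeNormedField]; exact two_le_infty)
  rw [mpullback_conj_mulInvariantVectorField, mpullback_conj_mulInvariantVectorField] at h1
  have h2 : ⁅ξ, η⁆ = mlieBracket IG (mulInvariantVectorField ξ) (mulInvariantVectorField η) (1 : G) :=
    rfl
  rw [h2, ← h1, mpullback_apply]
  have h3 := congrArg (fun L : EG →L[ℝ] EG => L (mlieBracket IG
    (mulInvariantVectorField (Ad IG g ξ)) (mulInvariantVectorField (Ad IG g η)) (g * 1 * g⁻¹)))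
    (isInvertible_tangentMapAt_conj (IG := IG) g 1).self_comp_inverse
  have h4 : ∀ k : G, k = 1 → (mlieBracket IG
    (mulInvariantVectorField (Ad IG g ξ)) (mulInvariantVectorField (Ad IG g η)) k : EG) =
      ⁅Ad IG g ξ, Ad IG g η⁆ := by
    rintro k rfl
    rfl
  exact h3.trans (h4 _ (by simp))

/-- A left invariant vector field, in the chart around the identity. -/
def chartInvariantField (ξ : GroupLieAlgebra IG G) : EG → EG :=
  mpullbackWithin 𝓘(ℝ, EG) IG (extChartAt IG (1 : G)).symm (mulInvariantVectorField ξ) (range IG)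

variable [IG.Boundaryless]

lemma tangentMapAt_chartInvariantField (ξ : GroupLieAlgebra IG G) {z : EG}
    (hz : z ∈ (extChartAt IG (1 : G)).target) :
    tangentMapAt 𝓘(ℝ, EG) IG (extChartAt IG (1 : G)).symm z (chartInvariantField ξ z) =
      mulInvariantVectorField ξ ((extChartAt IG (1 : G)).symm z) := by
  have h1 : (tangentMapAt 𝓘(ℝ, EG) IG (extChartAt IG (1 : G)).symm z).IsInvertible := by
    have := isInvertible_mfderivWithin_extChartAt_symm (I := IG) (x := (1 : G)) hz
    rwa [IG.range_eq_univ, mfderivWithin_univ] at this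
  have h2 : chartInvariantField ξ z =
      (tangentMapAt 𝓘(ℝ, EG) IG (extChartAt IG (1 : G)).symm z).inverse
        (mulInvariantVectorField ξ ((extChartAt IG (1 : G)).symm z)) := by
    rw [chartInvariantField, mpullbackWithin_apply, IG.range_eq_univ, mfderivWithin_univ]
    rfl
  rw [h2]
  exact congrArg (fun L : EG →L[ℝ] EG =>
    L (mulInvariantVectorField ξ ((extChartAt IG (1 : G)).symm z))) h1.self_comp_inverse

lemma chartInvariantField_self (ξ : GroupLieAlgebra IG G) :
    chartInvariantField ξ (extChartAt IG (1 : G) 1) = ξ := by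
  have h := tangentMapAt_chartInvariantField ξ (mem_extChartAt_target (I := IG) (1 : G))
  rw [tangentMapAt_chart_symm_self] at h
  refine h.trans ?_
  have h2 : ∀ k : G, k = 1 → (mulInvariantVectorField ξ k : EG) = ξ := by
    rintro k rfl
    rw [tangentMapAt_mulLeft_mulInvariantVectorField]
    have : (fun k : G => 1 * k) = id := by ext1 k; simp
    rw [this, tangentMapAt_id]
    rfl
  exact h2 _ (by simp)

lemma differentiableAt_chartInvariantField (ξ : GroupLieAlgebra IG G) :
    DifferentiableAt ℝ (chartInvariantField ξ) (extChartAt IG (1 : G) 1) := by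
  haveI := lieGroup_minSmoothness IG G
  haveI : IsManifold IG 2 G := IsManifold.of_le (n := ∞) two_le_infty
  have h := MDifferentiableWithinAt.differentiableWithinAt_mpullbackWithin_vectorField
    (mdifferentiableAt_mulInvariantVectorField ξ (g := (1 : G))).mdifferentiableWithinAt (s := univ)
  rw [preimage_univ, univ_inter, IG.range_eq_univ] at h
  have h2 := h.differentiableAt univ_mem
  unfold chartInvariantField
  rwa [IG.range_eq_univ]

/-- The chart around the identity has the identity as tangent map there, so passing to coordinates
introduces no Jacobian. -/
lemma bracket_eq_lieBracket (ξ η : GroupLieAlgebra IG G) :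
    ⁅ξ, η⁆ = lieBracket ℝ (chartInvariantField ξ) (chartInvariantField η)
      (extChartAt IG (1 : G) 1) := by
  have h1 : ⁅ξ, η⁆ = mlieBracketWithin IG (mulInvariantVectorField ξ)
    (mulInvariantVectorField η) univ (1 : G) := rfl
  have h2 : (tangentMapAt IG 𝓘(ℝ, EG) (extChartAt IG (1 : G)) 1).inverse =
      ContinuousLinearMap.id ℝ EG := by
    rw [tangentMapAt_chart_self, ContinuousLinearMap.inverse_id]
  rw [h1, mlieBracketWithin_apply, preimage_univ, univ_inter]
  refine (DFunLike.congr_fun h2 _).trans ?_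
  rw [← lieBracketWithin_univ]
  unfold chartInvariantField
  rw [IG.range_eq_univ]
  rfl

/-- The Maurer–Cartan equation at the identity. -/
lemma extDeriv_of_chartInvariantField {θ : EG → EG [⋀^Fin 1]→L[ℝ] ℝ}
    (l : GroupLieAlgebra IG G →ₗ[ℝ] ℝ) (hθ : DifferentiableAt ℝ θ (extChartAt IG (1 : G) 1))
    (h : ∀ᶠ z in 𝓝 (extChartAt IG (1 : G) 1), ∀ ξ : GroupLieAlgebra IG G,
      θ z (fun _ => chartInvariantField ξ z) = l ξ) (ξ η : GroupLieAlgebra IG G) :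
    extDeriv θ (extChartAt IG (1 : G) 1) ![ξ, η] = - l ⁅ξ, η⁆ := by
  set z₀ := extChartAt IG (1 : G) 1
  let V : Fin 2 → EG → EG := ![chartInvariantField ξ, chartInvariantField η]
  have hV : ∀ i, DifferentiableAt ℝ (V i) z₀ := by
    intro i
    fin_cases i
    · exact differentiableAt_chartInvariantField ξ
    · exact differentiableAt_chartInvariantField η
  have hV0 : (fun i => V i z₀) = (![ξ, η] : Fin 2 → EG) := by
    ext1 i
    fin_cases i
    · exact chartInvariantField_self ξ
    · exact chartInvariantField_self η
  have key := extDeriv_apply_vectorField hθ hV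
  rw [hV0] at key
  -- In the formula for dθ on two vector fields the first two terms differentiate the functions θ(V
  -- i), which are constant near the point by assumption. Only the bracket term is left.
  have hc : ∀ i : Fin 2, fderiv ℝ (fun x => θ x (i.removeNth (V · x))) z₀ = 0 := by
    intro i
    have : ∃ c : ℝ, (fun x => θ x (i.removeNth (V · x))) =ᶠ[𝓝 z₀] fun _ => c := by
      fin_cases i
      · refine ⟨l η, ?_⟩
        filter_upwards [h] with z hz
        rw [← hz η]
        congr 1
        ext1 k
        fin_cases k
        rfl
      · refine ⟨l ξ, ?_⟩
        filter_upwards [h] with z hz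
        rw [← hz ξ]
        congr 1
        ext1 k
        fin_cases k
        rfl
    obtain ⟨c, hc⟩ := this
    rw [hc.fderiv_eq]
    simp
  have h0 := h.self_of_nhds ⁅ξ, η⁆
  rw [chartInvariantField_self] at h0
  simp only [hc] at key
  rw [key]
  have hb := bracket_eq_lieBracket ξ η
  simp only [ContinuousLinearMap.zero_apply, smul_zero, Finset.sum_const_zero, zero_sub]
  rw [Fin.sum_univ_one, show Finset.Ici (0 : Fin 1) = {0} by decide, Finset.sum_singleton, ← h0]
  simp only [Fin.val_zero, add_zero, pow_zero, one_smul]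
  congr 2
  ext1 k
  fin_cases k
  exact hb.symm

end LieGroups

end

end EquivariantForms

namespace EquivariantForms

noncomputable section

/-! ### Chain rule in two variables; alternating forms modulo a set of vectors -/

section TwoVariables

variable {E : Type*} [NormedAddCommGroup E] [NormedSpace ℝ E]
  {H : Type*} [TopologicalSpace H] {I : ModelWithCorners ℝ E H}
  {M : Type*} [TopologicalSpace M] [ChartedSpace H M]
  {E' : Type*} [NormedAddCommGroup E'] [NormedSpace ℝ E']
  {H' : Type*} [TopologicalSpace H'] {I' : ModelWithCorners ℝ E' H'}
  {N : Type*} [TopologicalSpace N] [ChartedSpace H' N]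
  {F' : Type*} [NormedAddCommGroup F'] [NormedSpace ℝ F']
  {K' : Type*} [TopologicalSpace K'] {J' : ModelWithCorners ℝ F' K'}
  {N' : Type*} [TopologicalSpace N'] [ChartedSpace K' N']
  {E'' : Type*} [NormedAddCommGroup E''] [NormedSpace ℝ E'']
  {H'' : Type*} [TopologicalSpace H''] {I'' : ModelWithCorners ℝ E'' H''}
  {Q : Type*} [TopologicalSpace Q] [ChartedSpace H'' Q]

lemma tangentMapAt_comp_apply {g : N → Q} {f : M → N} {x : M}
    (hg : MDifferentiableAt I' I'' g (f x)) (hf : MDifferentiableAt I I' f x) (v : E) :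
    tangentMapAt I I'' (g ∘ f) x v = tangentMapAt I' I'' g (f x) (tangentMapAt I I' f x v) :=
  DFunLike.congr_fun (tangentMapAt_comp hg hf) v

lemma tangentMapAt_comp₂ {F : N × N' → Q} {f : M → N} {g : M → N'} {x : M}
    (hF : MDifferentiableAt (I'.prod J') I'' F (f x, g x)) (hf : MDifferentiableAt I I' f x)
    (hg : MDifferentiableAt I J' g x) (v : E) :
    tangentMapAt I I'' (fun z => F (f z, g z)) x v =
      tangentMapAt I' I'' (fun a => F (a, g x)) (f x) (tangentMapAt I I' f x v) +
      tangentMapAt J' I'' (fun c => F (f x, c)) (g x) (tangentMapAt I J' g x v) := by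
  have h1 := tangentMapAt_comp_apply (I := I) (I' := I'.prod J') (I'' := I'') (g := F)
    (f := fun z => (f z, g z)) (x := x) hF (hf.prodMk hg) v
  have h2 : tangentMapAt I (I'.prod J') (fun z => (f z, g z)) x v =
      (tangentMapAt I I' f x v, tangentMapAt I J' g x v) :=
    DFunLike.congr_fun (mfderiv_prodMk hf hg) v
  rw [h2] at h1
  exact h1.trans (mfderiv_prod_eq_add_apply hF)

/-- The entries are exchanged one at a time; each exchange changes the value by that of a frame with
an entry in K, which is 0. -/
lemma ContinuousAlternatingMap.eq_of_sub_mem {n : ℕ} (f : E [⋀^Fin n]→L[ℝ] ℝ) (K : Set E)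
    (hf : ∀ (v : Fin n → E) i, v i ∈ K → f v = 0) (v w : Fin n → E) (h : ∀ i, v i - w i ∈ K) :
    f v = f w := by
  classical
  have key : ∀ s : Finset (Fin n), f (s.piecewise v w) = f w := by
    intro s
    induction s using Finset.induction_on with
    | empty => simp
    | insert a s ha ih =>
      rw [← ih, Finset.piecewise_insert]
      have h1 : v a = (v a - w a) + w a := by abel
      have h2 : Function.update (s.piecewise v w) a (w a) = s.piecewise v w := by
        rw [Function.update_eq_self_iff]
        simp [ha]
      rw [h1, f.map_update_add, h2, hf _ a (by simpa using h a), zero_add]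
  simpa using key Finset.univ

end TwoVariables

/-! ### Principal bundles: sections, vertical vectors, descent of basic forms -/

section Geometry

variable {EG : Type*} [NormedAddCommGroup EG] [NormedSpace ℝ EG]
  {HG : Type*} [TopologicalSpace HG] {IG : ModelWithCorners ℝ EG HG}
  {G : Type*} [TopologicalSpace G] [ChartedSpace HG G] [Group G] [LieGroup IG ∞ G]
  {EP : Type*} [NormedAddCommGroup EP] [NormedSpace ℝ EP]
  {HP : Type*} [TopologicalSpace HP] {IP : ModelWithCorners ℝ EP HP}
  {P : Type*} [TopologicalSpace P] [ChartedSpace HP P] [MulAction Gᵐᵒᵖ P]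
  {EX : Type*} [NormedAddCommGroup EX] [NormedSpace ℝ EX]
  {HX : Type*} [TopologicalSpace HX] {IX : ModelWithCorners ℝ EX HX}
  {X : Type*} [TopologicalSpace X] [ChartedSpace HX X] {π : P → X}
  {EM : Type*} [NormedAddCommGroup EM] [NormedSpace ℝ EM]
  {HM : Type*} [TopologicalSpace HM] {IM : ModelWithCorners ℝ EM HM}
  {M : Type*} [TopologicalSpace M] [ChartedSpace HM M]
  [MulAction G M] [ContMDiffSMul IG IM ∞ G M]
  {E : Type*} [NormedAddCommGroup E] [NormedSpace ℝ E]
  {H : Type*} [TopologicalSpace H] {I : ModelWithCorners ℝ E H}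
  {N : Type*} [TopologicalSpace N] [ChartedSpace H N]

lemma tangentMapAt_smul_apply {c : N → G} {w : N → M} {x : N} (hc : MDifferentiableAt I IG c x)
    (hw : MDifferentiableAt I IM w x) (hx : c x = 1) (v : E) :
    tangentMapAt I IM (fun z => c z • w z) x v =
      tangentMapAt I IM w x v + infAct IG IM G (w x) (tangentMapAt I IG c x v) := by
  have h1 := tangentMapAt_comp₂ (F := fun q : G × M => q.1 • q.2) (I'' := IM)
    ((ContMDiffSMul.contMDiff_smul (I := IG) (I' := IM) (n := ∞) (G := G) (M := M)
      (c x, w x)).mdifferentiableAt (by simp)) hc hw v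
  have h2 : (fun a : M => c x • a) = id := by ext1 a; simp [hx]
  have h3 : tangentMapAt IG IM (fun a : G => a • w x) (c x) = infAct IG IM G (w x) := by
    rw [hx]; rfl
  rw [h3] at h1
  simp only [h2] at h1
  rw [tangentMapAt_id] at h1
  rw [h1, add_comm]
  rfl

variable (hπ : IsPrincipalBundle IG IP IX G π)
include hπ

lemma IsPrincipalBundle.contMDiff_translation (g : G) :
    ContMDiff IP IP ∞ (fun p : P => op g • p) :=
  hπ.smooth_act.comp (contMDiff_id.prodMk contMDiff_const)

lemma IsPrincipalBundle.contMDiff_orbit (p : P) : ContMDiff IG IP ∞ (fun g : G => op g • p) :=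
  hπ.smooth_act.comp (contMDiff_const.prodMk contMDiff_id)

lemma IsPrincipalBundle.tangentMapAt_act_apply {c : N → G} {f : N → P} {x : N}
    (hf : MDifferentiableAt I IP f x) (hc : MDifferentiableAt I IG c x) (v : E) :
    tangentMapAt I IP (fun z => op (c z) • f z) x v =
      tangentMapAt IP IP (fun p : P => op (c x) • p) (f x) (tangentMapAt I IP f x v) +
      tangentMapAt IG IP (fun g : G => op g • f x) (c x) (tangentMapAt I IG c x v) :=
  tangentMapAt_comp₂ (F := fun q : P × G => op q.2 • q.1) (I'' := IP)
    ((hπ.smooth_act (f x, c x)).mdifferentiableAt (by simp)) hf hc v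

lemma IsPrincipalBundle.tangentMapAt_act_apply_one {c : N → G} {f : N → P} {x : N}
    (hf : MDifferentiableAt I IP f x) (hc : MDifferentiableAt I IG c x) (hx : c x = 1) (v : E) :
    tangentMapAt I IP (fun z => op (c z) • f z) x v =
      tangentMapAt I IP f x v + vert IG IP G (f x) (tangentMapAt I IG c x v) := by
  have h1 := hπ.tangentMapAt_act_apply hf hc v
  have h2 : (fun p : P => op (c x) • p) = id := by ext1 a; simp [hx]
  have h3 : tangentMapAt IG IP (fun g : G => op g • f x) (c x) = vert IG IP G (f x) := by
    rw [hx]; rfl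
  rw [h2, h3, tangentMapAt_id] at h1
  exact h1

/-- The fundamental vector field along an orbit. -/
lemma IsPrincipalBundle.tangentMapAt_orbit (p : P) (g : G) (ξ : GroupLieAlgebra IG G) :
    tangentMapAt IG IP (fun h : G => op h • p) g (mulInvariantVectorField ξ g) =
      vert IG IP G (op g • p) ξ := by
  have h1 : (fun h : G => op h • p) ∘ (fun h : G => g * h) = fun h : G => op h • (op g • p) := by
    ext1 h
    simp [smul_smul]
  have h2 := tangentMapAt_comp_apply (I := IG) (I' := IG) (I'' := IP) (x := (1 : G))
    ((hπ.contMDiff_orbit p (g * 1)).mdifferentiableAt (by simp))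
    ((contMDiff_mulLeft (IG := IG) g 1).mdifferentiableAt (by simp)) ξ
  have h3 : tangentMapAt IG IP (fun h : G => op h • p) (g * 1) =
      tangentMapAt IG IP (fun h : G => op h • p) g := by rw [mul_one]
  rw [h1, h3] at h2
  exact h2.symm

lemma IsPrincipalBundle.tangentMapAt_proj_translation (p : P) (g : G) (v : EP) :
    tangentMapAt IP IX π (op g • p) (tangentMapAt IP IP (fun q : P => op g • q) p v) =
      tangentMapAt IP IX π p v := by
  have h1 : π ∘ (fun q : P => op g • q) = π := by
    ext1 q
    exact hπ.proj_act q g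
  have h2 := tangentMapAt_comp_apply (I := IP) (I' := IP) (I'' := IX) (x := p)
    ((hπ.smooth_proj (op g • p)).mdifferentiableAt (by simp))
    ((hπ.contMDiff_translation g p).mdifferentiableAt (by simp)) v
  rw [h1] at h2
  exact h2.symm

lemma IsPrincipalBundle.surjective : Function.Surjective π := by
  intro x
  obtain ⟨U, -, hx, e, hs, ht, -, -, he⟩ := hπ.locally_trivial x
  have h1 : ((x, 1) : X × G) ∈ e.target := by rw [ht]; exact ⟨hx, mem_univ _⟩
  refine ⟨e.symm (x, 1), ?_⟩
  rw [← (he _ (e.map_target h1)).1, e.right_inv h1]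

/-- In a trivialization two points over the same base point differ only in the group component, and
the right action multiplies that component. -/
lemma IsPrincipalBundle.exists_translation {p p' : P} (h : π p = π p') :
    ∃ g : G, p' = op g • p := by
  obtain ⟨U, -, hx, e, hs, ht, -, -, he⟩ := hπ.locally_trivial (π p)
  have hp : p ∈ e.source := by rw [hs]; exact hx
  have hp' : p' ∈ e.source := by rw [hs, mem_preimage, ← h]; exact hx
  refine ⟨(e p).2⁻¹ * (e p').2, ?_⟩
  have hp'' : op ((e p).2⁻¹ * (e p').2) • p ∈ e.source := by
    rw [hs, mem_preimage, hπ.proj_act]; exact hx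
  refine e.injOn hp' hp'' ?_
  rw [(he p hp).2, mul_inv_cancel_left, h]
  exact Prod.ext (he p' hp').1 rfl

/-- Smooth local sections, parametrized by a chart of the base. -/
lemma IsPrincipalBundle.exists_section [IX.Boundaryless] [IsManifold IX ∞ X] (c : X) {y : EX}
    (hy : y ∈ (extChartAt IX c).target) {p : P} (hp : π p = (extChartAt IX c).symm y) :
    ∃ s : EX → P, ContMDiffAt 𝓘(ℝ, EX) IP ∞ s y ∧ s y = p ∧
      ∀ᶠ z in 𝓝 y, π (s z) = (extChartAt IX c).symm z := by
  obtain ⟨U, hU, hx, e, hs, ht, -, he', he⟩ := hπ.locally_trivial (π p)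
  have hps : p ∈ e.source := by rw [hs]; exact hx
  have h1 : ∀ᶠ z in 𝓝 y, (extChartAt IX c).symm z ∈ U := by
    refine (contMDiffAt_chart_symm (I := IX) hy).continuousAt.eventually (hU.mem_nhds ?_)
    rwa [← hp]
  -- The group component is held constant at its value at p, so that the section passes through p.
  refine ⟨fun z => e.symm ((extChartAt IX c).symm z, (e p).2), ?_, ?_, ?_⟩
  · have h2 : ((extChartAt IX c).symm y, (e p).2) ∈ e.target := by
      rw [ht]; exact ⟨h1.self_of_nhds, mem_univ _⟩
    exact (he'.contMDiffAt (e.open_target.mem_nhds h2)).comp y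
      ((contMDiffAt_chart_symm hy).prodMk contMDiffAt_const)
  · have : ((extChartAt IX c).symm y, (e p).2) = e p := by
      rw [← hp, ← (he p hps).1]
    beta_reduce
    rw [this, e.left_inv hps]
  · filter_upwards [h1] with z hz
    have h2 : ((extChartAt IX c).symm z, (e p).2) ∈ e.target := by
      rw [ht]; exact ⟨hz, mem_univ _⟩
    rw [← (he _ (e.map_target h2)).1, e.right_inv h2]

/-- Splitting of a tangent vector into a tangent vector of a section and a vertical vector. -/
lemma IsPrincipalBundle.exists_eq_add_vert [IX.Boundaryless] [IsManifold IX ∞ X] {c : X} {y : EX}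
    (hy : y ∈ (extChartAt IX c).target) {s : EX → P} (hs : ContMDiffAt 𝓘(ℝ, EX) IP ∞ s y)
    (hs' : ∀ᶠ z in 𝓝 y, π (s z) = (extChartAt IX c).symm z) (v : EP) :
    ∃ ξ : GroupLieAlgebra IG G, v = tangentMapAt 𝓘(ℝ, EX) IP s y
      (tangentMapAt IX 𝓘(ℝ, EX) (extChartAt IX c) (π (s y)) (tangentMapAt IP IX π (s y) v)) +
        vert IG IP G (s y) ξ := by
  obtain ⟨U, hU, hx, e, hes, ht, he0, -, he⟩ := hπ.locally_trivial (π (s y))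
  set p := s y with hp
  have hπp : π p = (extChartAt IX c).symm y := hs'.self_of_nhds
  have hps : p ∈ e.source := by rw [hes]; exact hx
  have hcπ : π p ∈ (extChartAt IX c).source := by
    rw [hπp]; exact (extChartAt IX c).map_target hy
  have hcy : extChartAt IX c (π p) = y := by rw [hπp, (extChartAt IX c).right_inv hy]
  let r : P → EX := fun q => extChartAt IX c (π q)
  have hr : ContMDiffAt IP 𝓘(ℝ, EX) ∞ r p :=
    ContMDiffAt.comp p (contMDiffAt_extChartAt' (n := ∞) (by simpa using hcπ)) (hπ.smooth_proj p)
  have hrp : r p = y := hcy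
  let f : P → P := fun q => s (r q)
  have hf : ContMDiffAt IP IP ∞ f p := ContMDiffAt.comp p (by rw [hrp]; exact hs) hr
  have hfp : f p = p := by
    change s (r p) = p
    rw [hrp]
  have hep : ContMDiffAt IP (IX.prod IG) ∞ e p := he0.contMDiffAt (e.open_source.mem_nhds hps)
  -- With f = s ∘ chart ∘ π, a point q near p lies in the fibre of f q, and k q is the group element
  -- that carries f q to q. The splitting is the derivative at p of q = f(q) k(q), where k(p) = 1:
  -- df gives the part along s, dk the vertical part.
  let k : P → G := fun q => (e (f q)).2⁻¹ * (e q).2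
  have hk : ContMDiffAt IP IG ∞ k p := by
    refine ContMDiffAt.mul (ContMDiffAt.inv ?_) ?_
    · exact ContMDiffAt.comp p contMDiffAt_snd (ContMDiffAt.comp p (by rw [hfp]; exact hep) hf)
    · exact ContMDiffAt.comp p contMDiffAt_snd hep
  have hkp : k p = 1 := by simp only [k, hfp, inv_mul_cancel]
  have hid : (fun q => op (k q) • f q) =ᶠ[𝓝 p] id := by
    have e1 : ∀ᶠ q in 𝓝 p, q ∈ e.source := e.open_source.mem_nhds hps
    have e2 : ∀ᶠ q in 𝓝 p, π (f q) = (extChartAt IX c).symm (r q) := by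
      have : Tendsto r (𝓝 p) (𝓝 y) := by rw [← hrp]; exact hr.continuousAt
      exact this.eventually hs'
    have e3 : ∀ᶠ q in 𝓝 p, π q ∈ (extChartAt IX c).source :=
      (hπ.smooth_proj p).continuousAt.eventually (chart_source_mem_nhds hcπ)
    filter_upwards [e1, e2, e3] with q h1 h2 h3
    have h4 : π (f q) = π q := by rw [h2, (extChartAt IX c).left_inv h3]
    have h5 : f q ∈ e.source := by rw [hes, mem_preimage, h4]; rw [hes] at h1; exact h1
    have h6 : op (k q) • f q ∈ e.source := by
      rw [hes, mem_preimage, hπ.proj_act, h4]; rw [hes] at h1; exact h1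
    refine e.injOn h6 h1 ?_
    rw [(he _ h5).2, h4]
    simp only [k, mul_inv_cancel_left]
    exact Prod.ext (he q h1).1.symm rfl
  have h1 := hπ.tangentMapAt_act_apply_one (hf.mdifferentiableAt (by simp))
    (hk.mdifferentiableAt (by simp)) hkp v
  rw [tangentMapAt_congr hid, tangentMapAt_id, hfp] at h1
  refine ⟨tangentMapAt IP IG k p v, h1.trans ?_⟩
  congr 1
  have h2 := tangentMapAt_comp_apply (I := IP) (I' := 𝓘(ℝ, EX)) (I'' := IP) (g := s) (f := r)
    (x := p) (by rw [hrp]; exact hs.mdifferentiableAt (by simp)) (hr.mdifferentiableAt (by simp)) v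
  have h3 := tangentMapAt_comp_apply (I := IP) (I' := IX) (I'' := 𝓘(ℝ, EX))
    (g := extChartAt IX c) (f := π) (x := p) (mdifferentiableAt_chart hcπ)
    ((hπ.smooth_proj p).mdifferentiableAt (by simp)) v
  rw [hrp] at h2
  exact h2.trans (congrArg _ h3)

lemma IsPrincipalBundle.exists_eq_vert [IX.Boundaryless] [IsManifold IX ∞ X] {p : P} {v : EP}
    (hv : tangentMapAt IP IX π p v = 0) : ∃ ξ : GroupLieAlgebra IG G, v = vert IG IP G p ξ := by
  obtain ⟨s, hs, hsp, hs'⟩ := hπ.exists_section (π p) (mem_extChartAt_target (I := IX) (π p))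
    (p := p) (by simp)
  obtain ⟨ξ, hξ⟩ := hπ.exists_eq_add_vert (mem_extChartAt_target (I := IX) (π p)) hs hs' v
  rw [hsp, hv, map_zero, map_zero, zero_add] at hξ
  exact ⟨ξ, hξ⟩

lemma tangentMapAt_proj_section [IX.Boundaryless] [IsManifold IX ∞ X] {c : X} {y : EX}
    {s : EX → P} (hs : ContMDiffAt 𝓘(ℝ, EX) IP ∞ s y)
    (hs' : ∀ᶠ z in 𝓝 y, π (s z) = (extChartAt IX c).symm z) (w : EX) :
    tangentMapAt IP IX π (s y) (tangentMapAt 𝓘(ℝ, EX) IP s y w) =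
      tangentMapAt 𝓘(ℝ, EX) IX (extChartAt IX c).symm y w := by
  have h1 := tangentMapAt_comp_apply (I := 𝓘(ℝ, EX)) (I' := IP) (I'' := IX) (g := π) (f := s)
    (x := y) ((hπ.smooth_proj _).mdifferentiableAt (by simp)) (hs.mdifferentiableAt (by simp)) w
  have h2 : π ∘ s =ᶠ[𝓝 y] (extChartAt IX c).symm := hs'
  rw [tangentMapAt_congr h2] at h1
  exact h1.symm

lemma IsPrincipalBundle.exists_rightInverse [IX.Boundaryless] [IsManifold IX ∞ X] (p : P) :
    ∃ L : EX →L[ℝ] EP, ∀ w, tangentMapAt IP IX π p (L w) = w := by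
  obtain ⟨s, hs, hsp, hs'⟩ := hπ.exists_section (π p) (mem_extChartAt_target (I := IX) (π p))
    (p := p) (by simp)
  refine ⟨tangentMapAt 𝓘(ℝ, EX) IP s (extChartAt IX (π p) (π p)), fun w => ?_⟩
  have h1 := tangentMapAt_proj_section hπ hs hs' w
  rw [tangentMapAt_chart_symm_self, hsp] at h1
  exact h1

/-- Invariance moves the evaluation from p to p'; there the two frames have the same projection, so
they differ by vertical vectors, which the form ignores. -/
lemma IsPrincipalBundle.basic_apply_eq [IX.Boundaryless] [IsManifold IX ∞ X] {n : ℕ}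
    {θ : DForm EP P n} (he : IsEquivariantForm IP G θ) (hh : IsHorizontalForm IG IP G θ)
    {p p' : P} (hp : π p = π p') {v v' : Fin n → EP}
    (hv : ∀ i, tangentMapAt IP IX π p (v i) = tangentMapAt IP IX π p' (v' i)) :
    θ p v = θ p' v' := by
  obtain ⟨g, rfl⟩ := hπ.exists_translation hp
  have h1 : θ p v = θ (op g • p) (fun i => tangentMapAt IP IP (fun q : P => op g • q) p (v i)) := by
    conv_lhs => rw [← he g]
    rfl
  rw [h1]
  refine ContinuousAlternatingMap.eq_of_sub_mem _ (range (vert IG IP G (op g • p))) ?_ _ _ ?_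
  · rintro w i ⟨ξ, hξ⟩
    exact hh _ w i ξ hξ.symm
  · intro i
    obtain ⟨ξ, hξ⟩ := hπ.exists_eq_vert (p := op g • p)
      (v := tangentMapAt IP IP (fun q : P => op g • q) p (v i) - v' i) (by
        rw [map_sub, hπ.tangentMapAt_proj_translation, hv i, sub_self])
    exact ⟨ξ, hξ.symm⟩

/-- Pullback under π is injective because π is onto and every tangent map of π has a right inverse.
-/
lemma IsPrincipalBundle.eq_of_pullback_eq [IX.Boundaryless] [IsManifold IX ∞ X] {n : ℕ}
    {a a' : DForm EX X n} (h : pullback IP IX π a = pullback IP IX π a') : a = a' := by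
  ext x v
  obtain ⟨p, rfl⟩ := hπ.surjective x
  obtain ⟨L, hL⟩ := hπ.exists_rightInverse p
  have h1 := DFunLike.congr_fun (congrFun h p) (fun i => L (v i))
  have h2 : (fun i => tangentMapAt IP IX π p (L (v i))) = v := by
    ext1 i
    exact hL _
  have h3 : ∀ a : DForm EX X n, pullback IP IX π a p (fun i => L (v i)) = a (π p) v := fun a =>
    congrArg (a (π p)) h2
  rw [h3, h3] at h1
  exact h1

/-- Basic forms descend. -/
lemma IsPrincipalBundle.exists_descendsTo [IX.Boundaryless] [IsManifold IX ∞ X]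
    [IP.Boundaryless] [IsManifold IP ∞ P] {n : ℕ}
    {θ : DForm EP P n} (hθ : IsSmoothForm IP θ) (he : IsEquivariantForm IP G θ)
    (hh : IsHorizontalForm IG IP G θ) : ∃ a : DForm EX X n, DescendsTo IP IX π θ a := by
  -- The form on the base is defined by an arbitrary choice of a point in each fibre and of lifts of
  -- tangent vectors; the value does not depend on them because θ is basic. Smoothness is seen on
  -- local sections s, where the form is s^*θ.
  choose σ hσ using hπ.surjective
  choose L hL using hπ.exists_rightInverse
  let a : DForm EX X n := fun x => (θ (σ x)).compContinuousLinearMap (L (σ x))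
  have ha : ∀ (p : P) (v : Fin n → EP), a (π p) (fun i => tangentMapAt IP IX π p (v i)) = θ p v := by
    intro p v
    exact hπ.basic_apply_eq he hh (hσ _) fun i => hL _ _
  refine ⟨a, isSmoothForm_of_contDiffAt fun c y hy => ?_, ?_⟩
  · obtain ⟨p, hp⟩ := hπ.surjective ((extChartAt IX c).symm y)
    obtain ⟨s, hs, -, hs'⟩ := hπ.exists_section c hy hp
    refine (hθ.contDiffAt_pullback hs).congr_of_eventuallyEq ?_
    have hds := ContMDiffAt.eventually_mdifferentiableAt hs
    filter_upwards [hds, eventually_eventually_nhds.2 hs'] with z hz hz'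
    ext v
    have h1 : ∀ w : EX, tangentMapAt IP IX π (s z) (tangentMapAt 𝓘(ℝ, EX) IP s z w) =
        tangentMapAt 𝓘(ℝ, EX) IX (extChartAt IX c).symm z w := by
      intro w
      have h1 := tangentMapAt_comp_apply (I := 𝓘(ℝ, EX)) (I' := IP) (I'' := IX) (g := π) (f := s)
        (x := z) ((hπ.smooth_proj _).mdifferentiableAt (by simp)) hz w
      have h2 : π ∘ s =ᶠ[𝓝 z] (extChartAt IX c).symm := hz'
      rw [tangentMapAt_congr h2] at h1
      exact h1.symm
    have h2 := ha (s z) (fun i => tangentMapAt 𝓘(ℝ, EX) IP s z (v i))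
    simp only [h1, hz'.self_of_nhds] at h2
    exact h2
  · ext p v
    exact ha p v

end Geometry

end

end EquivariantForms

namespace EquivariantForms

noncomputable section

/-! ### Low-degree formulas for forms on a vector space -/

section LinearAlgebra

variable {V : Type*} [NormedAddCommGroup V] [NormedSpace ℝ V]

lemma wedge_one_one_apply (a c : V [⋀^Fin 1]→L[ℝ] ℝ) (v : Fin 2 → V) :
    wedge (rfl : 1 + 1 = 2) a c v =
      a (fun _ => v 0) * c (fun _ => v 1) - a (fun _ => v 1) * c (fun _ => v 0) := by
  have hu : (Finset.univ : Finset (Equiv.Perm (Fin 2))) = {1, Equiv.swap 0 1} := by decide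
  rw [wedge_apply, hu, Finset.sum_pair (by decide)]
  have h1 : (fun k : Fin 1 => v ((1 : Equiv.Perm (Fin 2)) (Fin.cast rfl (Fin.castAdd 1 k)))) =
      fun _ => v 0 := by ext1 k; rw [Subsingleton.elim k 0]; rfl
  have h2 : (fun k : Fin 1 => v ((1 : Equiv.Perm (Fin 2)) (Fin.cast rfl (Fin.natAdd 1 k)))) =
      fun _ => v 1 := by ext1 k; rw [Subsingleton.elim k 0]; rfl
  have h3 : (fun k : Fin 1 => v (Equiv.swap (0 : Fin 2) 1 (Fin.cast rfl (Fin.castAdd 1 k)))) =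
      fun _ => v 1 := by ext1 k; rw [Subsingleton.elim k 0]; rfl
  have h4 : (fun k : Fin 1 => v (Equiv.swap (0 : Fin 2) 1 (Fin.cast rfl (Fin.natAdd 1 k)))) =
      fun _ => v 0 := by ext1 k; rw [Subsingleton.elim k 0]; rfl
  rw [h1, h2, h3, h4, Equiv.Perm.sign_swap (by decide : (0 : Fin 2) ≠ 1)]
  simp
  ring

lemma oneForm_apply_add (g : V [⋀^Fin 1]→L[ℝ] ℝ) (x z : V) :
    g (fun _ => x + z) = g (fun _ => x) + g (fun _ => z) := by
  have h : ∀ u : V, (fun _ => u) = Function.update (fun _ : Fin 1 => (0 : V)) 0 u := by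
    intro u
    ext1 i
    rw [Subsingleton.elim i 0, Function.update_self]
  rw [h (x + z), g.map_update_add, ← h, ← h]

lemma extDeriv_one_apply {θ : V → V [⋀^Fin 1]→L[ℝ] ℝ} {y : V} (v : Fin 2 → V) :
    extDeriv θ y v = fderiv ℝ θ y (v 0) (fun _ => v 1) - fderiv ℝ θ y (v 1) (fun _ => v 0) := by
  rw [extDeriv, ContinuousAlternatingMap.alternatizeUncurryFin_apply, Fin.sum_univ_two]
  have h1 : ((0 : Fin 2).removeNth v : Fin 1 → V) = fun _ => v 1 := by
    ext1 k; rw [Subsingleton.elim k 0]; rfl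
  have h2 : ((1 : Fin 2).removeNth v : Fin 1 → V) = fun _ => v 0 := by
    ext1 k; rw [Subsingleton.elim k 0]; rfl
  rw [h1, h2]
  simp [sub_eq_add_neg]

lemma fderiv_apply_eq_zero_of_line {n : ℕ} {θ : V → V [⋀^Fin n]→L[ℝ] ℝ} {y : V}
    (hθ : DifferentiableAt ℝ θ y) (v : V) (w : Fin n → V) (c : ℝ)
    (h : ∀ᶠ t in 𝓝 (0 : ℝ), θ (y + t • v) w = c) : fderiv ℝ θ y v w = 0 := by
  have h1 : HasDerivAt (fun t : ℝ => θ (y + t • v)) (fderiv ℝ θ y v) 0 := by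
    have h2 : HasDerivAt (fun t : ℝ => y + t • v) v 0 := by
      simpa using ((hasDerivAt_id (0 : ℝ)).smul_const v).const_add y
    have h3 : HasFDerivAt θ (fderiv ℝ θ y) (y + (0 : ℝ) • v) := by simpa using hθ.hasFDerivAt
    exact h3.comp_hasDerivAt 0 h2
  let ev : (V [⋀^Fin n]→L[ℝ] ℝ) →L[ℝ] ℝ :=
    (ContinuousMultilinearMap.apply ℝ (fun _ : Fin n => V) ℝ w).comp
      (ContinuousAlternatingMap.toContinuousMultilinearMapCLM ℝ)
  have h4 : HasDerivAt (fun t : ℝ => θ (y + t • v) w) (fderiv ℝ θ y v w) 0 :=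
    ev.hasFDerivAt.comp_hasDerivAt (0 : ℝ) h1
  exact h4.unique ((hasDerivAt_const (0 : ℝ) c).congr_of_eventuallyEq h)

lemma contract_monomialWedge_eq_zero {m : ℕ} {θ : Fin m → V [⋀^Fin 2]→L[ℝ] ℝ} (J : Fin m → ℕ)
    {β : ∀ n : ℕ, V [⋀^Fin n]→L[ℝ] ℝ} {x : V} (hθ : ∀ k, (θ k).curryLeft x = 0)
    (hβ : contract x β = 0) : contract x (monomialWedge θ J β) = 0 := by
  unfold monomialWedge
  induction List.finRange m with
  | nil => exact hβ
  | cons i l ih =>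
    simp only [List.foldr_cons]
    generalize hJ : J i = r
    clear hJ
    induction r with
    | zero => exact ih
    | succ r ih' =>
      rw [Function.iterate_succ_apply', contract_wedgeLeft_two, hθ, ih']
      have h1 : wedgeLeft (θ i) 0 = 0 := (wedgeOp 2 (θ i)).map_zero
      have h2 : ∀ γ : ∀ n : ℕ, V [⋀^Fin n]→L[ℝ] ℝ, wedgeLeft (0 : V [⋀^Fin 1]→L[ℝ] ℝ) γ = 0 :=
        fun γ => DFunLike.congr_fun ((wedgeOp (V := V) 1).map_zero) γ
      rw [h1, h2, add_zero]

/-- A transposition brings slot i to the front, where the contraction is known to vanish. -/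
lemma apply_eq_zero_of_curryLeft {n : ℕ} {f : V [⋀^Fin (n + 1)]→L[ℝ] ℝ} {x : V}
    (hf : f.curryLeft x = 0) (v : Fin (n + 1) → V) (i : Fin (n + 1)) (hv : v i = x) : f v = 0 := by
  have h0 : ∀ w : Fin (n + 1) → V, w 0 = x → f w = 0 := by
    intro w hw
    have h1 := DFunLike.congr_fun hf (Matrix.vecTail w)
    rw [ContinuousAlternatingMap.curryLeft_apply_apply, ← hw] at h1
    rwa [show Matrix.vecCons (w 0) (Matrix.vecTail w) = w from Matrix.cons_head_tail w] at h1
  by_cases hi : i = 0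
  · exact h0 v (hi ▸ hv)
  · have h1 : f (v ∘ Equiv.swap 0 i) = - f v :=
      f.toAlternatingMap.map_swap v (Ne.symm hi)
    rw [h0 (v ∘ Equiv.swap 0 i) (by simpa using hv)] at h1
    linarith

end LinearAlgebra

/-! ### The curvature is horizontal -/

section Connections

variable {EG : Type*} [NormedAddCommGroup EG] [NormedSpace ℝ EG] [FiniteDimensional ℝ EG]
  {HG : Type*} [TopologicalSpace HG] {IG : ModelWithCorners ℝ EG HG} [IG.Boundaryless]
  {G : Type*} [TopologicalSpace G] [ChartedSpace HG G] [Group G] [LieGroup IG ∞ G]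
  {EP : Type*} [NormedAddCommGroup EP] [NormedSpace ℝ EP] [FiniteDimensional ℝ EP]
  {HP : Type*} [TopologicalSpace HP] {IP : ModelWithCorners ℝ EP HP} [IP.Boundaryless]
  {P : Type*} [TopologicalSpace P] [ChartedSpace HP P] [IsManifold IP ∞ P] [MulAction Gᵐᵒᵖ P]
  {EX : Type*} [NormedAddCommGroup EX] [NormedSpace ℝ EX]
  {HX : Type*} [TopologicalSpace HX] {IX : ModelWithCorners ℝ EX HX} [IX.Boundaryless]
  {X : Type*} [TopologicalSpace X] [ChartedSpace HX X] [IsManifold IX ∞ X] {π : P → X}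
  {EM : Type*} [NormedAddCommGroup EM] [NormedSpace ℝ EM]
  {HM : Type*} [TopologicalSpace HM] {IM : ModelWithCorners ℝ EM HM}
  {M : Type*} [TopologicalSpace M] [ChartedSpace HM M]
  [MulAction G M] [ContMDiffSMul IG IM ∞ G M]
  {m : ℕ} {b : Module.Basis (Fin m) ℝ (GroupLieAlgebra IG G)}

/-- Bilinear expansion in the basis, averaged with its antisymmetric counterpart. The factor 1/2 and
the antisymmetric products are those that occur in the curvature when the wedge products of
one-forms are evaluated. -/
lemma repr_bracket (b : Module.Basis (Fin m) ℝ (GroupLieAlgebra IG G))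
    (l : GroupLieAlgebra IG G →ₗ[ℝ] ℝ) (ξ η : GroupLieAlgebra IG G) :
    l ⁅ξ, η⁆ = (1 / 2 : ℝ) * ∑ i, ∑ j, l ⁅b i, b j⁆ *
      (b.repr ξ i * b.repr η j - b.repr η i * b.repr ξ j) := by
  haveI := lieGroup_minSmoothness IG G
  haveI : CompleteSpace EG := FiniteDimensional.complete ℝ EG
  have key : ∀ ξ η : GroupLieAlgebra IG G,
      l ⁅ξ, η⁆ = ∑ i, ∑ j, l ⁅b i, b j⁆ * (b.repr ξ i * b.repr η j) := by
    intro ξ η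
    conv_lhs => rw [← b.sum_repr ξ, ← b.sum_repr η]
    rw [sum_lie, map_sum]
    refine Finset.sum_congr rfl fun i _ => ?_
    rw [lie_sum, map_sum]
    refine Finset.sum_congr rfl fun j _ => ?_
    rw [lie_smul, smul_lie, map_smul, map_smul, smul_eq_mul, smul_eq_mul]
    ring
  have h2 : l ⁅η, ξ⁆ = - l ⁅ξ, η⁆ := by rw [← lie_skew, map_neg]
  simp only [mul_sub, Finset.sum_sub_distrib]
  rw [← key ξ η]
  have h3 := key η ξ
  rw [h2] at h3
  rw [← h3]
  ring

lemma lie_zero_right (ξ : GroupLieAlgebra IG G) : ⁅ξ, (0 : GroupLieAlgebra IG G)⁆ = 0 := by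
  haveI := lieGroup_minSmoothness IG G
  haveI : CompleteSpace EG := FiniteDimensional.complete ℝ EG
  exact lie_zero ξ

/-- The basis-free structure equation F(v, w) = dA(v, w) + [A v, A w], which all computations with
the values of the curvature use. -/
lemma curvature_apply (A : Connection IG IP G P)
    (b : Module.Basis (Fin m) ℝ (GroupLieAlgebra IG G)) (k : Fin m) (p : P) (v : Fin 2 → EP) :
    A.curvature b k p v = extd IP (component IG A.form (b.coord k)) p v +
      b.coord k ⁅A.form p (v 0), A.form p (v 1)⁆ := by
  rw [repr_bracket b (b.coord k)]
  have h1 : A.curvature b k p v = extd IP (component IG A.form (b.coord k)) p v +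
      ((1 / 2 : ℝ) • ∑ i, ∑ j, b.repr ⁅b i, b j⁆ k • wedge (rfl : 1 + 1 = 2)
        (component IG A.form (b.coord i) p) (component IG A.form (b.coord j) p)) v := rfl
  rw [h1]
  congr 1
  rw [ContinuousAlternatingMap.smul_apply, ContinuousAlternatingMap.sum_apply, smul_eq_mul]
  congr 1
  refine Finset.sum_congr rfl fun i _ => ?_
  rw [ContinuousAlternatingMap.sum_apply]
  refine Finset.sum_congr rfl fun j _ => ?_
  rw [ContinuousAlternatingMap.smul_apply, wedge_one_one_apply]
  rfl

/-- The chart around the identity, inverted. -/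
def groupChart (IG : ModelWithCorners ℝ EG HG) (G : Type*) [TopologicalSpace G] [ChartedSpace HG G]
    [Group G] : EG → G := (extChartAt IG (1 : G)).symm

variable (IG G) in
lemma groupChart_base : groupChart IG G (extChartAt IG (1 : G) 1) = 1 := by simp [groupChart]

variable (IG G) in
lemma contMDiffAt_groupChart :
    ContMDiffAt 𝓘(ℝ, EG) IG ∞ (groupChart IG G) (extChartAt IG (1 : G) 1) :=
  contMDiffAt_chart_symm (mem_extChartAt_target (I := IG) (1 : G))

variable (IG G) in
lemma tangentMapAt_groupChart : tangentMapAt 𝓘(ℝ, EG) IG (groupChart IG G)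
    (extChartAt IG (1 : G) 1) = ContinuousLinearMap.id ℝ EG :=
  tangentMapAt_chart_symm_self (I := IG) (1 : G)

/-- Any section s through p can be corrected by a group-valued function k with k(y) = 1 and dk(y) =
- A(ds): the correction adds the vertical vector of dk, on which A is the identity, so A vanishes on
d(s k) at y. In the chart of G, k is affine. Horizontality is obtained at the point y only. -/
lemma IsPrincipalBundle.exists_horizontal_section (hπ : IsPrincipalBundle IG IP IX G π)
    (A : Connection IG IP G P) (c : X) {y : EX}
    (hy : y ∈ (extChartAt IX c).target) {p : P} (hp : π p = (extChartAt IX c).symm y) :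
    ∃ s : EX → P, ContMDiffAt 𝓘(ℝ, EX) IP ∞ s y ∧ s y = p ∧
      (∀ᶠ z in 𝓝 y, π (s z) = (extChartAt IX c).symm z) ∧
      ∀ w, A.form p (tangentMapAt 𝓘(ℝ, EX) IP s y w) = 0 := by
  obtain ⟨s, hs, hsp, hs'⟩ := hπ.exists_section c hy hp
  let T : EX →L[ℝ] EG := ContinuousLinearMap.comp (A.form p : EP →L[ℝ] EG)
    (tangentMapAt 𝓘(ℝ, EX) IP s y)
  let z₀ : EG := extChartAt IG (1 : G) 1
  let r : EX → EG := fun z => z₀ - T (z - y)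
  have hry : r y = z₀ := by simp [r]
  have hr : HasFDerivAt r (-T) y := by
    have := (T.hasFDerivAt.comp y ((hasFDerivAt_id y).sub_const y)).const_sub z₀
    simpa [r] using this
  have hrs : ContDiff ℝ ∞ r := contDiff_const.sub (T.contDiff.comp (contDiff_id.sub contDiff_const))
  let k : EX → G := fun z => groupChart IG G (r z)
  have hk : ContMDiffAt 𝓘(ℝ, EX) IG ∞ k y :=
    ContMDiffAt.comp y (by rw [hry]; exact contMDiffAt_groupChart IG G) hrs.contMDiff.contMDiffAt
  have hky : k y = 1 := by simp only [k, hry]; exact groupChart_base IG G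
  have hdk : ∀ w, tangentMapAt 𝓘(ℝ, EX) IG k y w = - T w := by
    intro w
    have h1 := tangentMapAt_comp_apply (I := 𝓘(ℝ, EX)) (I' := 𝓘(ℝ, EG)) (I'' := IG)
      (g := groupChart IG G) (f := r) (x := y)
      (by rw [hry]; exact (contMDiffAt_groupChart IG G).mdifferentiableAt (by simp))
      (hr.differentiableAt.mdifferentiableAt) w
    rw [hry, tangentMapAt_groupChart, tangentMapAt_eq_fderiv, hr.fderiv] at h1
    exact h1
  refine ⟨fun z => op (k z) • s z, ?_, ?_, ?_, fun w => ?_⟩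
  · exact ContMDiffAt.comp y (hπ.smooth_act _) (hs.prodMk hk)
  · simp only [hky, hsp, op_one, one_smul]
  · filter_upwards [hs'] with z hz
    rw [hπ.proj_act, hz]
  · have h1 := hπ.tangentMapAt_act_apply_one (hs.mdifferentiableAt (by simp))
      (hk.mdifferentiableAt (by simp)) hky w
    rw [hdk, hsp] at h1
    have h2 : A.form p (tangentMapAt 𝓘(ℝ, EX) IP (fun z => op (k z) • s z) y w) =
        A.form p (tangentMapAt 𝓘(ℝ, EX) IP s y w + vert IG IP G p (- T w : EG)) :=
      congrArg _ h1
    refine h2.trans ((map_add (A.form p) _ _).trans ?_)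
    refine (congrArg (fun u : EG => T w + u) (A.vertical p (- T w : EG))).trans ?_
    exact add_neg_cancel (T w)

/-- Pulled back to the orbit through p, A takes the constant value ζ on the left invariant field of
ζ. The Maurer–Cartan equation gives dA = - [ξ, η] on the two vertical vectors, and the bracket term
of the curvature cancels it. -/
lemma IsPrincipalBundle.curvature_vert_vert (hπ : IsPrincipalBundle IG IP IX G π)
    (A : Connection IG IP G P) (k : Fin m) (p : P) (ξ η : GroupLieAlgebra IG G) :
    A.curvature b k p ![vert IG IP G p ξ, vert IG IP G p η] = 0 := by
  let z₀ : EG := extChartAt IG (1 : G) 1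
  let o : EG → P := fun z => op (groupChart IG G z) • p
  have ho : ∀ z ∈ (extChartAt IG (1 : G)).target, ContMDiffAt 𝓘(ℝ, EG) IP ∞ o z := fun z hz =>
    ContMDiffAt.comp z (hπ.contMDiff_orbit p _) (contMDiffAt_chart_symm hz)
  have hz₀ : z₀ ∈ (extChartAt IG (1 : G)).target := mem_extChartAt_target (I := IG) (1 : G)
  have hop : o z₀ = p := by
    simp only [o]
    rw [groupChart_base, op_one, one_smul]
  have hdo : ∀ z ∈ (extChartAt IG (1 : G)).target, ∀ ζ : GroupLieAlgebra IG G,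
      tangentMapAt 𝓘(ℝ, EG) IP o z (chartInvariantField ζ z) = vert IG IP G (o z) ζ := by
    intro z hz ζ
    have h1 := tangentMapAt_comp_apply (I := 𝓘(ℝ, EG)) (I' := IG) (I'' := IP)
      (g := fun g : G => op g • p) (f := groupChart IG G) (x := z)
      ((hπ.contMDiff_orbit p _).mdifferentiableAt (by simp))
      ((contMDiffAt_chart_symm hz).mdifferentiableAt (by simp)) (chartInvariantField ζ z)
    have h2 : tangentMapAt 𝓘(ℝ, EG) IG (groupChart IG G) z (chartInvariantField ζ z) =
      mulInvariantVectorField ζ (groupChart IG G z) := tangentMapAt_chartInvariantField ζ hz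
    rw [h2] at h1
    exact h1.trans (hπ.tangentMapAt_orbit p _ ζ)
  have hs := A.smooth (b.coord k)
  have h1 := extDeriv_of_chartInvariantField (IG := IG) (G := G)
    (θ := pullback 𝓘(ℝ, EG) IP o (component IG A.form (b.coord k))) (b.coord k)
    ((hs.contDiffAt_pullback (ho z₀ hz₀)).differentiableAt (by simp)) (by
      filter_upwards [extChartAt_target_mem_nhds' hz₀] with z hz ζ
      refine (congrArg (fun v => b.coord k (A.form (o z) v)) (hdo z hz ζ)).trans ?_
      beta_reduce
      rw [A.vertical]) ξ η
  rw [extDeriv_pullback_plot hs (ho z₀ hz₀)] at h1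
  rw [curvature_apply]
  have h2 : ∀ ζ : GroupLieAlgebra IG G, tangentMapAt 𝓘(ℝ, EG) IP o z₀ ζ = vert IG IP G p ζ := by
    intro ζ
    have := hdo z₀ hz₀ ζ
    rw [chartInvariantField_self, hop] at this
    exact this
  have h3 : (fun i => tangentMapAt 𝓘(ℝ, EG) IP o z₀ ((![ξ, η] : Fin 2 → EG) i)) =
      ![vert IG IP G p ξ, vert IG IP G p η] := by
    ext1 i
    fin_cases i
    · exact h2 ξ
    · exact h2 η
  have h4 : pullback 𝓘(ℝ, EG) IP o (extd IP (component IG A.form (b.coord k))) z₀ ![ξ, η] =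
      extd IP (component IG A.form (b.coord k)) (o z₀) ![vert IG IP G p ξ, vert IG IP G p η] := by
    rw [← h3]; rfl
  rw [h4, hop] at h1
  rw [h1]
  simp [A.vertical]

/-- In the plot Ψ(y, z) = s(y) g(z) both terms of dA on the pair of coordinate directions are
derivatives of constants: A of the direction w remains 0 along the group direction, A of the group
direction remains ξ along w. The bracket term vanishes because A kills the second vector. -/
lemma IsPrincipalBundle.curvature_vert_section (hπ : IsPrincipalBundle IG IP IX G π)
    (A : Connection IG IP G P) (k : Fin m) {y : EX} {s : EX → P}
    (hs : ContMDiffAt 𝓘(ℝ, EX) IP ∞ s y) (ξ : GroupLieAlgebra IG G) (w : EX)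
    (hw : A.form (s y) (tangentMapAt 𝓘(ℝ, EX) IP s y w) = 0) :
    A.curvature b k (s y) ![vert IG IP G (s y) ξ, tangentMapAt 𝓘(ℝ, EX) IP s y w] = 0 := by
  -- The same vector regarded as an element of the model space, so that it can be used as a
  -- coordinate vector of the plot.
  obtain ⟨ζ, hζ⟩ : ∃ ζ : EG, ζ = ξ := ⟨ξ, rfl⟩
  let z₀ : EG := extChartAt IG (1 : G) 1
  have hz₀ : z₀ ∈ (extChartAt IG (1 : G)).target := mem_extChartAt_target (I := IG) (1 : G)
  let Ψ : EX × EG → P := fun q => op (groupChart IG G q.2) • s q.1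
  have hfst : ContMDiff 𝓘(ℝ, EX × EG) 𝓘(ℝ, EX) ∞ (Prod.fst : EX × EG → EX) :=
    contDiff_fst.contMDiff
  have hsnd : ContMDiff 𝓘(ℝ, EX × EG) 𝓘(ℝ, EG) ∞ (Prod.snd : EX × EG → EG) :=
    contDiff_snd.contMDiff
  have hΨ : ContMDiffAt 𝓘(ℝ, EX × EG) IP ∞ Ψ (y, z₀) := by
    refine ContMDiffAt.comp (y, z₀) (hπ.smooth_act _) (ContMDiffAt.prodMk ?_ ?_)
    · exact ContMDiffAt.comp (y, z₀) hs (hfst _)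
    · exact ContMDiffAt.comp (y, z₀) (contMDiffAt_groupChart IG G) (hsnd _)
  have hΨ0 : Ψ (y, z₀) = s y := by
    simp only [Ψ]
    rw [groupChart_base, op_one, one_smul]
  have hd : ∀ (y' : EX) (z : EG), MDifferentiableAt 𝓘(ℝ, EX) IP s y' →
      z ∈ (extChartAt IG (1 : G)).target → ∀ v : EX × EG,
      tangentMapAt 𝓘(ℝ, EX × EG) IP Ψ (y', z) v =
        tangentMapAt IP IP (fun p : P => op (groupChart IG G z) • p) (s y')
          (tangentMapAt 𝓘(ℝ, EX) IP s y' v.1) +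
        tangentMapAt IG IP (fun g : G => op g • s y') (groupChart IG G z)
          (tangentMapAt 𝓘(ℝ, EG) IG (groupChart IG G) z v.2) := by
    intro y' z hy' hz v
    have e1 : MDifferentiableAt 𝓘(ℝ, EG) IG (groupChart IG G) z :=
      (contMDiffAt_chart_symm hz).mdifferentiableAt (by simp)
    have h1 := hπ.tangentMapAt_act_apply (I := 𝓘(ℝ, EX × EG)) (x := (y', z))
      (f := s ∘ Prod.fst) (c := groupChart IG G ∘ Prod.snd)
      (MDifferentiableAt.comp (y', z) hy' ((hfst _).mdifferentiableAt (by simp)))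
      (MDifferentiableAt.comp (y', z) e1 ((hsnd _).mdifferentiableAt (by simp))) v
    have h2 := tangentMapAt_comp_apply (I := 𝓘(ℝ, EX × EG)) (I' := 𝓘(ℝ, EX)) (I'' := IP)
      (g := s) (f := Prod.fst) (x := (y', z)) hy' ((hfst _).mdifferentiableAt (by simp)) v
    have h3 := tangentMapAt_comp_apply (I := 𝓘(ℝ, EX × EG)) (I' := 𝓘(ℝ, EG)) (I'' := IG)
      (g := groupChart IG G) (f := Prod.snd) (x := (y', z)) e1
      ((hsnd _).mdifferentiableAt (by simp)) v
    rw [tangentMapAt_eq_fderiv, fderiv_fst] at h2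
    rw [tangentMapAt_eq_fderiv, fderiv_snd] at h3
    rw [h2, h3] at h1
    exact h1
  have hAs := A.smooth (b.coord k)
  set θ := pullback 𝓘(ℝ, EX × EG) IP Ψ (component IG A.form (b.coord k)) with hθ
  have hθd : DifferentiableAt ℝ θ (y, z₀) :=
    (hAs.contDiffAt_pullback hΨ).differentiableAt (by simp)
  have hθa : ∀ q v, θ q (fun _ => v) =
      b.coord k (A.form (Ψ q) (tangentMapAt 𝓘(ℝ, EX × EG) IP Ψ q v)) := fun q v => rfl
  -- Moving in the group direction translates the vector ds(w), and by equivariance A of the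
  -- translate is Ad of 0.
  have h1 : fderiv ℝ θ (y, z₀) ((0 : EX), ζ) (fun _ => (w, 0)) = 0 := by
    refine fderiv_apply_eq_zero_of_line hθd _ _ 0 ?_
    have ht : Tendsto (fun t : ℝ => z₀ + t • ζ) (𝓝 0) (𝓝 z₀) := by
      have : Continuous (fun t : ℝ => z₀ + t • ζ) := by fun_prop
      simpa using this.tendsto 0
    filter_upwards [ht.eventually (extChartAt_target_mem_nhds' hz₀)] with t ht
    have e1 : ((y, z₀) : EX × EG) + t • ((0 : EX), ζ) = (y, z₀ + t • ζ) := by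
      simp
    rw [e1, hθa, hd y _ (hs.mdifferentiableAt (by simp)) ht, map_zero, map_zero, add_zero]
    have h5 := A.equivariant (groupChart IG G (z₀ + t • ζ)) (s y)
      (tangentMapAt 𝓘(ℝ, EX) IP s y w)
    rw [hw, map_zero] at h5
    exact (congrArg (b.coord k) h5).trans (map_zero _)
  -- Along s the group direction is the fundamental vector of ξ, on which A always has the value ξ.
  have h2 : fderiv ℝ θ (y, z₀) (w, 0) (fun _ => ((0 : EX), ζ)) = 0 := by
    refine fderiv_apply_eq_zero_of_line hθd _ _ (b.coord k ξ) ?_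
    have ht : Tendsto (fun t : ℝ => y + t • w) (𝓝 0) (𝓝 y) := by
      have : Continuous (fun t : ℝ => y + t • w) := by fun_prop
      simpa using this.tendsto 0
    filter_upwards [ht.eventually (ContMDiffAt.eventually_mdifferentiableAt hs)] with t ht
    have e1 : ((y, z₀) : EX × EG) + t • ((w, 0) : EX × EG) = (y + t • w, z₀) := by
      simp
    rw [e1, hθa, hd _ z₀ ht hz₀, map_zero, map_zero, zero_add, tangentMapAt_groupChart]
    have h6 : Ψ (y + t • w, z₀) = s (y + t • w) := by
      simp only [Ψ]
      rw [groupChart_base, op_one, one_smul]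
    have h7 : tangentMapAt IG IP (fun g : G => op g • s (y + t • w)) (groupChart IG G z₀) =
        vert IG IP G (s (y + t • w)) := by
      rw [groupChart_base]; rfl
    rw [h6, h7]
    rw [hζ]
    exact congrArg (b.coord k) (A.vertical _ ξ)
  have h3 := extDeriv_one_apply (θ := θ) (y := (y, z₀)) ![((0 : EX), ζ), (w, 0)]
  have h4 : extDeriv θ (y, z₀) ![((0 : EX), ζ), (w, 0)] = 0 := by
    rw [h3]
    exact (congrArg₂ (· - ·) h1 h2).trans (sub_zero 0)
  rw [extDeriv_pullback_plot hAs hΨ] at h4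
  have h5 : (fun i => tangentMapAt 𝓘(ℝ, EX × EG) IP Ψ (y, z₀)
      ((![((0 : EX), ζ), (w, 0)] : Fin 2 → EX × EG) i)) =
      ![vert IG IP G (s y) ξ, tangentMapAt 𝓘(ℝ, EX) IP s y w] := by
    have h8 := hd y z₀ (hs.mdifferentiableAt (by simp)) hz₀
    have h7 : tangentMapAt IG IP (fun g : G => op g • s y) (groupChart IG G z₀) =
        vert IG IP G (s y) := by
      rw [groupChart_base]; rfl
    have h9 : tangentMapAt IP IP (fun p : P => op (groupChart IG G z₀) • p) (s y) =
        ContinuousLinearMap.id ℝ EP := by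
      rw [groupChart_base, ← tangentMapAt_id (I := IP) (s y)]
      congr 1
      ext1 q
      simp
    rw [h7, h9, tangentMapAt_groupChart] at h8
    ext1 i
    fin_cases i
    · refine (h8 ((0 : EX), ζ)).trans ?_
      simp [hζ]
      rfl
    · refine (h8 (w, 0)).trans ?_
      simp
      exact map_zero _
  have h6 : pullback 𝓘(ℝ, EX × EG) IP Ψ (extd IP (component IG A.form (b.coord k))) (y, z₀)
      ![((0 : EX), ζ), (w, 0)] =
      extd IP (component IG A.form (b.coord k)) (Ψ (y, z₀))
        ![vert IG IP G (s y) ξ, tangentMapAt 𝓘(ℝ, EX) IP s y w] := by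
    rw [← h5]; rfl
  rw [h6, hΨ0] at h4
  rw [curvature_apply, h4]
  simp only [Matrix.cons_val_zero, Matrix.cons_val_one]
  rw [hw, lie_zero_right, map_zero, add_zero]

/-- The second argument is split into a vector tangent to a section that is horizontal at p and a
vertical vector; the two previous lemmas treat the two parts. -/
lemma IsPrincipalBundle.curvature_curryLeft_vert (hπ : IsPrincipalBundle IG IP IX G π)
    (A : Connection IG IP G P) (k : Fin m) (p : P) (ξ : GroupLieAlgebra IG G) :
    (A.curvature b k p).curryLeft (vert IG IP G p ξ) = 0 := by
  ext v
  have hy := mem_extChartAt_target (I := IX) (π p)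
  obtain ⟨s, hs, hsp, hs', hA⟩ := hπ.exists_horizontal_section A (π p) hy (p := p) (by simp)
  obtain ⟨η, hη⟩ := hπ.exists_eq_add_vert hy hs hs' (v 0)
  generalize tangentMapAt IX 𝓘(ℝ, EX) (extChartAt IX (π p)) (π (s (extChartAt IX (π p) (π p))))
    (tangentMapAt IP IX π (s (extChartAt IX (π p) (π p))) (v 0)) = w at hη

  have h1 := hπ.curvature_vert_section (b := b) A k hs ξ w (by rw [hsp]; exact hA w)
  have h2 := hπ.curvature_vert_vert (b := b) A k (s (extChartAt IX (π p) (π p))) ξ η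
  have h3 : v = fun _ => v 0 := by
    ext1 i
    rw [Subsingleton.elim i 0]
  rw [h3, hη, oneForm_apply_add]
  rw [hsp] at h1 h2 ⊢
  have h4 : ∀ x z : EP, (A.curvature b k p).curryLeft x (fun _ => z) =
      A.curvature b k p ![x, z] := by
    intro x z
    rw [ContinuousAlternatingMap.curryLeft_apply_apply]
    congr 1
    ext1 i
    fin_cases i <;> rfl
  rw [h4, h4, h1, h2, add_zero]
  rfl

end Connections

end

end EquivariantForms

namespace EquivariantForms

noncomputable section

/-! ### Invariance, horizontality and smoothness of α(u,A) -/

lemma sum_apply_eq_sum_apply_of_eval {m : ℕ} {C D : Type*} [AddCommGroup C] [Module ℝ C]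
    [AddCommGroup D] [Module ℝ D] {ι ι' : Type*} (s : Finset ι) (s' : Finset ι')
    (q : ι → MvPolynomial (Fin m) ℝ) (q' : ι' → MvPolynomial (Fin m) ℝ) (c : ι → C) (c' : ι' → C)
    (h : ∀ ξ : Fin m → ℝ, ∑ k ∈ s, MvPolynomial.eval ξ (q k) • c k =
      ∑ k ∈ s', MvPolynomial.eval ξ (q' k) • c' k)
    (φ : MvPolynomial (Fin m) ℝ →ₗ[ℝ] Module.End ℝ D) (T : C →ₗ[ℝ] D) :
    ∑ k ∈ s, φ (q k) (T (c k)) = ∑ k ∈ s', φ (q' k) (T (c' k)) := by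
  have h1 := sum_apply_eq_zero_of_eval (s.disjSum s') (Sum.elim q q') (Sum.elim c fun k => - c' k)
    (fun ξ => by
      rw [Finset.sum_disjSum]
      simp only [Sum.elim_inl, Sum.elim_inr, smul_neg, Finset.sum_neg_distrib]
      rw [h ξ, add_neg_cancel]) φ T
  rw [Finset.sum_disjSum] at h1
  simp only [Sum.elim_inl, Sum.elim_inr, map_neg, Finset.sum_neg_distrib] at h1
  exact add_neg_eq_zero.1 h1

lemma id_prod_eq {V W : Type*} [NormedAddCommGroup V] [NormedSpace ℝ V] [NormedAddCommGroup W]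
    [NormedSpace ℝ W] (a : V →L[ℝ] W) : (ContinuousLinearMap.id ℝ V).prod a =
      ContinuousLinearMap.inl ℝ V W + (ContinuousLinearMap.inr ℝ V W).comp a := by
  ext v <;> simp

lemma contDiffAt_id_prod {V W : Type*} [NormedAddCommGroup V] [NormedSpace ℝ V]
    [NormedAddCommGroup W] [NormedSpace ℝ W] {a : V → V →L[ℝ] W} {y : V}
    (ha : ContDiffAt ℝ ∞ a y) :
    ContDiffAt ℝ ∞ (fun z => (ContinuousLinearMap.id ℝ V).prod (a z)) y := by
  simp only [id_prod_eq]
  exact contDiffAt_const.add (contDiffAt_const.clm_comp ha)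

section Smooth

variable {E : Type*} [NormedAddCommGroup E] [NormedSpace ℝ E]
  {H : Type*} [TopologicalSpace H] {I : ModelWithCorners ℝ E H}
  {M : Type*} [TopologicalSpace M] [ChartedSpace H M]

lemma IsSmoothForm.wedge {i j n : ℕ} (h : i + j = n) {θ : DForm E M i} {θ' : DForm E M j}
    (hθ : IsSmoothForm I θ) (hθ' : IsSmoothForm I θ') :
    IsSmoothForm I (fun x => wedge h (θ x) (θ' x)) := by
  intro c
  have h1 : inChart I (fun x => EquivariantForms.wedge h (θ x) (θ' x)) c = fun y =>
      wedgeCLM h (inChart I θ c y) (inChart I θ' c y) := by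
    ext1 y
    exact wedge_compContinuousLinearMap h _ _ _
  rw [h1]
  exact ((wedgeCLM (V := E) h).contDiff.comp_contDiffOn (hθ c)).clm_apply (hθ' c)

end Smooth

section Equivariance

variable {EG : Type*} [NormedAddCommGroup EG] [NormedSpace ℝ EG] [FiniteDimensional ℝ EG]
  {HG : Type*} [TopologicalSpace HG] {IG : ModelWithCorners ℝ EG HG} [IG.Boundaryless]
  {G : Type*} [TopologicalSpace G] [ChartedSpace HG G] [Group G] [LieGroup IG ∞ G]
  {EP : Type*} [NormedAddCommGroup EP] [NormedSpace ℝ EP] [FiniteDimensional ℝ EP]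
  {HP : Type*} [TopologicalSpace HP] {IP : ModelWithCorners ℝ EP HP} [IP.Boundaryless]
  {P : Type*} [TopologicalSpace P] [ChartedSpace HP P] [IsManifold IP ∞ P] [MulAction Gᵐᵒᵖ P]
  {EX : Type*} [NormedAddCommGroup EX] [NormedSpace ℝ EX]
  {HX : Type*} [TopologicalSpace HX] {IX : ModelWithCorners ℝ EX HX} [IX.Boundaryless]
  {X : Type*} [TopologicalSpace X] [ChartedSpace HX X] [IsManifold IX ∞ X] {π : P → X}
  {EM : Type*} [NormedAddCommGroup EM] [NormedSpace ℝ EM]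
  {HM : Type*} [TopologicalSpace HM] {IM : ModelWithCorners ℝ EM HM} [IM.Boundaryless]
  {M : Type*} [TopologicalSpace M] [ChartedSpace HM M] [IsManifold IM ∞ M]
  [MulAction G M] [ContMDiffSMul IG IM ∞ G M]
  {m : ℕ} {b : Module.Basis (Fin m) ℝ (GroupLieAlgebra IG G)}
  {E₁ : Type*} [NormedAddCommGroup E₁] [NormedSpace ℝ E₁]

lemma component_eq_sum (A : P → EP →L[ℝ] GroupLieAlgebra IG G)
    (b : Module.Basis (Fin m) ℝ (GroupLieAlgebra IG G)) (l : GroupLieAlgebra IG G →ₗ[ℝ] ℝ) :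
    component IG A l = ∑ j, l (b j) • component IG A (b.coord j) := by
  ext p v
  have h1 : component IG A l p v = l (A p (v 0)) := rfl
  rw [h1, Finset.sum_apply, ContinuousAlternatingMap.sum_apply]
  conv_lhs => rw [← b.sum_repr (A p (v 0)), map_sum]
  refine Finset.sum_congr rfl fun j _ => ?_
  rw [map_smul, smul_eq_mul, mul_comm]
  rfl

/-- The translate of F is Ad(g⁻¹) F: for dA because d is natural and A is equivariant, for the
bracket because Ad is a homomorphism of Lie algebras. -/
lemma IsPrincipalBundle.curvature_translation (hπ : IsPrincipalBundle IG IP IX G π)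
    (A : Connection IG IP G P) (b : Module.Basis (Fin m) ℝ (GroupLieAlgebra IG G)) (k : Fin m)
    (g : G) (p : P) :
    (A.curvature b k (op g • p)).compContinuousLinearMap
      (tangentMapAt IP IP (fun q : P => op g • q) p) =
      ∑ j, b.coord k (Ad IG g⁻¹ (b j)) • A.curvature b j p := by
  ext v
  have h1 : pullback IP IP (fun q : P => op g • q) (component IG A.form (b.coord k)) =
      component IG A.form (b.coord k ∘ₗ (Ad IG g⁻¹ : GroupLieAlgebra IG G →ₗ[ℝ] _)) := by
    ext q w
    exact congrArg (b.coord k) (A.equivariant g q (w 0))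
  have h2 := extd_pullback (A.smooth (b.coord k)) (hπ.contMDiff_translation g)
  rw [h1, component_eq_sum A.form b, extd_sum _ fun j _ => (A.smooth _).const_smul _] at h2
  have h3 := DFunLike.congr_fun (congrFun h2 p) v
  rw [Finset.sum_apply, ContinuousAlternatingMap.sum_apply] at h3
  rw [ContinuousAlternatingMap.sum_apply]
  have h4 : ∀ ζ : GroupLieAlgebra IG G, b.coord k (Ad IG g⁻¹ ζ) =
      ∑ j, b.coord k (Ad IG g⁻¹ (b j)) * b.coord j ζ := by
    intro ζ
    conv_lhs => rw [← b.sum_repr ζ, map_sum, map_sum]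
    refine Finset.sum_congr rfl fun j _ => ?_
    rw [map_smul, map_smul, smul_eq_mul, mul_comm]
    rfl
  have h5 : (A.curvature b k (op g • p)).compContinuousLinearMap
      (tangentMapAt IP IP (fun q : P => op g • q) p) v =
      A.curvature b k (op g • p) (fun i => tangentMapAt IP IP (fun q : P => op g • q) p (v i)) := rfl
  rw [h5, curvature_apply, A.equivariant, A.equivariant, ← Ad_bracket, h4]
  refine (congrArg₂ (· + ·) h3.symm rfl).trans ?_
  rw [← Finset.sum_add_distrib]
  refine Finset.sum_congr rfl fun j _ => ?_
  rw [ContinuousAlternatingMap.smul_apply, curvature_apply, extd_smul (A.smooth _), smul_add]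
  rfl

/-- The map g ↦ g · u(p g) is constant by equivariance; its derivative at the identity is du(pξ) +
X_ξ(u(p)), and A(pξ) = ξ. -/
lemma IsPrincipalBundle.covDeriv_vert (hπ : IsPrincipalBundle IG IP IX G π)
    (A : Connection IG IP G P) {u : P → M} (hu : IsEquivariantMap IM IP G u) (p : P)
    (ξ : GroupLieAlgebra IG G) : A.covDeriv IM u p (vert IG IP G p ξ) = 0 := by
  have e1 : MDifferentiableAt IG IP (fun g : G => op g • p) 1 :=
    (hπ.contMDiff_orbit p 1).mdifferentiableAt (by simp)
  have e2 : ∀ q, MDifferentiableAt IP IM u q := fun q => (hu.1 q).mdifferentiableAt (by simp)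
  have h1 := tangentMapAt_smul_apply (I := IG) (IG := IG) (IM := IM) (c := fun g : G => g)
    (w := u ∘ fun g : G => op g • p) (x := 1) mdifferentiableAt_id
    (MDifferentiableAt.comp (1 : G) (e2 _) e1) rfl ξ
  have h2 : (fun g : G => g • (u ∘ fun g : G => op g • p) g) = fun _ => u p := by
    ext1 g
    simp [hu.2]
  have h3 := tangentMapAt_comp_apply (I := IG) (I' := IP) (I'' := IM) (x := (1 : G)) (e2 _) e1 ξ
  have h4 : (op (1 : G) • p) = p := by simp
  have h5 : tangentMapAt IG IG (fun g : G => g) 1 = ContinuousLinearMap.id ℝ EG :=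
    tangentMapAt_id (I := IG) (1 : G)
  have h6 : tangentMapAt IP IM u (op (1 : G) • p) = tangentMapAt IP IM u p := by rw [h4]
  have h7 : infAct IG IM G ((u ∘ fun g : G => op g • p) 1) = infAct IG IM G (u p) := by
    simp only [Function.comp_apply, h4]
  rw [h2, h3, h5, h6, h7, tangentMapAt_const] at h1
  have h8 : A.covDeriv IM u p (vert IG IP G p ξ) = tangentMapAt IP IM u p (vert IG IP G p ξ) +
    infAct IG IM G (u p) (A.form p (vert IG IP G p ξ)) := rfl
  rw [h8, A.vertical]
  exact h1.symm

/-- Derivative of u(p g) = g⁻¹ u(p), together with the compatibility of the infinitesimal action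
with Ad for the term containing A. -/
lemma IsPrincipalBundle.covDeriv_translation (hπ : IsPrincipalBundle IG IP IX G π)
    (A : Connection IG IP G P) {u : P → M} (hu : IsEquivariantMap IM IP G u) (g : G) (p : P) :
    (A.covDeriv IM u (op g • p)).comp (tangentMapAt IP IP (fun q : P => op g • q) p) =
      (tangentMapAt IM IM (fun x : M => g⁻¹ • x) (u p)).comp (A.covDeriv IM u p) := by
  ext v
  have e2 : ∀ q, MDifferentiableAt IP IM u q := fun q => (hu.1 q).mdifferentiableAt (by simp)
  have h1 := tangentMapAt_comp_apply (I := IP) (I' := IP) (I'' := IM) (g := u)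
    (f := fun q : P => op g • q) (x := p) (e2 _)
    ((hπ.contMDiff_translation g p).mdifferentiableAt (by simp)) v
  have h2 := tangentMapAt_comp_apply (I := IP) (I' := IM) (I'' := IM) (g := fun x : M => g⁻¹ • x)
    (f := u) (x := p) ((contMDiff_smul_left IG g⁻¹ _).mdifferentiableAt (by simp)) (e2 p) v
  have h3 : u ∘ (fun q : P => op g • q) = (fun x : M => g⁻¹ • x) ∘ u := by
    ext1 q
    exact hu.2 q g
  rw [h3] at h1
  have h4 : infAct IG IM G (u (op g • p)) (A.form (op g • p)
      (tangentMapAt IP IP (fun q : P => op g • q) p v)) =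
      tangentMapAt IM IM (fun x : M => g⁻¹ • x) (u p) (infAct IG IM G (u p) (A.form p v)) := by
    rw [A.equivariant, tangentMapAt_smul_infAct, hu.2]
  refine (congrArg₂ (· + ·) (h1.symm.trans h2) h4).trans ?_
  exact (map_add _ _ _).symm

lemma subst_apply {ℓ : ℕ} (α : EquivForm IG IM b M ℓ) (u : P → M) (A : Connection IG IP G P)
    (p : P) : α.subst u A p = (∑ J ∈ multiIndices m ℓ, monomialWedge (fun k => A.curvature b k p) J
      (pull (A.covDeriv IM u p) fun n => α.coeff J n (u p))) ℓ := rfl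

lemma polyEval_apply {ℓ : ℕ} (α : (Fin m → ℕ) → ∀ n : ℕ, DForm EM M n)
    (ξ : GroupLieAlgebra IG G) (n : ℕ) (x : M) :
    polyEval IG b ℓ α ξ n x = ∑ J ∈ multiIndices m ℓ, (∏ i, b.repr ξ i ^ J i) • α J n x := by
  simp [polyEval]

/-- After translation the curvature components are linear combinations of the old ones and d_A u is
composed with the action of g⁻¹. The claim is thus the equivariance identity of α for g⁻¹ with ξ
replaced by the curvature at p. -/
lemma IsPrincipalBundle.isEquivariantForm_subst (hπ : IsPrincipalBundle IG IP IX G π) {ℓ : ℕ}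
    (α : EquivForm IG IM b M ℓ) (A : Connection IG IP G P) {u : P → M}
    (hu : IsEquivariantMap IM IP G u) : IsEquivariantForm IP G (α.subst u A) := by
  intro g
  ext1 p
  obtain ⟨φ, hφ⟩ := exists_algHom_wedgeOp (fun k => A.curvature b k p)
  -- The coordinates of Ad(g⁻¹) ξ as linear polynomials in the coordinates of ξ.
  let q : Fin m → MvPolynomial (Fin m) ℝ := fun i =>
    ∑ j, b.coord i (Ad IG g⁻¹ (b j)) • MvPolynomial.X j
  let T := pull (A.covDeriv IM u p)
  have h1 : ∀ ξ : Fin m → ℝ,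
      ∑ J ∈ multiIndices m ℓ, MvPolynomial.eval ξ (∏ i, q i ^ J i) •
        (pull (tangentMapAt IM IM (fun x : M => g⁻¹ • x) (u p))
          fun n => α.coeff J n (g⁻¹ • u p)) =
      ∑ J ∈ multiIndices m ℓ, MvPolynomial.eval ξ (∏ i, MvPolynomial.X i ^ J i) •
        (fun n => α.coeff J n (u p)) := by
    intro ξ
    ext1 n
    have h2 := congrFun (α.equivariant g⁻¹ (b.equivFun.symm ξ) n) (u p)
    rw [polyEval_apply, pullback_apply, polyEval_apply] at h2
    have h3 : ∀ i, b.repr (b.equivFun.symm ξ) i = ξ i := fun i => by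
      rw [← b.equivFun_apply, LinearEquiv.apply_symm_apply]
    have h4 : ∀ i, b.repr (Ad IG g⁻¹ (b.equivFun.symm ξ)) i = MvPolynomial.eval ξ (q i) := by
      intro i
      rw [b.equivFun_symm_apply, map_sum, map_sum, Finsupp.finsetSum_apply]
      simp only [q, map_sum]
      refine Finset.sum_congr rfl fun j _ => ?_
      rw [map_smul, map_smul, MvPolynomial.smul_eval, MvPolynomial.eval_X, Finsupp.smul_apply,
        smul_eq_mul, mul_comm]
      rfl
    simp only [h3, h4] at h2
    rw [Finset.sum_apply, Finset.sum_apply]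
    simp only [map_prod, map_pow, MvPolynomial.eval_X, Pi.smul_apply, pull_apply]
    rw [← h2]
    ext v
    simp only [ContinuousAlternatingMap.sum_apply, ContinuousAlternatingMap.smul_apply,
      ContinuousAlternatingMap.compContinuousLinearMap_apply]
  have h2 := sum_apply_eq_sum_apply_of_eval _ _ _ _ _ _ h1 φ.toLinearMap T
  have hq : ∀ i, φ (q i) = wedgeOp 2 ((A.curvature b i (op g • p)).compContinuousLinearMap
      (tangentMapAt IP IP (fun q : P => op g • q) p)) := by
    intro i
    rw [hπ.curvature_translation]
    simp only [q, map_sum, map_smul, hφ]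
  have h3 : pullback IP IP (fun p : P => op g • p) (α.subst u A) p =
      pull (tangentMapAt IP IP (fun q : P => op g • q) p)
        (∑ J ∈ multiIndices m ℓ, monomialWedge (fun k => A.curvature b k (op g • p)) J
        (pull (A.covDeriv IM u (op g • p)) fun n => α.coeff J n (u (op g • p)))) ℓ := rfl
  rw [h3, subst_apply, map_sum]
  refine congrFun (?_ : (_ : ∀ n : ℕ, EP [⋀^Fin n]→L[ℝ] ℝ) = _) ℓ
  calc _ = ∑ J ∈ multiIndices m ℓ, φ.toLinearMap (∏ i, q i ^ J i)
        (T (pull (tangentMapAt IM IM (fun x : M => g⁻¹ • x) (u p))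
          fun n => α.coeff J n (g⁻¹ • u p))) := by
        refine Finset.sum_congr rfl fun J _ => ?_
        rw [pull_monomialWedge, monomialWedge_eq_algHom _ q φ fun i => hq i]
        have h5 : pull (tangentMapAt IP IP (fun q : P => op g • q) p)
            (pull (A.covDeriv IM u (op g • p)) fun n => α.coeff J n (u (op g • p))) =
          pull ((A.covDeriv IM u (op g • p)).comp (tangentMapAt IP IP (fun q : P => op g • q) p))
            fun n => α.coeff J n (u (op g • p)) := rfl
        rw [h5, hπ.covDeriv_translation A hu, hu.2]
        rfl
    _ = _ := h2
    _ = _ := by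
        refine Finset.sum_congr rfl fun J _ => ?_
        rw [monomialWedge_eq_algHom _ MvPolynomial.X φ hφ]
        rfl

/-- Contraction with a vertical vector is a derivation on products with two-forms, and it kills both
ingredients, the curvature and the pullback under d_A u. -/
lemma IsPrincipalBundle.isHorizontalForm_subst (hπ : IsPrincipalBundle IG IP IX G π) {ℓ : ℕ}
    (α : EquivForm IG IM b M ℓ) (A : Connection IG IP G P) {u : P → M}
    (hu : IsEquivariantMap IM IP G u) : IsHorizontalForm IG IP G (α.subst u A) := by
  intro p v i ξ hv
  cases ℓ with
  | zero => exact i.elim0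
  | succ ℓ =>
    refine apply_eq_zero_of_curryLeft ?_ v i hv
    have h1 : ∀ J, contract (vert IG IP G p ξ) (monomialWedge (fun k => A.curvature b k p) J
        (pull (A.covDeriv IM u p) fun n => α.coeff J n (u p))) = 0 := by
      intro J
      refine contract_monomialWedge_eq_zero J
        (fun k => hπ.curvature_curryLeft_vert (b := b) A k p ξ) ?_
      rw [contract_pull, hπ.covDeriv_vert A hu]
      have : contract (0 : EM) (fun n => α.coeff J n (u p)) = 0 := by
        simpa using contract_smul_left (0 : ℝ) (0 : EM) (fun n => α.coeff J n (u p))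
      rw [this, map_zero]
    have h2 : contract (vert IG IP G p ξ) (∑ J ∈ multiIndices m (ℓ + 1),
        monomialWedge (fun k => A.curvature b k p) J
        (pull (A.covDeriv IM u p) fun n => α.coeff J n (u p))) = 0 := by
      generalize multiIndices m (ℓ + 1) = s
      classical
      induction s using Finset.induction_on with
      | empty => rfl
      | insert J s hJ ih => rw [Finset.sum_insert hJ, contract_add, h1, ih, add_zero]
    exact congrFun h2 ℓ

lemma isSmoothForm_curvature (A : Connection IG IP G P) (k : Fin m) :
    IsSmoothForm IP (A.curvature b k) := by
  have h1 : A.curvature b k = extd IP (component IG A.form (b.coord k)) +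
      (1 / 2 : ℝ) • ∑ i, ∑ j, b.repr ⁅b i, b j⁆ k • fun p =>
      wedge (rfl : 1 + 1 = 2) (component IG A.form (b.coord i) p)
        (component IG A.form (b.coord j) p) := by
    ext1 p
    simp only [Connection.curvature, Pi.add_apply, Pi.smul_apply, Finset.sum_apply]
  rw [h1]
  refine (A.smooth _).extd.add (IsSmoothForm.const_smul (IsSmoothForm.sum _ fun i _ =>
    IsSmoothForm.sum _ fun j _ => IsSmoothForm.const_smul ?_ _) _)
  exact (A.smooth _).wedge rfl (A.smooth _)

/-- The connection form along a plot. -/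
def Connection.along (A : Connection IG IP G P) (f : E₁ → P) (z : E₁) : E₁ →L[ℝ] EG :=
  ContinuousLinearMap.comp (A.form (f z) : EP →L[ℝ] EG) (tangentMapAt 𝓘(ℝ, E₁) IP f z)

/-- A basis of the Lie algebra as a family of vectors of the model space. -/
def modelBasis (b : Module.Basis (Fin m) ℝ (GroupLieAlgebra IG G)) (k : Fin m) : EG := b k

/-- The `k`-th component of the connection form along a plot. -/
def Connection.alongCoord (A : Connection IG IP G P)
    (b : Module.Basis (Fin m) ℝ (GroupLieAlgebra IG G)) (f : E₁ → P) (k : Fin m) (z : E₁) :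
    E₁ →L[ℝ] ℝ :=
  (ContinuousAlternatingMap.ofSubsingletonLIE (𝕜 := ℝ) (E := E₁) (F := ℝ) (0 : Fin 1)).symm
    (pullback 𝓘(ℝ, E₁) IP f (component IG A.form (b.coord k)) z)

lemma Connection.alongCoord_apply (A : Connection IG IP G P)
    (b : Module.Basis (Fin m) ℝ (GroupLieAlgebra IG G)) (f : E₁ → P) (k : Fin m) (z v : E₁) :
    A.alongCoord b f k z v = b.coord k (A.along f z v) := rfl

lemma Connection.ofSubsingleton_alongCoord (A : Connection IG IP G P)
    (b : Module.Basis (Fin m) ℝ (GroupLieAlgebra IG G)) (f : E₁ → P) (k : Fin m) (z : E₁) :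
    ContinuousAlternatingMap.ofSubsingleton ℝ E₁ ℝ (0 : Fin 1) (A.alongCoord b f k z) =
      pullback 𝓘(ℝ, E₁) IP f (component IG A.form (b.coord k)) z :=
  (ContinuousAlternatingMap.ofSubsingletonLIE (𝕜 := ℝ) (E := E₁) (F := ℝ) (0 : Fin 1)
    ).apply_symm_apply _

lemma Connection.along_eq_sum (A : Connection IG IP G P)
    (b : Module.Basis (Fin m) ℝ (GroupLieAlgebra IG G)) (f : E₁ → P) (z : E₁) :
    A.along f z = ∑ k, (A.alongCoord b f k z).smulRight (modelBasis b k) := by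
  ext v
  rw [ContinuousLinearMap.sum_apply]
  exact (b.sum_repr (A.along f z v)).symm

lemma contDiffAt_alongCoord (A : Connection IG IP G P)
    (b : Module.Basis (Fin m) ℝ (GroupLieAlgebra IG G)) {f : E₁ → P} {y : E₁}
    (hf : ContMDiffAt 𝓘(ℝ, E₁) IP ∞ f y) (k : Fin m) :
    ContDiffAt ℝ ∞ (A.alongCoord b f k) y :=
  ContDiffAt.comp y (ContinuousAlternatingMap.ofSubsingletonLIE (𝕜 := ℝ) (E := E₁) (F := ℝ)
    (0 : Fin 1)).symm.contDiff.contDiffAt ((A.smooth (b.coord k)).contDiffAt_pullback hf)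

lemma contDiffAt_along (A : Connection IG IP G P)
    (b : Module.Basis (Fin m) ℝ (GroupLieAlgebra IG G)) {f : E₁ → P} {y : E₁}
    (hf : ContMDiffAt 𝓘(ℝ, E₁) IP ∞ f y) : ContDiffAt ℝ ∞ (A.along f) y := by
  have h1 : A.along f = fun z => ∑ k, (A.alongCoord b f k z).smulRight (modelBasis b k) := by
    ext1 z
    exact A.along_eq_sum b f z
  rw [h1]
  exact ContDiffAt.sum fun k _ => (contDiffAt_alongCoord A b hf k).smulRight contDiffAt_const

variable (IG G) in
/-- The plot `(z, ζ) ↦ g(ζ) w(z)`, `g` the inverse of the chart around the identity. -/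
def actPlot (w : E₁ → M) (q : E₁ × EG) : M := groupChart IG G q.2 • w q.1

lemma contMDiffAt_actPlot {w : E₁ → M} {y : E₁} (hw : ContMDiffAt 𝓘(ℝ, E₁) IM ∞ w y) :
    ContMDiffAt 𝓘(ℝ, E₁ × EG) IM ∞ (actPlot IG G w) (y, extChartAt IG (1 : G) 1) := by
  refine ContMDiffAt.comp (y, extChartAt IG (1 : G) 1)
    (ContMDiffSMul.contMDiff_smul (I := IG) (I' := IM) (n := ∞) (G := G) (M := M) _)
    (ContMDiffAt.prodMk ?_ ?_)
  · exact ContMDiffAt.comp (y, extChartAt IG (1 : G) 1) (contMDiffAt_groupChart IG G)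
      (contDiff_snd.contMDiff _)
  · exact ContMDiffAt.comp (y, extChartAt IG (1 : G) 1) hw (contDiff_fst.contMDiff _)

lemma tangentMapAt_actPlot {w : E₁ → M} {z : E₁} (hw : MDifferentiableAt 𝓘(ℝ, E₁) IM w z)
    (v : E₁ × EG) :
    tangentMapAt 𝓘(ℝ, E₁ × EG) IM (actPlot IG G w) (z, extChartAt IG (1 : G) 1) v =
      tangentMapAt 𝓘(ℝ, E₁) IM w z v.1 + infAct IG IM G (w z) v.2 := by
  have e1 : MDifferentiableAt 𝓘(ℝ, EG) IG (groupChart IG G) (extChartAt IG (1 : G) 1) :=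
    (contMDiffAt_groupChart IG G).mdifferentiableAt (by simp)
  have e2 : MDifferentiableAt 𝓘(ℝ, E₁ × EG) 𝓘(ℝ, E₁) (Prod.fst : E₁ × EG → E₁)
    (z, extChartAt IG (1 : G) 1) := differentiableAt_fst.mdifferentiableAt
  have e3 : MDifferentiableAt 𝓘(ℝ, E₁ × EG) 𝓘(ℝ, EG) (Prod.snd : E₁ × EG → EG)
    (z, extChartAt IG (1 : G) 1) := differentiableAt_snd.mdifferentiableAt
  have h1 := tangentMapAt_smul_apply (I := 𝓘(ℝ, E₁ × EG)) (IG := IG) (IM := IM)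
    (x := (z, extChartAt IG (1 : G) 1)) (c := groupChart IG G ∘ Prod.snd) (w := w ∘ Prod.fst)
    (MDifferentiableAt.comp (z, extChartAt IG (1 : G) 1) e1 e3)
    (MDifferentiableAt.comp (z, extChartAt IG (1 : G) 1) hw e2) (groupChart_base IG G) v
  have h2 := tangentMapAt_comp_apply (I := 𝓘(ℝ, E₁ × EG)) (I' := 𝓘(ℝ, E₁)) (I'' := IM)
    (g := w) (f := Prod.fst) (x := (z, extChartAt IG (1 : G) 1)) hw e2 v
  have h3 := tangentMapAt_comp_apply (I := 𝓘(ℝ, E₁ × EG)) (I' := 𝓘(ℝ, EG)) (I'' := IG)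
    (g := groupChart IG G) (f := Prod.snd) (x := (z, extChartAt IG (1 : G) 1)) e1 e3 v
  rw [tangentMapAt_eq_fderiv, fderiv_fst] at h2
  rw [tangentMapAt_eq_fderiv, fderiv_snd, tangentMapAt_groupChart] at h3
  rw [h2, h3] at h1
  exact h1

/-- The map d_A u varies with the point and takes values in varying tangent spaces. Along a plot it
factors as the tangent map of the action plot after (id, A), which leaves a fixed smooth form on a
vector space and a linear map that depends smoothly on the point. Both smoothness and
differentiation of α(u,A) rest on this. -/
lemma covDeriv_comp_plot (A : Connection IG IP G P) {u : P → M} {f : E₁ → P} {z : E₁}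
    (hu : MDifferentiableAt IP IM u (f z)) (hf : MDifferentiableAt 𝓘(ℝ, E₁) IP f z) :
    (A.covDeriv IM u (f z)).comp (tangentMapAt 𝓘(ℝ, E₁) IP f z) =
      (tangentMapAt 𝓘(ℝ, E₁ × EG) IM (actPlot IG G (u ∘ f)) (z, extChartAt IG (1 : G) 1)).comp
        ((ContinuousLinearMap.id ℝ E₁).prod (A.along f z)) := by
  ext v
  have h1 := tangentMapAt_actPlot (IG := IG) (G := G) (MDifferentiableAt.comp z hu hf)
    (v, A.along f z v)
  have h2 := tangentMapAt_comp_apply (I := 𝓘(ℝ, E₁)) (I' := IP) (I'' := IM) hu hf v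
  refine Eq.trans ?_ h1.symm
  exact congrArg (fun x : EM => x + infAct IG IM G (u (f z)) (A.along f z v)) h2.symm

lemma pullback_subst (A : Connection IG IP G P) {u : P → M} {f : E₁ → P} {z : E₁}
    (hu : MDifferentiableAt IP IM u (f z)) (hf : MDifferentiableAt 𝓘(ℝ, E₁) IP f z) {ℓ : ℕ}
    (α : EquivForm IG IM b M ℓ) :
    pullback 𝓘(ℝ, E₁) IP f (α.subst u A) z = (∑ J ∈ multiIndices m ℓ,
      monomialWedge (fun k => pullback 𝓘(ℝ, E₁) IP f (A.curvature b k) z) J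
        (pull ((ContinuousLinearMap.id ℝ E₁).prod (A.along f z)) fun n =>
          pullback 𝓘(ℝ, E₁ × EG) IM (actPlot IG G (u ∘ f)) (α.coeff J n)
            (z, extChartAt IG (1 : G) 1))) ℓ := by
  have h3 : pullback 𝓘(ℝ, E₁) IP f (α.subst u A) z =
      pull (tangentMapAt 𝓘(ℝ, E₁) IP f z)
        (∑ J ∈ multiIndices m ℓ, monomialWedge (fun k => A.curvature b k (f z)) J
        (pull (A.covDeriv IM u (f z)) fun n => α.coeff J n (u (f z)))) ℓ := rfl
  rw [h3, map_sum]
  refine congrFun (Finset.sum_congr rfl fun J _ => ?_) ℓ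
  rw [pull_monomialWedge]
  refine congrArg (monomialWedge _ J) ?_
  have h5 : pull (tangentMapAt 𝓘(ℝ, E₁) IP f z)
      (pull (A.covDeriv IM u (f z)) fun n => α.coeff J n (u (f z))) =
    pull ((A.covDeriv IM u (f z)).comp (tangentMapAt 𝓘(ℝ, E₁) IP f z))
      fun n => α.coeff J n (u (f z)) := rfl
  rw [h5, covDeriv_comp_plot A hu hf]
  ext1 n
  have h6 : actPlot IG G (u ∘ f) (z, extChartAt IG (1 : G) 1) = u (f z) := by
    rw [actPlot, groupChart_base, one_smul]
    rfl
  rw [pull_apply, pull_apply, pullback_apply, h6]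
  rfl

lemma isSmoothForm_subst {ℓ : ℕ} (α : EquivForm IG IM b M ℓ) (A : Connection IG IP G P)
    {u : P → M} (hu : ContMDiff IP IM ∞ u) : IsSmoothForm IP (α.subst u A) := by
  refine isSmoothForm_of_contDiffAt fun c y hy => ?_
  let f : EP → P := fun z => (extChartAt IP c).symm z
  have hf : ContMDiffAt 𝓘(ℝ, EP) IP ∞ f y := contMDiffAt_chart_symm hy
  have h1 : ∀ᶠ z in 𝓝 y, inChart IP (α.subst u A) c z = (∑ J ∈ multiIndices m ℓ,
      monomialWedge (fun k => pullback 𝓘(ℝ, EP) IP f (A.curvature b k) z) J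
        (pull ((ContinuousLinearMap.id ℝ EP).prod (A.along f z)) fun n =>
          pullback 𝓘(ℝ, EP × EG) IM (actPlot IG G (u ∘ f)) (α.coeff J n)
            (z, extChartAt IG (1 : G) 1))) ℓ := by
    filter_upwards [ContMDiffAt.eventually_mdifferentiableAt hf] with z hz
    exact pullback_subst A ((hu _).mdifferentiableAt (by simp)) hz α
  refine ContDiffAt.congr_of_eventuallyEq ?_ h1
  simp only [Finset.sum_apply]
  refine ContDiffAt.sum fun J _ => ContDiffAt.monomialWedge J
    (fun k => (isSmoothForm_curvature A k).contDiffAt_pullback hf) (fun n => ?_) ℓ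
  refine ContDiffAt.compForm ?_ (contDiffAt_id_prod (contDiffAt_along A b hf))
  exact ContDiffAt.comp (f := fun z : EP => (z, extChartAt IG (1 : G) 1)) y
    ((α.smooth J n).contDiffAt_pullback
    (contMDiffAt_actPlot (ContMDiffAt.comp y (hu _) hf))) (contDiffAt_id.prodMk contDiffAt_const)

end Equivariance

end

end EquivariantForms

namespace EquivariantForms

noncomputable section

/-! ### First-order perturbation of a linear pullback -/

section Perturbation

variable {V : Type*} [NormedAddCommGroup V] [NormedSpace ℝ V]
  {V' : Type*} [NormedAddCommGroup V'] [NormedSpace ℝ V']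

lemma extDTot_add {β γ : V → ∀ n : ℕ, V [⋀^Fin n]→L[ℝ] ℝ} {y : V}
    (hβ : ∀ n, DifferentiableAt ℝ (fun z => β z n) y)
    (hγ : ∀ n, DifferentiableAt ℝ (fun z => γ z n) y) :
    extDTot (fun z => β z + γ z) y = extDTot β y + extDTot γ y := by
  rw [extDTot, extDTot, extDTot, ← altTot_add]
  congr 1
  ext1 n
  exact fderiv_fun_add (hβ n) (hγ n)

lemma extDTot_sum {ι : Type*} (s : Finset ι) {β : ι → V → ∀ n : ℕ, V [⋀^Fin n]→L[ℝ] ℝ} {y : V}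
    (hβ : ∀ k ∈ s, ∀ n, DifferentiableAt ℝ (fun z => β k z n) y) :
    extDTot (fun z => ∑ k ∈ s, β k z) y = ∑ k ∈ s, extDTot (β k) y := by
  classical
  induction s using Finset.induction_on with
  | empty =>
    simp only [Finset.sum_empty]
    ext1 n
    cases n with
    | zero => rfl
    | succ n =>
      rw [extDTot_succ]
      simp only [extDeriv, Pi.zero_apply, fderiv_fun_const]
      exact (ContinuousAlternatingMap.alternatizeUncurryFinCLM ℝ V ℝ).map_zero
  | insert a s ha ih =>
    simp only [Finset.sum_insert ha]
    rw [extDTot_add (hβ a (by simp)) fun n => ?_, ih fun k hk => hβ k (by simp [hk])]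
    simp only [Finset.sum_apply]
    exact DifferentiableAt.fun_sum fun k hk => hβ k (by simp [hk]) n

lemma extDTot_congr {β γ : V → ∀ n : ℕ, V [⋀^Fin n]→L[ℝ] ℝ} {y : V}
    (h : ∀ n, (fun z => β z n) =ᶠ[𝓝 y] fun z => γ z n) : extDTot β y = extDTot γ y := by
  rw [extDTot, extDTot]
  congr 1
  ext1 n
  exact (h n).fderiv_eq

/-- Each summand adds a term a_k ∧ ι_{x_k}, by the expansion for rank one perturbations. Since a_k
vanishes at y, the Leibniz rule leaves only da_k ∧ pull L (ι_{x_k} κ). The induction runs over all κ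
because it is also applied to ι_{x_k} κ. -/
lemma extDTot_pull_add_sum {ι : Type*} (t : Finset ι) (L : V →L[ℝ] V') (a : ι → V → V →L[ℝ] ℝ)
    (x : ι → V') {y : V} (ha : ∀ k, ContDiffAt ℝ ∞ (a k) y) (ha0 : ∀ k, a k y = 0)
    (κ : V → ∀ n : ℕ, V' [⋀^Fin n]→L[ℝ] ℝ) (hκ : ∀ n, ContDiffAt ℝ ∞ (fun z => κ z n) y) :
    (∀ n, ContDiffAt ℝ ∞ (fun z => pull (L + ∑ k ∈ t, (a k z).smulRight (x k)) (κ z) n) y) ∧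
    extDTot (fun z => pull (L + ∑ k ∈ t, (a k z).smulRight (x k)) (κ z)) y =
      extDTot (fun z => pull L (κ z)) y + ∑ k ∈ t, wedgeLeft
        (extDeriv (fun z => ContinuousAlternatingMap.ofSubsingleton ℝ V ℝ (0 : Fin 1) (a k z)) y)
        (pull L (contract (x k) (κ y))) := by
  classical
  induction t using Finset.induction_on generalizing κ with
  | empty =>
    simp only [Finset.sum_empty, add_zero, and_true]
    exact fun n => ContDiffAt.compForm (hκ n) contDiffAt_const
  | insert k t hk ih =>
    have hf : ContDiffAt ℝ ∞ (fun z => ContinuousAlternatingMap.ofSubsingleton ℝ V ℝ (0 : Fin 1)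
        (a k z)) y :=
      ContDiffAt.comp y (ContinuousAlternatingMap.ofSubsingletonLIE (𝕜 := ℝ) (E := V) (F := ℝ)
        (0 : Fin 1)).contDiff.contDiffAt (ha k)
    have hc : ∀ n, ContDiffAt ℝ ∞ (fun z => contract (x k) (κ z) n) y := fun n =>
      ContDiffAt.comp y (contractCLM (x k) n).contDiff.contDiffAt (hκ (n + 1))
    obtain ⟨i1, i2⟩ := ih κ hκ
    obtain ⟨j1, j2⟩ := ih (fun z => contract (x k) (κ z)) hc
    have e1 : (fun z => pull (L + ∑ k ∈ insert k t, (a k z).smulRight (x k)) (κ z)) = fun z =>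
        pull (L + ∑ k ∈ t, (a k z).smulRight (x k)) (κ z) +
        wedgeLeft (ContinuousAlternatingMap.ofSubsingleton ℝ V ℝ (0 : Fin 1) (a k z))
          (pull (L + ∑ k ∈ t, (a k z).smulRight (x k)) (contract (x k) (κ z))) := by
      ext1 z
      rw [← pull_add_smulRight, Finset.sum_insert hk, add_assoc, add_comm (∑ k ∈ t, _)]
    have hw := fun n => ContDiffAt.wedgeLeft hf j1 n
    have h0 : ContinuousAlternatingMap.ofSubsingleton ℝ V ℝ (0 : Fin 1) (a k y) = 0 := by
      rw [ha0 k]; rfl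
    have hL : L + ∑ k ∈ t, (a k y).smulRight (x k) = L := by
      simp [ha0]
    constructor
    · intro n
      have := congrArg (fun F => fun z => F z n) e1
      beta_reduce at this
      rw [this]
      exact (i1 n).add (hw n)
    · rw [e1, extDTot_add (fun n => (i1 n).differentiableAt (by simp))
        (fun n => (hw n).differentiableAt (by simp)), i2,
        extDTot_wedgeLeft (hf.differentiableAt (by simp))
          (fun n => (j1 n).differentiableAt (by simp)), h0, hL, Finset.sum_insert hk]
      have h1 : ∀ γ : ∀ n : ℕ, V [⋀^Fin n]→L[ℝ] ℝ, wedgeLeft (0 : V [⋀^Fin 1]→L[ℝ] ℝ) γ = 0 :=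
        fun γ => DFunLike.congr_fun ((wedgeOp (V := V) 1).map_zero) γ
      rw [h1, smul_zero, add_zero]
      abel

end Perturbation

/-! ### The square of the exterior derivative -/

section ExtdExtd

variable {E : Type*} [NormedAddCommGroup E] [NormedSpace ℝ E]
  {H : Type*} [TopologicalSpace H] {I : ModelWithCorners ℝ E H} [I.Boundaryless]
  {M : Type*} [TopologicalSpace M] [ChartedSpace H M] [IsManifold I ∞ M]

lemma extd_extd {n : ℕ} {θ : DForm E M n} (hθ : IsSmoothForm I θ) : extd I (extd I θ) = 0 := by
  ext1 x
  have hy := mem_extChartAt_target (I := I) x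
  refine eq_of_inChart_eq (I := I) (θ' := (0 : DForm E M (n + 2))) ?_
  have h1 : inChart I (extd I θ) x =ᶠ[𝓝 (extChartAt I x x)] extDeriv (inChart I θ x) := by
    filter_upwards [extChartAt_target_mem_nhds' hy] with z hz
    exact inChart_extd hθ hz
  rw [inChart_extd hθ.extd hy, h1.extDeriv_eq,
    extDeriv_extDeriv_apply (hθ.contDiffAt_inChart hy)
      (by rw [minSmoothness_of_isRCLikeNormedField]; exact two_le_infty)]
  rfl

end ExtdExtd

/-! ### The differential of α(u,A) -/

section Main

variable {EG : Type*} [NormedAddCommGroup EG] [NormedSpace ℝ EG] [FiniteDimensional ℝ EG]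
  {HG : Type*} [TopologicalSpace HG] {IG : ModelWithCorners ℝ EG HG} [IG.Boundaryless]
  {G : Type*} [TopologicalSpace G] [ChartedSpace HG G] [Group G] [LieGroup IG ∞ G]
  {EP : Type*} [NormedAddCommGroup EP] [NormedSpace ℝ EP] [FiniteDimensional ℝ EP]
  {HP : Type*} [TopologicalSpace HP] {IP : ModelWithCorners ℝ EP HP} [IP.Boundaryless]
  {P : Type*} [TopologicalSpace P] [ChartedSpace HP P] [IsManifold IP ∞ P] [MulAction Gᵐᵒᵖ P]
  {EX : Type*} [NormedAddCommGroup EX] [NormedSpace ℝ EX]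
  {HX : Type*} [TopologicalSpace HX] {IX : ModelWithCorners ℝ EX HX} [IX.Boundaryless]
  {X : Type*} [TopologicalSpace X] [ChartedSpace HX X] [IsManifold IX ∞ X] {π : P → X}
  {EM : Type*} [NormedAddCommGroup EM] [NormedSpace ℝ EM]
  {HM : Type*} [TopologicalSpace HM] {IM : ModelWithCorners ℝ EM HM} [IM.Boundaryless]
  {M : Type*} [TopologicalSpace M] [ChartedSpace HM M] [IsManifold IM ∞ M]
  [MulAction G M] [ContMDiffSMul IG IM ∞ G M]
  {m : ℕ} {b : Module.Basis (Fin m) ℝ (GroupLieAlgebra IG G)}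
  {E₁ : Type*} [NormedAddCommGroup E₁] [NormedSpace ℝ E₁]

lemma pullback_curvature (A : Connection IG IP G P) (f : E₁ → P) (k : Fin m) (z : E₁) :
    pullback 𝓘(ℝ, E₁) IP f (A.curvature b k) z =
      pullback 𝓘(ℝ, E₁) IP f (extd IP (component IG A.form (b.coord k))) z +
      (1 / 2 : ℝ) • ∑ i, ∑ j, b.repr ⁅b i, b j⁆ k • wedge (rfl : 1 + 1 = 2)
        (pullback 𝓘(ℝ, E₁) IP f (component IG A.form (b.coord i)) z)
        (pullback 𝓘(ℝ, E₁) IP f (component IG A.form (b.coord j)) z) := by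
  ext v
  simp only [pullback_apply, Connection.curvature, ← wedge_compContinuousLinearMap,
    ContinuousAlternatingMap.compContinuousLinearMap_apply, ContinuousAlternatingMap.add_apply,
    ContinuousAlternatingMap.smul_apply, ContinuousAlternatingMap.sum_apply]

lemma wedge_zero_one (a c : E₁ [⋀^Fin 1]→L[ℝ] ℝ) (h : a = 0) :
    wedge (rfl : 1 + 1 = 2) a c = 0 := by
  rw [h]
  exact DFunLike.congr_fun ((wedgeCLM (V := E₁) (rfl : 1 + 1 = 2)).map_zero) c

lemma pullback_component_eq_zero (A : Connection IG IP G P) {f : E₁ → P} {y : E₁}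
    (h0 : A.along f y = 0) (k : Fin m) :
    pullback 𝓘(ℝ, E₁) IP f (component IG A.form (b.coord k)) y = 0 := by
  ext v
  have h1 : pullback 𝓘(ℝ, E₁) IP f (component IG A.form (b.coord k)) y v =
    b.coord k (A.along f y (v 0)) := rfl
  rw [h1, h0]
  exact map_zero _

/-- Along a plot that is horizontal at `y`, the curvature is the derivative of the connection. -/
lemma pullback_curvature_of_along_eq_zero (A : Connection IG IP G P) {f : E₁ → P} {y : E₁}
    (hf : ContMDiffAt 𝓘(ℝ, E₁) IP ∞ f y) (h0 : A.along f y = 0) (k : Fin m) :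
    pullback 𝓘(ℝ, E₁) IP f (A.curvature b k) y =
      extDeriv (pullback 𝓘(ℝ, E₁) IP f (component IG A.form (b.coord k))) y := by
  rw [pullback_curvature, extDeriv_pullback_plot (A.smooth _) hf]
  simp only [wedge_zero_one _ _ (pullback_component_eq_zero A h0 _), smul_zero,
    Finset.sum_const_zero, add_zero]

/-- A product of two forms that vanish at y has derivative zero at y. -/
lemma extDeriv_wedge_one_one {a c : E₁ → E₁ [⋀^Fin 1]→L[ℝ] ℝ} {y : E₁}
    (ha : DifferentiableAt ℝ a y) (hc : DifferentiableAt ℝ c y) (ha0 : a y = 0) (hc0 : c y = 0) :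
    DifferentiableAt ℝ (fun z => wedge (rfl : 1 + 1 = 2) (a z) (c z)) y ∧
    extDeriv (fun z => wedge (rfl : 1 + 1 = 2) (a z) (c z)) y = 0 := by
  have h1 := (wedgeCLM (V := E₁) (rfl : 1 + 1 = 2)).hasFDerivAt_of_bilinear
    ha.hasFDerivAt hc.hasFDerivAt
  have h2 : HasFDerivAt (fun z => wedge (rfl : 1 + 1 = 2) (a z) (c z))
      (0 : E₁ →L[ℝ] E₁ [⋀^Fin 2]→L[ℝ] ℝ) y := by
    refine h1.congr_fderiv ?_
    rw [ha0, hc0]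
    ext1 v
    simp
  refine ⟨h2.differentiableAt, ?_⟩
  rw [extDeriv, h2.fderiv]
  exact (ContinuousAlternatingMap.alternatizeUncurryFinCLM ℝ E₁ ℝ).map_zero

/-- The Bianchi identity along a plot that is horizontal at `y`. -/
lemma extDeriv_pullback_curvature (A : Connection IG IP G P) {f : E₁ → P} {y : E₁}
    (hf : ContMDiffAt 𝓘(ℝ, E₁) IP ∞ f y) (h0 : A.along f y = 0) (k : Fin m) :
    extDeriv (pullback 𝓘(ℝ, E₁) IP f (A.curvature b k)) y = 0 := by
  have h1 : pullback 𝓘(ℝ, E₁) IP f (A.curvature b k) = fun z =>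
      pullback 𝓘(ℝ, E₁) IP f (extd IP (component IG A.form (b.coord k))) z +
      ((1 / 2 : ℝ) • ∑ i, ∑ j, b.repr ⁅b i, b j⁆ k • wedge (rfl : 1 + 1 = 2)
        (pullback 𝓘(ℝ, E₁) IP f (component IG A.form (b.coord i)) z)
        (pullback 𝓘(ℝ, E₁) IP f (component IG A.form (b.coord j)) z)) := by
    ext1 z
    exact pullback_curvature A f k z
  have hd : ∀ i, DifferentiableAt ℝ
      (pullback 𝓘(ℝ, E₁) IP f (component IG A.form (b.coord i))) y := fun i =>
    ((A.smooth _).contDiffAt_pullback hf).differentiableAt (by simp)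
  have hw := fun i j => extDeriv_wedge_one_one (hd i) (hd j) (pullback_component_eq_zero A h0 _)
    (pullback_component_eq_zero A h0 _)
  have hd2 : ∀ i, DifferentiableAt ℝ (fun z => ∑ j, b.repr ⁅b i, b j⁆ k •
      wedge (rfl : 1 + 1 = 2)
        (pullback 𝓘(ℝ, E₁) IP f (component IG A.form (b.coord i)) z)
        (pullback 𝓘(ℝ, E₁) IP f (component IG A.form (b.coord j)) z)) y := fun i =>
    DifferentiableAt.fun_sum fun j _ => (hw i j).1.fun_const_smul _
  have hc : ∀ {n : ℕ} (c : ℝ) (F : E₁ → E₁ [⋀^Fin n]→L[ℝ] ℝ),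
      extDeriv (fun z => c • F z) y = c • extDeriv F y := fun c F => extDeriv_smul c F
  have hs : ∀ {n : ℕ} {ι : Type} (t : Finset ι) (F : ι → E₁ → E₁ [⋀^Fin n]→L[ℝ] ℝ),
      (∀ i ∈ t, DifferentiableAt ℝ (F i) y) → (∀ i ∈ t, extDeriv (F i) y = 0) →
      extDeriv (fun z => ∑ i ∈ t, F i z) y = 0 := by
    intro n ι t F h1 h2
    -- Additivity of d over finite sums is taken from inhomogeneous forms, by placing each F i in
    -- degree n.
    have h3 := extDTot_sum t (β := fun i z => single (F i z)) (y := y) ?_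
    · have h4 := congrFun h3 (n + 1)
      rw [extDTot_succ, Finset.sum_apply] at h4
      simp only [extDTot_succ, Finset.sum_apply, single, Pi.single_eq_same] at h4
      exact h4.trans (Finset.sum_eq_zero h2)
    · intro i hi r
      by_cases hr : r = n
      · subst hr
        simpa [single] using h1 i hi
      · have : (fun z => single (F i z) r) = fun _ => 0 := by
          ext1 z
          exact Pi.single_eq_of_ne hr _
        rw [this]
        exact differentiableAt_const _
  rw [h1, extDeriv_fun_add
    (((A.smooth _).extd.contDiffAt_pullback hf).differentiableAt (by simp))
    ((DifferentiableAt.fun_sum fun i _ => hd2 i).fun_const_smul _), hc,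
    hs _ _ (fun i _ => hd2 i), smul_zero, add_zero]
  · have h2 := extDeriv_pullback_plot (A.smooth (b.coord k)).extd hf
    refine h2.trans ?_
    rw [extd_extd (A.smooth _)]
    rfl
  · intro i _
    refine hs _ _ (fun j _ => (hw i j).1.fun_const_smul _) fun j _ => ?_
    rw [hc, (hw i j).2, smul_zero]

/-- With the group variable fixed at the identity the action plot is w itself. -/
lemma pull_inl_pullback_actPlot {w : E₁ → M} {z : E₁} (hw : MDifferentiableAt 𝓘(ℝ, E₁) IM w z)
    {n : ℕ} (θ : DForm EM M n) :
    (pullback 𝓘(ℝ, E₁ × EG) IM (actPlot IG G w) θ (z, extChartAt IG (1 : G) 1)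
      ).compContinuousLinearMap (ContinuousLinearMap.inl ℝ E₁ EG) =
      pullback 𝓘(ℝ, E₁) IM w θ z := by
  ext v
  have h6 : actPlot IG G w (z, extChartAt IG (1 : G) 1) = w z := by
    rw [actPlot, groupChart_base, one_smul]
  rw [pullback_apply, h6]
  refine congrArg (θ (w z)) ?_
  ext1 i
  refine (tangentMapAt_actPlot hw ((v i, 0) : E₁ × EG)).trans ?_
  exact (congrArg _ (map_zero (infAct IG IM G (w z)))).trans (add_zero _)

/-- The group direction (0, ξ) is mapped by the action plot to the infinitesimal action of ξ, so
contraction with it upstairs is contraction with X_ξ on M. -/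
lemma pull_inl_contract_pullback_actPlot {w : E₁ → M} {z : E₁}
    (hw : MDifferentiableAt 𝓘(ℝ, E₁) IM w z) (θ : ∀ n : ℕ, DForm EM M n) (ξ : EG) :
    pull (ContinuousLinearMap.inl ℝ E₁ EG) (contract ((0, ξ) : E₁ × EG) fun n =>
      pullback 𝓘(ℝ, E₁ × EG) IM (actPlot IG G w) (θ n) (z, extChartAt IG (1 : G) 1)) =
      pull (tangentMapAt 𝓘(ℝ, E₁) IM w z)
        (contract (infAct IG IM G (w z) ξ) fun n => θ n (w z)) := by
  have h6 : actPlot IG G w (z, extChartAt IG (1 : G) 1) = w z := by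
    rw [actPlot, groupChart_base, one_smul]
  have h1 : (fun n => pullback 𝓘(ℝ, E₁ × EG) IM (actPlot IG G w) (θ n)
      (z, extChartAt IG (1 : G) 1)) = pull (tangentMapAt 𝓘(ℝ, E₁ × EG) IM (actPlot IG G w)
        (z, extChartAt IG (1 : G) 1)) fun n => θ n (w z) := by
    rw [← h6]
    rfl
  rw [h1, contract_pull]
  have h2 : tangentMapAt 𝓘(ℝ, E₁ × EG) IM (actPlot IG G w) (z, extChartAt IG (1 : G) 1)
      ((0, ξ) : E₁ × EG) = infAct IG IM G (w z) ξ := by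
    rw [tangentMapAt_actPlot hw]
    rw [map_zero, zero_add]
  have h3 : (tangentMapAt 𝓘(ℝ, E₁ × EG) IM (actPlot IG G w) (z, extChartAt IG (1 : G) 1)).comp
      (ContinuousLinearMap.inl ℝ E₁ EG) = tangentMapAt 𝓘(ℝ, E₁) IM w z := by
    ext v
    refine (tangentMapAt_actPlot hw ((v, 0) : E₁ × EG)).trans ?_
    exact (congrArg _ (map_zero (infAct IG IM G (w z)))).trans (add_zero _)
  rw [h2, ← h3]
  rfl

/-- The exterior derivative of the pullback of a form under the covariant derivative, along a plot
that is horizontal at `y`. -/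
lemma extDTot_pull_covDeriv (A : Connection IG IP G P)
    (b : Module.Basis (Fin m) ℝ (GroupLieAlgebra IG G)) {u : P → M} (hu : ContMDiff IP IM ∞ u)
    {f : E₁ → P} {y : E₁} (hf : ContMDiffAt 𝓘(ℝ, E₁) IP ∞ f y) (h0 : A.along f y = 0)
    {θ : ∀ n : ℕ, DForm EM M n} (hθ : ∀ n, IsSmoothForm IM (θ n)) :
    (∀ n, ContDiffAt ℝ ∞ (fun z => pull ((ContinuousLinearMap.id ℝ E₁).prod (A.along f z)) (fun n =>
      pullback 𝓘(ℝ, E₁ × EG) IM (actPlot IG G (u ∘ f)) (θ n) (z, extChartAt IG (1 : G) 1)) n) y) ∧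
    extDTot (fun z => pull ((ContinuousLinearMap.id ℝ E₁).prod (A.along f z)) fun n =>
      pullback 𝓘(ℝ, E₁ × EG) IM (actPlot IG G (u ∘ f)) (θ n) (z, extChartAt IG (1 : G) 1)) y =
      pull (tangentMapAt 𝓘(ℝ, E₁) IM (u ∘ f) y) (fun n => totalExtd IM θ n (u (f y))) +
      ∑ k, wedgeLeft (pullback 𝓘(ℝ, E₁) IP f (A.curvature b k) y)
        (pull (tangentMapAt 𝓘(ℝ, E₁) IM (u ∘ f) y)
          (contract (infAct IG IM G (u (f y)) (b k)) fun n => θ n (u (f y)))) := by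
  have hw : ContMDiffAt 𝓘(ℝ, E₁) IM ∞ (u ∘ f) y := ContMDiffAt.comp y (hu _) hf
  -- This puts (id, A) into the form treated by the perturbation lemma: the inclusion of the first
  -- factor plus one rank one term for each basis vector, with coefficients that vanish at y.
  have hL : ∀ z, (ContinuousLinearMap.id ℝ E₁).prod (A.along f z) =
      ContinuousLinearMap.inl ℝ E₁ EG +
        ∑ k, (A.alongCoord b f k z).smulRight ((0, modelBasis b k) : E₁ × EG) := by
    intro z
    rw [id_prod_eq, A.along_eq_sum b]
    congr 1
    ext v <;> simp [Prod.fst_sum, Prod.snd_sum]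
  simp only [hL]
  have ha0 : ∀ k, A.alongCoord b f k y = 0 := by
    intro k
    ext v
    rw [A.alongCoord_apply, h0]
    exact map_zero _
  obtain ⟨h1, h2⟩ := extDTot_pull_add_sum Finset.univ (ContinuousLinearMap.inl ℝ E₁ EG)
    (A.alongCoord b f) (fun k => ((0, modelBasis b k) : E₁ × EG)) (contDiffAt_alongCoord A b hf) ha0
    (fun z n => pullback 𝓘(ℝ, E₁ × EG) IM (actPlot IG G (u ∘ f)) (θ n)
      (z, extChartAt IG (1 : G) 1)) (fun n => ContDiffAt.comp
        (f := fun z : E₁ => (z, extChartAt IG (1 : G) 1)) y ((hθ n).contDiffAt_pullback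
        (contMDiffAt_actPlot hw)) (contDiffAt_id.prodMk contDiffAt_const))
  refine ⟨h1, h2.trans ?_⟩
  congr 1
  · rw [extDTot_congr (γ := fun z n => pullback 𝓘(ℝ, E₁) IM (u ∘ f) (θ n) z) fun n => ?_]
    · ext1 n
      cases n with
      | zero => rfl
      | succ n => exact extDeriv_pullback_plot (hθ n) hw
    · filter_upwards [ContMDiffAt.eventually_mdifferentiableAt hw] with z hz
      exact pull_inl_pullback_actPlot hz (θ n)
  · refine Finset.sum_congr rfl fun k _ => ?_
    -- The differential of the k-th component of A is the curvature component F^k at y, because A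
    -- vanishes there.
    have h3 := pullback_curvature_of_along_eq_zero (b := b) A hf h0 k
    have h4 : (fun z => ContinuousAlternatingMap.ofSubsingleton ℝ E₁ ℝ (0 : Fin 1)
        (A.alongCoord b f k z)) =
        pullback 𝓘(ℝ, E₁) IP f (component IG A.form (b.coord k)) := by
      ext1 z
      exact A.ofSubsingleton_alongCoord b f k z
    rw [h4, ← h3, pull_inl_contract_pullback_actPlot (hw.mdifferentiableAt (by simp))]
    rfl

/-- Displays d_G α as a polynomial with vector coefficients, as the substitution principle requires:
d contributes the monomials ξ^J, contraction with X_ξ the monomials ξ^J ξ^k. -/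
lemma EquivForm.dG_apply {ℓ : ℕ} (α : EquivForm IG IM b M ℓ) (ξ : Fin m → ℝ) (x : M) :
    (fun n => α.dG (b.equivFun.symm ξ) n x) =
      ∑ J ∈ multiIndices m ℓ, (∏ i, ξ i ^ J i) • (fun n => totalExtd IM (α.coeff J) n x) +
      ∑ J ∈ multiIndices m ℓ, ∑ k, ((∏ i, ξ i ^ J i) * ξ k) •
        (contract (infAct IG IM G x (b k)) fun n => α.coeff J n x) := by
  have h3 : ∀ i, b.repr (b.equivFun.symm ξ) i = ξ i := fun i => by
    rw [← b.equivFun_apply, LinearEquiv.apply_symm_apply]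
  have h4 : ∀ n, α.eval (b.equivFun.symm ξ) n =
      ∑ J ∈ multiIndices m ℓ, (∏ i, ξ i ^ J i) • α.coeff J n := by
    intro n
    simp only [EquivForm.eval, polyEval, h3]
  have h5 : (fun n => totalExtd IM (α.eval (b.equivFun.symm ξ)) n x) =
      ∑ J ∈ multiIndices m ℓ, (∏ i, ξ i ^ J i) • (fun n => totalExtd IM (α.coeff J) n x) := by
    ext1 n
    rw [Finset.sum_apply]
    cases n with
    | zero => simp [totalExtd]
    | succ n =>
      simp only [totalExtd]
      rw [h4, extd_sum _ fun J _ => (α.smooth J n).const_smul _, Finset.sum_apply]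
      refine Finset.sum_congr rfl fun J _ => ?_
      rw [extd_smul (α.smooth J n)]
      rfl
  have h6 : (fun n => totalInterior (fun x => infAct IG IM G x (b.equivFun.symm ξ))
      (α.eval (b.equivFun.symm ξ)) n x) = ∑ J ∈ multiIndices m ℓ, ∑ k, ((∏ i, ξ i ^ J i) * ξ k) •
        (contract (infAct IG IM G x (b k)) fun n => α.coeff J n x) := by
    have h7 : (fun n => totalInterior (fun x => infAct IG IM G x (b.equivFun.symm ξ))
      (α.eval (b.equivFun.symm ξ)) n x) = contract (infAct IG IM G x (b.equivFun.symm ξ))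
        (∑ J ∈ multiIndices m ℓ, (∏ i, ξ i ^ J i) • fun n => α.coeff J n x) := by
      ext1 n
      simp only [totalInterior, h4, contract, Finset.sum_apply, Pi.smul_apply]
    have h8 : ∀ (v : EM) (s : Finset (Fin m → ℕ)) (F : (Fin m → ℕ) → ∀ n : ℕ, EM [⋀^Fin n]→L[ℝ] ℝ),
        contract v (∑ J ∈ s, F J) = ∑ J ∈ s, contract v (F J) := by
      intro v s F
      classical
      induction s using Finset.induction_on with
      | empty => rfl
      | insert J s hJ ih => rw [Finset.sum_insert hJ, Finset.sum_insert hJ, contract_add, ih]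
    have h9 : ∀ (s : Finset (Fin m)) (c : Fin m → ℝ) (v : Fin m → EM)
        (F : ∀ n : ℕ, EM [⋀^Fin n]→L[ℝ] ℝ),
        contract (∑ k ∈ s, c k • v k) F = ∑ k ∈ s, c k • contract (v k) F := by
      intro s c v F
      classical
      induction s using Finset.induction_on with
      | empty => simpa using contract_smul_left (0 : ℝ) (0 : EM) F
      | insert k s hk ih =>
        rw [Finset.sum_insert hk, Finset.sum_insert hk, contract_add_left, ih, contract_smul_left]
    have h10 : infAct IG IM G x (b.equivFun.symm ξ) = ∑ k, ξ k • infAct IG IM G x (b k) := by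
      rw [b.equivFun_symm_apply, map_sum]
      exact Finset.sum_congr rfl fun k _ => map_smul _ _ _
    rw [h7, h8, h10]
    refine Finset.sum_congr rfl fun J _ => ?_
    rw [contract_smul, h9, Finset.smul_sum]
    refine Finset.sum_congr rfl fun k _ => ?_
    rw [smul_smul]
  rw [← h5, ← h6]
  rfl

/-- The differential of `α(u,A)` along a plot that is horizontal at `y`. -/
lemma extDeriv_pullback_subst (A : Connection IG IP G P) {u : P → M} (hu : ContMDiff IP IM ∞ u)
    {f : E₁ → P} {y : E₁} (hf : ContMDiffAt 𝓘(ℝ, E₁) IP ∞ f y) (h0 : A.along f y = 0) {ℓ : ℕ}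
    (α : EquivForm IG IM b M ℓ) (β : EquivForm IG IM b M (ℓ + 1))
    (h : ∀ ξ, α.dG ξ = β.eval ξ) :
    extDeriv (pullback 𝓘(ℝ, E₁) IP f (α.subst u A)) y =
      pullback 𝓘(ℝ, E₁) IP f (β.subst u A) y := by
  have hu' : ∀ p, MDifferentiableAt IP IM u p := fun p => (hu p).mdifferentiableAt (by simp)
  let Θ : Fin m → E₁ → E₁ [⋀^Fin 2]→L[ℝ] ℝ := fun k => pullback 𝓘(ℝ, E₁) IP f (A.curvature b k)
  have hΘ : ∀ k, ContDiffAt ℝ ∞ (Θ k) y := fun k =>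
    (isSmoothForm_curvature A k).contDiffAt_pullback hf
  let B : (Fin m → ℕ) → E₁ → ∀ n : ℕ, E₁ [⋀^Fin n]→L[ℝ] ℝ := fun J z =>
    pull ((ContinuousLinearMap.id ℝ E₁).prod (A.along f z)) fun n =>
      pullback 𝓘(ℝ, E₁ × EG) IM (actPlot IG G (u ∘ f)) (α.coeff J n) (z, extChartAt IG (1 : G) 1)
  have hB := fun J => extDTot_pull_covDeriv A b hu hf h0 (α.smooth J)
  have h1 : pullback 𝓘(ℝ, E₁) IP f (α.subst u A) =ᶠ[𝓝 y] fun z =>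
      (∑ J ∈ multiIndices m ℓ, monomialWedge (fun k => Θ k z) J (B J z)) ℓ := by
    filter_upwards [ContMDiffAt.eventually_mdifferentiableAt hf] with z hz
    exact pullback_subst A (hu' _) hz α
  obtain ⟨φ, hφ⟩ := exists_algHom_wedgeOp (fun k => Θ k y)
  let T := pull (tangentMapAt 𝓘(ℝ, E₁) IM (u ∘ f) y)
  -- The hypothesis d_G α = β with ξ replaced by the curvature at y. The index set on the left is
  -- the disjoint union of the indices J, for dα_J, and the pairs (J, k), for ι(X_{e_k}) α_J.
  have h2 := sum_apply_eq_sum_apply_of_eval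
    ((multiIndices m ℓ).disjSum (multiIndices m ℓ ×ˢ Finset.univ)) (multiIndices m (ℓ + 1))
    (Sum.elim (fun J => ∏ i, MvPolynomial.X i ^ J i)
      (fun Jk => (∏ i, MvPolynomial.X i ^ Jk.1 i) * MvPolynomial.X Jk.2))
    (fun J => ∏ i, MvPolynomial.X i ^ J i)
    (Sum.elim (fun J n => totalExtd IM (α.coeff J) n (u (f y)))
      (fun Jk => contract (infAct IG IM G (u (f y)) (b Jk.2)) fun n => α.coeff Jk.1 n (u (f y))))
    (fun J n => β.coeff J n (u (f y))) (fun ξ => by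
      rw [Finset.sum_disjSum, Finset.sum_product]
      simp only [Sum.elim_inl, Sum.elim_inr, map_prod, map_mul, map_pow, MvPolynomial.eval_X]
      rw [← α.dG_apply, h]
      ext1 n
      rw [EquivForm.eval, polyEval_apply, Finset.sum_apply]
      refine Finset.sum_congr rfl fun J _ => ?_
      have h3 : ∀ i, b.repr (b.equivFun.symm ξ) i = ξ i := fun i => by
        rw [← b.equivFun_apply, LinearEquiv.apply_symm_apply]
      simp only [h3]
      rfl) φ.toLinearMap T
  rw [Finset.sum_disjSum, Finset.sum_product] at h2
  simp only [Sum.elim_inl, Sum.elim_inr] at h2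
  have h3 : ∀ J (γ : ∀ n : ℕ, E₁ [⋀^Fin n]→L[ℝ] ℝ), monomialWedge (fun k => Θ k y) J γ =
      φ.toLinearMap (∏ i, MvPolynomial.X i ^ J i) γ := fun J γ =>
    monomialWedge_eq_algHom _ MvPolynomial.X φ hφ J γ
  have h4 : extDTot (fun z => ∑ J ∈ multiIndices m ℓ, monomialWedge (fun k => Θ k z) J (B J z)) y =
      ∑ J ∈ multiIndices m (ℓ + 1), φ.toLinearMap (∏ i, MvPolynomial.X i ^ J i)
        (T fun n => β.coeff J n (u (f y))) := by
    rw [extDTot_sum _ fun J _ n => (ContDiffAt.monomialWedge J hΘ (hB J).1 n).differentiableAt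
      (by simp), ← h2, ← Finset.sum_add_distrib]
    refine Finset.sum_congr rfl fun J _ => ?_
    rw [extDTot_monomialWedge J (fun k => (hΘ k).of_le (by simp))
      (fun n => ((hB J).1 n).of_le (by simp)) fun k => extDeriv_pullback_curvature A hf h0 k,
      (hB J).2, h3, map_add, map_sum]
    congr 1
    refine Finset.sum_congr rfl fun k _ => ?_
    -- The additional variable ξ^k is the additional factor F^k that the derivative of the covariant
    -- pullback produces.
    have h5 : φ.toLinearMap ((∏ i, MvPolynomial.X i ^ J i) * MvPolynomial.X k) =
        φ.toLinearMap (∏ i, MvPolynomial.X i ^ J i) * wedgeOp 2 (Θ k y) := by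
      rw [← hφ k]
      exact map_mul φ _ _
    rw [h5]
    rfl
  rw [h1.extDeriv_eq]
  refine (congrFun h4 (ℓ + 1)).trans ?_
  rw [pullback_subst A (hu' _) (hf.mdifferentiableAt (by simp)) β]
  refine congrFun (Finset.sum_congr rfl fun J _ => ?_) (ℓ + 1)
  rw [h3, h0]
  congr 1
  ext1 n
  have h6 : (ContinuousLinearMap.id ℝ E₁).prod (0 : E₁ →L[ℝ] EG) =
      ContinuousLinearMap.inl ℝ E₁ EG := by ext v <;> simp
  rw [h6]
  exact (pull_inl_pullback_actPlot (MDifferentiableAt.comp y (hu' _)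
    (hf.mdifferentiableAt (by simp))) (β.coeff J n)).symm

/-- `d α(u,A) = (d_G α)(u,A)` on the base. -/
lemma IsPrincipalBundle.extd_eq_of_descendsTo (hπ : IsPrincipalBundle IG IP IX G π) {ℓ : ℕ}
    (α : EquivForm IG IM b M ℓ) (β : EquivForm IG IM b M (ℓ + 1)) (A : Connection IG IP G P)
    {u : P → M} (hu : ContMDiff IP IM ∞ u) (h : ∀ ξ, α.dG ξ = β.eval ξ) {a : DForm EX X ℓ}
    {a' : DForm EX X (ℓ + 1)} (ha : DescendsTo IP IX π (α.subst u A) a)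
    (ha' : DescendsTo IP IX π (β.subst u A) a') : extd IX a = a' := by
  ext1 x
  refine eq_of_inChart_eq (I := IX) ?_
  have hy := mem_extChartAt_target (I := IX) x
  obtain ⟨p, hp⟩ := hπ.surjective x
  -- Both sides are forms on X, so they may be compared at one point on any section through a point
  -- above it; this one makes A vanish there. Near the point a is the pullback of α(u,A) under s.
  obtain ⟨s, hs, hsp, hs', hA⟩ := hπ.exists_horizontal_section A x hy (p := p) (by simpa using hp)
  have h0 : A.along s (extChartAt IX x x) = 0 := by
    ext w
    rw [← hsp] at hA
    exact hA w
  have key : ∀ {n : ℕ} (θ : DForm EX X n), inChart IX θ x =ᶠ[𝓝 (extChartAt IX x x)]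
      pullback 𝓘(ℝ, EX) IP s (pullback IP IX π θ) := by
    intro n θ
    filter_upwards [ContMDiffAt.eventually_mdifferentiableAt hs,
      eventually_eventually_nhds.2 hs'] with z hz hz'
    have h1 : (extChartAt IX x).symm =ᶠ[𝓝 z] π ∘ s := by
      filter_upwards [hz'] with q hq
      exact hq.symm
    rw [inChart, pullback_congr h1]
    exact pullback_comp_apply ((hπ.smooth_proj _).mdifferentiableAt (by simp)) hz θ
  rw [inChart_extd ha.1 hy, (key a).extDeriv_eq, ha.2, extDeriv_pullback_subst A hu hs h0 α β h,
    ← ha'.2]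
  exact (key a').self_of_nhds.symm

end Main

end

end EquivariantForms

namespace EquivariantForms

noncomputable section

/-! ### Differentiation under the integral over [0,1] -/

section ParametricIntegral

universe u

variable {E : Type u} [NormedAddCommGroup E] [NormedSpace ℝ E] [FiniteDimensional ℝ E]

lemma hasFDerivAt_intervalIntegral {F : Type*} [NormedAddCommGroup F] [NormedSpace ℝ F]
    {g : ℝ × E → F} {U : Set E} (hU : IsOpen U) (hg : ContDiffOn ℝ 1 g (univ ×ˢ U)) {y : E}
    (hy : y ∈ U) :
    HasFDerivAt (fun x => ∫ t in (0 : ℝ)..1, g (t, x))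
      (∫ t in (0 : ℝ)..1, (fderiv ℝ g (t, y)).comp (ContinuousLinearMap.inr ℝ ℝ E)) y := by
  have hUo : IsOpen ((univ : Set ℝ) ×ˢ U) := isOpen_univ.prod hU
  have hc : ContinuousOn (fun q => (fderiv ℝ g q).comp (ContinuousLinearMap.inr ℝ ℝ E))
      (univ ×ˢ U) :=
    (hg.continuousOn_fderiv_of_isOpen hUo (by simp)).clm_comp continuousOn_const
  have hline : ∀ x : E, ContinuousOn (fun t : ℝ => (t, x)) univ := fun x =>
    (continuous_id.prodMk continuous_const).continuousOn
  have hgc : ∀ x ∈ U, Continuous (fun t : ℝ => g (t, x)) := fun x hx =>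
    continuousOn_univ.1 (hg.continuousOn.comp (hline x) fun t _ => ⟨mem_univ _, hx⟩)
  -- The dominating constant is the maximum of the partial derivative on [0,1] times a closed ball;
  -- half the radius keeps the ball inside U.
  obtain ⟨r, hr, hrU⟩ := Metric.isOpen_iff.1 hU y hy
  haveI : ProperSpace E := FiniteDimensional.proper ℝ E
  have hK : IsCompact (Icc (0 : ℝ) 1 ×ˢ Metric.closedBall y (r / 2)) :=
    isCompact_Icc.prod (isCompact_closedBall _ _)
  have hsub : Metric.closedBall y (r / 2) ⊆ U :=
    (Metric.closedBall_subset_ball (by linarith)).trans hrU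
  obtain ⟨C, hC⟩ := hK.exists_bound_of_continuousOn
    (hc.mono (prod_mono (subset_univ _) hsub))
  refine intervalIntegral.hasFDerivAt_integral_of_dominated_of_fderiv_le
    (F := fun x t => g (t, x)) (bound := fun _ => C)
    (F' := fun x t => (fderiv ℝ g (t, x)).comp (ContinuousLinearMap.inr ℝ ℝ E))
    (Metric.closedBall_mem_nhds y (half_pos hr)) ?_ ((hgc y hy).intervalIntegrable _ _) ?_ ?_
    intervalIntegrable_const ?_
  · filter_upwards [hU.mem_nhds hy] with x hx
    exact (hgc x hx).aestronglyMeasurable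
  · exact (continuousOn_univ.1 (hc.comp (hline y) fun t _ => ⟨mem_univ _, hy⟩)).aestronglyMeasurable
  · refine Eventually.of_forall fun t ht x hx => ?_
    rw [uIoc_of_le zero_le_one] at ht
    exact hC (t, x) ⟨⟨ht.1.le, ht.2⟩, hx⟩
  · refine Eventually.of_forall fun t ht x hx => ?_
    have h1 : HasFDerivAt g (fderiv ℝ g (t, x)) (t, x) :=
      ((hg.contDiffAt (hUo.mem_nhds ⟨mem_univ _, hsub hx⟩)).differentiableAt (by simp)).hasFDerivAt
    have h2 : HasFDerivAt (fun x : E => (t, x)) (ContinuousLinearMap.inr ℝ ℝ E) x :=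
      hasFDerivAt_prodMk_right t x
    exact h1.comp x h2

lemma clm_fderiv_intervalIntegral {F F' : Type*} [NormedAddCommGroup F] [NormedSpace ℝ F]
    [CompleteSpace F] [NormedAddCommGroup F'] [NormedSpace ℝ F'] [CompleteSpace F']
    (L : (E →L[ℝ] F) →L[ℝ] F') {g : ℝ × E → F} {U : Set E} (hU : IsOpen U)
    (hg : ContDiffOn ℝ 1 g (univ ×ˢ U)) {y : E} (hy : y ∈ U) :
    L (fderiv ℝ (fun x => ∫ t in (0 : ℝ)..1, g (t, x)) y) =
      ∫ t in (0 : ℝ)..1, L ((fderiv ℝ g (t, y)).comp (ContinuousLinearMap.inr ℝ ℝ E)) := by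
  have hUo : IsOpen ((univ : Set ℝ) ×ˢ U) := isOpen_univ.prod hU
  have hline : ContinuousOn (fun t : ℝ => (t, y)) univ :=
    (continuous_id.prodMk continuous_const).continuousOn
  have hc : Continuous fun t : ℝ => (fderiv ℝ g (t, y)).comp (ContinuousLinearMap.inr ℝ ℝ E) :=
    continuousOn_univ.1 (((hg.continuousOn_fderiv_of_isOpen hUo (by simp)).comp hline
      fun t _ => ⟨mem_univ _, hy⟩).clm_comp continuousOn_const)
  rw [(hasFDerivAt_intervalIntegral hU hg hy).fderiv]
  exact (L.intervalIntegral_comp_comm (hc.intervalIntegrable 0 1)).symm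

/-- Induction on the order of differentiability. The derivative of the integral is the integral of
the partial derivative, whose values are linear maps from E to F, so the induction runs over all
targets F; for this E and F share one universe. -/
lemma contDiffOn_intervalIntegral {F : Type u} [NormedAddCommGroup F] [NormedSpace ℝ F]
    {g : ℝ × E → F} {U : Set E} (hU : IsOpen U) (hg : ContDiffOn ℝ ∞ g (univ ×ˢ U)) :
    ContDiffOn ℝ ∞ (fun x => ∫ t in (0 : ℝ)..1, g (t, x)) U := by
  rw [contDiffOn_infty]
  intro n
  induction n generalizing F with
  | zero =>
    rw [Nat.cast_zero, contDiffOn_zero]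
    intro y hy
    exact (hasFDerivAt_intervalIntegral hU (hg.of_le (by simp)) hy).continuousAt.continuousWithinAt
  | succ n ih =>
    rw [Nat.cast_succ, contDiffOn_succ_iff_fderiv_of_isOpen hU]
    have hUo : IsOpen ((univ : Set ℝ) ×ˢ U) := isOpen_univ.prod hU
    refine ⟨fun y hy => (hasFDerivAt_intervalIntegral hU (hg.of_le (by simp)) hy
      ).differentiableAt.differentiableWithinAt, fun h => absurd h (by simp), ?_⟩
    refine (ih (g := fun q => (fderiv ℝ g q).comp (ContinuousLinearMap.inr ℝ ℝ E)) ?_).congr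
      fun y hy => (hasFDerivAt_intervalIntegral hU (hg.of_le (by simp)) hy).fderiv
    exact (hg.fderiv_of_isOpen hUo (by simp)).clm_comp contDiffOn_const

end ParametricIntegral

/-! ### The homotopy formula on ℝ times a vector space -/

section Homotopy

universe u

variable {E : Type u} [NormedAddCommGroup E] [NormedSpace ℝ E]

/-- Restriction of a form on `ℝ × E` to the slice through a point. -/
def sliceCLM (E : Type*) [NormedAddCommGroup E] [NormedSpace ℝ E] (n : ℕ) :
    ((ℝ × E) [⋀^Fin n]→L[ℝ] ℝ) →L[ℝ] E [⋀^Fin n]→L[ℝ] ℝ :=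
  ContinuousAlternatingMap.compContinuousLinearMapCLM (ContinuousLinearMap.inr ℝ ℝ E)

lemma sliceCLM_apply {n : ℕ} (f : (ℝ × E) [⋀^Fin n]→L[ℝ] ℝ) :
    sliceCLM E n f = f.compContinuousLinearMap (ContinuousLinearMap.inr ℝ ℝ E) := rfl

lemma hasDerivAt_slice {n : ℕ} {B : ℝ × E → (ℝ × E) [⋀^Fin n]→L[ℝ] ℝ} {t : ℝ} {y : E}
    (hB : DifferentiableAt ℝ B (t, y)) :
    HasDerivAt (fun s => sliceCLM E n (B (s, y))) (sliceCLM E n (fderiv ℝ B (t, y) (1, 0))) t := by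
  have h1 : HasDerivAt (fun s : ℝ => (s, y)) ((1 : ℝ), (0 : E)) t :=
    (hasDerivAt_id t).prodMk (hasDerivAt_const t y)
  exact (sliceCLM E n).hasFDerivAt.comp_hasDerivAt t (hB.hasFDerivAt.comp_hasDerivAt t h1)

/-- Cartan's formula for a closed form, restricted to slices. -/
lemma slice_fderiv_eq {n : ℕ} {B : ℝ × E → (ℝ × E) [⋀^Fin (n + 1)]→L[ℝ] ℝ} {t : ℝ} {y : E}
    (hB : DifferentiableAt ℝ B (t, y)) (h0 : extDeriv B (t, y) = 0) :
    sliceCLM E (n + 1) (fderiv ℝ B (t, y) (1, 0)) =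
      ContinuousAlternatingMap.alternatizeUncurryFin
        ((fderiv ℝ (fun q => sliceCLM E n (contractCLM (1, 0) n (B q))) (t, y)).comp
          (ContinuousLinearMap.inr ℝ ℝ E)) := by
  have h1 := curryLeft_alternatizeUncurryFin (fderiv ℝ B (t, y)) (1, 0)
  have h2 : ContinuousAlternatingMap.alternatizeUncurryFin (fderiv ℝ B (t, y)) = 0 := h0
  rw [h2] at h1
  have h3 : fderiv ℝ B (t, y) (1, 0) = ContinuousAlternatingMap.alternatizeUncurryFin
      ((contractCLM ((1, 0) : ℝ × E) n).comp (fderiv ℝ B (t, y))) := by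
    have h4 : (0 : (ℝ × E) [⋀^Fin (n + 2)]→L[ℝ] ℝ).curryLeft (1, 0) = 0 := by
      ext v
      simp
    rw [h4] at h1
    exact sub_eq_zero.1 h1.symm
  have h5 : fderiv ℝ (fun q => sliceCLM E n (contractCLM (1, 0) n (B q))) (t, y) =
      (sliceCLM E n).comp ((contractCLM ((1, 0) : ℝ × E) n).comp (fderiv ℝ B (t, y))) :=
    ((sliceCLM E n).hasFDerivAt.comp (t, y)
      ((contractCLM ((1, 0) : ℝ × E) n).hasFDerivAt.comp (t, y) hB.hasFDerivAt)).fderiv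
  rw [h5, h3]
  ext v
  rw [sliceCLM_apply, ContinuousAlternatingMap.compContinuousLinearMap_apply,
    ContinuousAlternatingMap.alternatizeUncurryFin_apply,
    ContinuousAlternatingMap.alternatizeUncurryFin_apply]
  rfl

lemma fderiv_eq_zero_of_extDeriv {B : ℝ × E → (ℝ × E) [⋀^Fin 0]→L[ℝ] ℝ} {q : ℝ × E}
    (h0 : extDeriv B q = 0) (v : ℝ × E) : fderiv ℝ B q v = 0 := by
  have h1 := curryLeft_alternatizeUncurryFin_zero (fderiv ℝ B q) v
  have h2 : ContinuousAlternatingMap.alternatizeUncurryFin (fderiv ℝ B q) = 0 := h0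
  rw [← h1, h2]
  ext v
  simp

variable [FiniteDimensional ℝ E]

/-- The homotopy formula for a closed form on `ℝ × U`. -/
lemma extDeriv_intervalIntegral_slice {n : ℕ} {B : ℝ × E → (ℝ × E) [⋀^Fin (n + 1)]→L[ℝ] ℝ}
    {U : Set E} (hU : IsOpen U) (hB : ContDiffOn ℝ ∞ B (univ ×ˢ U))
    (h0 : ∀ t, ∀ y ∈ U, extDeriv B (t, y) = 0) {y : E} (hy : y ∈ U) :
    extDeriv (fun x => ∫ t in (0 : ℝ)..1, sliceCLM E n (contractCLM (1, 0) n (B (t, x)))) y =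
      sliceCLM E (n + 1) (B (1, y)) - sliceCLM E (n + 1) (B (0, y)) := by
  have hUo : IsOpen ((univ : Set ℝ) ×ˢ U) := isOpen_univ.prod hU
  have hBd : ∀ t, DifferentiableAt ℝ B (t, y) := fun t =>
    (hB.contDiffAt (hUo.mem_nhds ⟨mem_univ _, hy⟩)).differentiableAt (by simp)
  have hg : ContDiffOn ℝ ∞ (fun q => sliceCLM E n (contractCLM (1, 0) n (B q))) (univ ×ˢ U) :=
    (sliceCLM E n).contDiff.comp_contDiffOn
      ((contractCLM ((1, 0) : ℝ × E) n).contDiff.comp_contDiffOn hB)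
  have hline : ContinuousOn (fun t : ℝ => (t, y)) univ :=
    (continuous_id.prodMk continuous_const).continuousOn
  have hc' : Continuous fun t : ℝ => sliceCLM E (n + 1) (fderiv ℝ B (t, y) (1, 0)) :=
    (sliceCLM E (n + 1)).continuous.comp (continuousOn_univ.1
      (((hB.continuousOn_fderiv_of_isOpen hUo (by simp)).comp hline
      fun t _ => ⟨mem_univ _, hy⟩).clm_apply continuousOn_const))
  -- After d is taken under the integral, Cartan's formula identifies the integrand with the
  -- t-derivative of the slice of B, and the fundamental theorem of calculus applies.
  have h2 := clm_fderiv_intervalIntegral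
    (ContinuousAlternatingMap.alternatizeUncurryFinCLM ℝ E ℝ (n := n)) hU (hg.of_le (by simp)) hy
  refine h2.trans ?_
  rw [← intervalIntegral.integral_eq_sub_of_hasDerivAt (fun t _ => hasDerivAt_slice (hBd t))
    (hc'.intervalIntegrable 0 1)]
  refine intervalIntegral.integral_congr fun t _ => ?_
  exact (slice_fderiv_eq (hBd t) (h0 t y hy)).symm

end Homotopy

/-! ### Slices and charts of the cylinder ℝ × X -/

section Cylinder

universe u

variable {E : Type u} [NormedAddCommGroup E] [NormedSpace ℝ E]
  {H : Type*} [TopologicalSpace H] {I : ModelWithCorners ℝ E H}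
  {X : Type*} [TopologicalSpace X] [ChartedSpace H X]

lemma contMDiff_slice (t : ℝ) : ContMDiff I (𝓘(ℝ, ℝ).prod I) ∞ (fun x : X => (t, x)) :=
  contMDiff_const.prodMk contMDiff_id

lemma tangentMapAt_slice (t : ℝ) (x : X) :
    tangentMapAt I (𝓘(ℝ, ℝ).prod I) (fun x : X => (t, x)) x = ContinuousLinearMap.inr ℝ ℝ E := by
  have h := mfderiv_prodMk (I := I) (I' := 𝓘(ℝ, ℝ)) (I'' := I) (f := fun _ : X => t)
    (g := fun x : X => x) (x := x) mdifferentiableAt_const mdifferentiableAt_id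
  refine ContinuousLinearMap.ext fun v => (DFunLike.congr_fun h v).trans (Prod.ext ?_ ?_)
  · exact DFunLike.congr_fun (tangentMapAt_const (I := I) (I' := 𝓘(ℝ, ℝ)) (M := X) t x) v
  · exact DFunLike.congr_fun (tangentMapAt_id (I := I) x) v

/-- The chart of `X` around `c`, extended to the cylinder and inverted. -/
def cylinderChart (I : ModelWithCorners ℝ E H) (c : X) (q : ℝ × E) : ℝ × X :=
  (q.1, (extChartAt I c).symm q.2)

variable [I.Boundaryless] [IsManifold I ∞ X]

lemma contMDiffAt_cylinderChart (c : X) {q : ℝ × E} (hq : q.2 ∈ (extChartAt I c).target) :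
    ContMDiffAt 𝓘(ℝ, ℝ × E) (𝓘(ℝ, ℝ).prod I) ∞ (cylinderChart I c) q :=
  (contDiff_fst.contMDiff _).prodMk
    (ContMDiffAt.comp q (contMDiffAt_chart_symm hq) (contDiff_snd.contMDiff _))

lemma tangentMapAt_cylinderChart (c : X) {q : ℝ × E} (hq : q.2 ∈ (extChartAt I c).target)
    (v : ℝ × E) :
    tangentMapAt 𝓘(ℝ, ℝ × E) (𝓘(ℝ, ℝ).prod I) (cylinderChart I c) q v =
      (v.1, tangentMapAt 𝓘(ℝ, E) I (extChartAt I c).symm q.2 v.2) := by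
  have e2 : MDifferentiableAt 𝓘(ℝ, ℝ × E) 𝓘(ℝ, ℝ) (Prod.fst : ℝ × E → ℝ) q :=
    differentiableAt_fst.mdifferentiableAt
  have e3 : MDifferentiableAt 𝓘(ℝ, ℝ × E) 𝓘(ℝ, E) (Prod.snd : ℝ × E → E) q :=
    differentiableAt_snd.mdifferentiableAt
  have e4 := mdifferentiableAt_chart_symm (I := I) hq
  have h := mfderiv_prodMk (I := 𝓘(ℝ, ℝ × E)) (I' := 𝓘(ℝ, ℝ)) (I'' := I)
    (f := (Prod.fst : ℝ × E → ℝ)) (g := (extChartAt I c).symm ∘ Prod.snd) (x := q) e2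
    (MDifferentiableAt.comp q e4 e3)
  refine (DFunLike.congr_fun h v).trans ?_
  refine Prod.ext ?_ ?_
  · have := tangentMapAt_eq_fderiv (Prod.fst : ℝ × E → ℝ) q
    rw [fderiv_fst] at this
    exact DFunLike.congr_fun this v
  · have h3 := tangentMapAt_comp_apply (I := 𝓘(ℝ, ℝ × E)) (I' := 𝓘(ℝ, E)) (I'' := I)
      (g := (extChartAt I c).symm) (f := Prod.snd) (x := q) e4 e3 v
    rw [tangentMapAt_eq_fderiv, fderiv_snd] at h3
    exact h3

end Cylinder

end

end EquivariantForms

namespace EquivariantForms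

noncomputable section

/-! ### Fibre integration and exactness of the difference of slices -/

section FiberIntegral

universe u

variable {E : Type u} [NormedAddCommGroup E] [NormedSpace ℝ E] [FiniteDimensional ℝ E]
  {H : Type*} [TopologicalSpace H] {I : ModelWithCorners ℝ E H}
  {X : Type*} [TopologicalSpace X] [ChartedSpace H X] [I.Boundaryless] [IsManifold I ∞ X]

lemma inChart_pullback_slice {n : ℕ} (θ : DForm (ℝ × E) (ℝ × X) n) (t : ℝ) {c : X} {y : E}
    (hy : y ∈ (extChartAt I c).target) :
    inChart I (pullback I (𝓘(ℝ, ℝ).prod I) (fun x : X => (t, x)) θ) c y =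
      sliceCLM E n (pullback 𝓘(ℝ, ℝ × E) (𝓘(ℝ, ℝ).prod I) (cylinderChart I c) θ (t, y)) := by
  ext v
  refine congrArg (θ (t, (extChartAt I c).symm y)) (funext fun i => ?_)
  refine (DFunLike.congr_fun (tangentMapAt_slice (I := I) t ((extChartAt I c).symm y)) _).trans ?_
  exact (tangentMapAt_cylinderChart c (q := (t, y)) hy (0, v i)).symm

/-- Integration over the fibers of `[0,1] × X → X`. -/
def fiberIntegral {n : ℕ} (θ : DForm (ℝ × E) (ℝ × X) (n + 1)) : DForm E X n :=
  fun x => ∫ t in (0 : ℝ)..1, sliceCLM E n (contractCLM (1, 0) n (θ (t, x)))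

/-- The cylinder chart is the identity in the t direction, so contraction with ∂_t and restriction
to a slice commute with passing to coordinates. -/
lemma comp_slice_contract {n : ℕ} (θ : DForm (ℝ × E) (ℝ × X) (n + 1)) (t : ℝ) {c : X} {y : E}
    (hy : y ∈ (extChartAt I c).target) :
    (sliceCLM E n (contractCLM (1, 0) n (θ (t, (extChartAt I c).symm y)))).compContinuousLinearMap
        (tangentMapAt 𝓘(ℝ, E) I (extChartAt I c).symm y) =
      sliceCLM E n (contractCLM (1, 0) n
        (pullback 𝓘(ℝ, ℝ × E) (𝓘(ℝ, ℝ).prod I) (cylinderChart I c) θ (t, y))) := by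
  ext v
  refine congrArg (θ (t, (extChartAt I c).symm y)) (funext fun i => ?_)
  refine Fin.cases ?_ (fun j => ?_) i
  · refine Eq.symm ((tangentMapAt_cylinderChart c (q := (t, y)) hy (1, 0)).trans ?_)
    exact Prod.ext rfl (map_zero _)
  · exact (tangentMapAt_cylinderChart c (q := (t, y)) hy (0, v j)).symm

variable {n : ℕ} {θ : DForm (ℝ × E) (ℝ × X) n}

lemma contDiffOn_pullback_cylinderChart (hθ : IsSmoothForm (𝓘(ℝ, ℝ).prod I) θ) (c : X) :
    ContDiffOn ℝ ∞ (pullback 𝓘(ℝ, ℝ × E) (𝓘(ℝ, ℝ).prod I) (cylinderChart I c) θ)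
      (univ ×ˢ (extChartAt I c).target) := fun _ hq =>
  (hθ.contDiffAt_pullback (contMDiffAt_cylinderChart c hq.2)).contDiffWithinAt

lemma extDeriv_pullback_cylinderChart (hθ : IsSmoothForm (𝓘(ℝ, ℝ).prod I) θ)
    (h0 : extd (𝓘(ℝ, ℝ).prod I) θ = 0) (c : X) (t : ℝ) (y : E) (hy : y ∈ (extChartAt I c).target) :
    extDeriv (pullback 𝓘(ℝ, ℝ × E) (𝓘(ℝ, ℝ).prod I) (cylinderChart I c) θ) (t, y) = 0 := by
  rw [extDeriv_pullback_plot hθ (contMDiffAt_cylinderChart c hy), h0]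
  rfl

lemma contDiffOn_slice_contract {θ : DForm (ℝ × E) (ℝ × X) (n + 1)}
    (hθ : IsSmoothForm (𝓘(ℝ, ℝ).prod I) θ) (c : X) :
    ContDiffOn ℝ ∞ (fun q => sliceCLM E n (contractCLM (1, 0) n
      (pullback 𝓘(ℝ, ℝ × E) (𝓘(ℝ, ℝ).prod I) (cylinderChart I c) θ q)))
      (univ ×ˢ (extChartAt I c).target) :=
  (sliceCLM E n).contDiff.comp_contDiffOn ((contractCLM ((1, 0) : ℝ × E) n).contDiff.comp_contDiffOn
    (contDiffOn_pullback_cylinderChart hθ c))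

lemma continuous_slice_contract {θ : DForm (ℝ × E) (ℝ × X) (n + 1)}
    (hθ : IsSmoothForm (𝓘(ℝ, ℝ).prod I) θ) (x : X) :
    Continuous fun t : ℝ => sliceCLM E n (contractCLM (1, 0) n (θ (t, x))) := by
  have hx := mem_extChartAt_target (I := I) x
  have h1 : ContinuousOn (fun t : ℝ => (t, extChartAt I x x)) univ :=
    (continuous_id.prodMk continuous_const).continuousOn
  have h2 := continuousOn_univ.1 ((contDiffOn_slice_contract hθ x).continuousOn.comp h1
    fun t _ => ⟨mem_univ _, hx⟩)
  refine h2.congr fun t => ?_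
  refine (comp_slice_contract θ t hx).symm.trans ?_
  rw [tangentMapAt_chart_symm_self, extChartAt_to_inv]
  rfl

lemma inChart_fiberIntegral {θ : DForm (ℝ × E) (ℝ × X) (n + 1)}
    (hθ : IsSmoothForm (𝓘(ℝ, ℝ).prod I) θ) {c : X} {y : E} (hy : y ∈ (extChartAt I c).target) :
    inChart I (fiberIntegral θ) c y = ∫ t in (0 : ℝ)..1, sliceCLM E n (contractCLM (1, 0) n
      (pullback 𝓘(ℝ, ℝ × E) (𝓘(ℝ, ℝ).prod I) (cylinderChart I c) θ (t, y))) := by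
  have h := (ContinuousAlternatingMap.compContinuousLinearMapCLM (ι := Fin n) (F := ℝ)
    (tangentMapAt 𝓘(ℝ, E) I (extChartAt I c).symm y)).intervalIntegral_comp_comm
    ((continuous_slice_contract hθ ((extChartAt I c).symm y)).intervalIntegrable 0 1
      (μ := MeasureTheory.volume))
  refine h.symm.trans ?_
  exact intervalIntegral.integral_congr fun t _ => comp_slice_contract θ t hy

lemma isSmoothForm_fiberIntegral {θ : DForm (ℝ × E) (ℝ × X) (n + 1)}
    (hθ : IsSmoothForm (𝓘(ℝ, ℝ).prod I) θ) : IsSmoothForm I (fiberIntegral θ) := fun c =>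
  (contDiffOn_intervalIntegral (isOpen_extChartAt_target c)
    (contDiffOn_slice_contract hθ c)).congr fun _ hy => inChart_fiberIntegral hθ hy

/-- The homotopy formula for closed forms on the cylinder. -/
lemma extd_fiberIntegral {θ : DForm (ℝ × E) (ℝ × X) (n + 1)}
    (hθ : IsSmoothForm (𝓘(ℝ, ℝ).prod I) θ) (h0 : extd (𝓘(ℝ, ℝ).prod I) θ = 0) :
    extd I (fiberIntegral θ) = pullback I (𝓘(ℝ, ℝ).prod I) (fun x : X => ((1 : ℝ), x)) θ -
      pullback I (𝓘(ℝ, ℝ).prod I) (fun x : X => ((0 : ℝ), x)) θ := by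
  ext1 x
  have hx := mem_extChartAt_target (I := I) x
  refine eq_of_inChart_eq (I := I)
    (θ' := pullback I (𝓘(ℝ, ℝ).prod I) (fun x : X => ((1 : ℝ), x)) θ -
      pullback I (𝓘(ℝ, ℝ).prod I) (fun x : X => ((0 : ℝ), x)) θ) ?_
  rw [inChart_extd (isSmoothForm_fiberIntegral hθ) hx]
  have h1 : inChart I (fiberIntegral θ) x =ᶠ[𝓝 (extChartAt I x x)] fun y =>
      ∫ t in (0 : ℝ)..1, sliceCLM E n (contractCLM (1, 0) n
      (pullback 𝓘(ℝ, ℝ × E) (𝓘(ℝ, ℝ).prod I) (cylinderChart I x) θ (t, y))) := by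
    filter_upwards [extChartAt_target_mem_nhds' hx] with y hy
    exact inChart_fiberIntegral hθ hy
  rw [h1.extDeriv_eq]
  rw [extDeriv_intervalIntegral_slice (isOpen_extChartAt_target x)
    (contDiffOn_pullback_cylinderChart hθ x) (extDeriv_pullback_cylinderChart hθ h0 x) hx,
    ← inChart_pullback_slice θ 1 hx, ← inChart_pullback_slice θ 0 hx]
  rfl

lemma isExactForm_slice_sub_slice : ∀ {n : ℕ} {θ : DForm (ℝ × E) (ℝ × X) n},
    IsSmoothForm (𝓘(ℝ, ℝ).prod I) θ → extd (𝓘(ℝ, ℝ).prod I) θ = 0 →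
    IsExactForm I (pullback I (𝓘(ℝ, ℝ).prod I) (fun x : X => ((1 : ℝ), x)) θ -
      pullback I (𝓘(ℝ, ℝ).prod I) (fun x : X => ((0 : ℝ), x)) θ)
  | n + 1, θ, hθ, h0 => ⟨fiberIntegral θ, isSmoothForm_fiberIntegral hθ,
      (extd_fiberIntegral hθ h0).symm⟩
  -- In degree 0 there is no primitive: a function with zero differential is constant in t, so the
  -- two slices agree.
  | 0, θ, hθ, h0 => by
    change _ = _
    ext1 x
    have hx := mem_extChartAt_target (I := I) x
    refine sub_eq_zero.2 (eq_of_inChart_eq (I := I) ?_)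
    rw [inChart_pullback_slice θ 1 hx, inChart_pullback_slice θ 0 hx]
    have hU : IsOpen ((univ : Set ℝ) ×ˢ (extChartAt I x).target) :=
      isOpen_univ.prod (isOpen_extChartAt_target x)
    have h1 : ∀ t : ℝ, HasDerivAt (fun s => sliceCLM E 0 (pullback 𝓘(ℝ, ℝ × E) (𝓘(ℝ, ℝ).prod I)
        (cylinderChart I x) θ (s, extChartAt I x x))) 0 t := fun t => by
      have h2 := hasDerivAt_slice (((contDiffOn_pullback_cylinderChart hθ x).contDiffAt
        (hU.mem_nhds (mk_mem_prod (mem_univ t) hx))).differentiableAt (by simp))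
      rwa [fderiv_eq_zero_of_extDeriv (extDeriv_pullback_cylinderChart hθ h0 x t _ hx),
        map_zero] at h2
    exact is_const_of_deriv_eq_zero (fun t => (h1 t).differentiableAt) (fun t => (h1 t).deriv) 1 0

end FiberIntegral

end

end EquivariantForms

namespace EquivariantForms

noncomputable section

/-! ### Products of smooth functions and forms -/

section FunctionMultiple

variable {E : Type*} [NormedAddCommGroup E] [NormedSpace ℝ E]
  {H : Type*} [TopologicalSpace H] {I : ModelWithCorners ℝ E H} [I.Boundaryless]
  {M : Type*} [TopologicalSpace M] [ChartedSpace H M] [IsManifold I ∞ M]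

lemma IsSmoothForm.fun_smul {n : ℕ} {θ : DForm E M n} (hθ : IsSmoothForm I θ) {f : M → ℝ}
    (hf : ContMDiff I 𝓘(ℝ, ℝ) ∞ f) : IsSmoothForm I (fun x => f x • θ x) :=
  isSmoothForm_of_contDiffAt fun c y hy => by
    have h1 : ContDiffAt ℝ ∞ (fun z => f ((extChartAt I c).symm z)) y :=
      (ContMDiffAt.comp y (hf _) (contMDiffAt_chart_symm hy)).contDiffAt
    exact h1.smul (hθ.contDiffAt_inChart hy)

end FunctionMultiple

/-! ### Naturality of α(u,A) and the zero form -/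

section Naturality

variable {EG : Type*} [NormedAddCommGroup EG] [NormedSpace ℝ EG] [FiniteDimensional ℝ EG]
  {HG : Type*} [TopologicalSpace HG] {IG : ModelWithCorners ℝ EG HG} [IG.Boundaryless]
  {G : Type*} [TopologicalSpace G] [ChartedSpace HG G] [Group G] [LieGroup IG ∞ G]
  {EP : Type*} [NormedAddCommGroup EP] [NormedSpace ℝ EP] [FiniteDimensional ℝ EP]
  {HP : Type*} [TopologicalSpace HP] {IP : ModelWithCorners ℝ EP HP} [IP.Boundaryless]
  {P : Type*} [TopologicalSpace P] [ChartedSpace HP P] [IsManifold IP ∞ P] [MulAction Gᵐᵒᵖ P]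
  {EQ : Type*} [NormedAddCommGroup EQ] [NormedSpace ℝ EQ] [FiniteDimensional ℝ EQ]
  {HQ : Type*} [TopologicalSpace HQ] {IQ : ModelWithCorners ℝ EQ HQ} [IQ.Boundaryless]
  {Q : Type*} [TopologicalSpace Q] [ChartedSpace HQ Q] [IsManifold IQ ∞ Q] [MulAction Gᵐᵒᵖ Q]
  {EM : Type*} [NormedAddCommGroup EM] [NormedSpace ℝ EM]
  {HM : Type*} [TopologicalSpace HM] {IM : ModelWithCorners ℝ EM HM} [IM.Boundaryless]
  {M : Type*} [TopologicalSpace M] [ChartedSpace HM M] [IsManifold IM ∞ M]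
  [MulAction G M] [ContMDiffSMul IG IM ∞ G M]
  {m : ℕ} {b : Module.Basis (Fin m) ℝ (GroupLieAlgebra IG G)}

lemma pullback_curvature_eq {A : Connection IG IP G P} {B : Connection IG IQ G Q} {j : P → Q}
    (hj : ContMDiff IP IQ ∞ j)
    (hA : ∀ p v, B.form (j p) (tangentMapAt IP IQ j p v) = A.form p v) (k : Fin m) :
    pullback IP IQ j (B.curvature b k) = A.curvature b k := by
  ext p v
  have h1 : pullback IP IQ j (component IG B.form (b.coord k)) = component IG A.form (b.coord k) := by
    ext q w
    exact congrArg (b.coord k) (hA q (w 0))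
  have h2 := extd_pullback (B.smooth (b.coord k)) hj
  rw [h1] at h2
  have h5 : pullback IP IQ j (B.curvature b k) p v =
      B.curvature b k (j p) (fun i => tangentMapAt IP IQ j p (v i)) := rfl
  rw [h5, curvature_apply, hA, hA, curvature_apply, h2]
  rfl

lemma covDeriv_comp {A : Connection IG IP G P} {B : Connection IG IQ G Q} {j : P → Q}
    (hj : ContMDiff IP IQ ∞ j)
    (hA : ∀ p v, B.form (j p) (tangentMapAt IP IQ j p v) = A.form p v) {u : Q → M}
    (hu : ContMDiff IQ IM ∞ u) (p : P) :
    (B.covDeriv IM u (j p)).comp (tangentMapAt IP IQ j p) = A.covDeriv IM (u ∘ j) p := by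
  ext v
  have h1 := tangentMapAt_comp_apply (I := IP) (I' := IQ) (I'' := IM) (g := u) (f := j) (x := p)
    ((hu _).mdifferentiableAt (by simp)) ((hj p).mdifferentiableAt (by simp)) v
  exact (congrArg₂ (· + ·) h1 (congrArg (infAct IG IM G (u (j p))) (hA p v).symm)).symm

/-- Naturality of `α(u,A)` under maps that preserve the connection. -/
lemma pullback_subst_eq {A : Connection IG IP G P} {B : Connection IG IQ G Q} {j : P → Q}
    (hj : ContMDiff IP IQ ∞ j)
    (hA : ∀ p v, B.form (j p) (tangentMapAt IP IQ j p v) = A.form p v) {u : Q → M}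
    (hu : ContMDiff IQ IM ∞ u) {ℓ : ℕ} (α : EquivForm IG IM b M ℓ) :
    pullback IP IQ j (α.subst u B) = α.subst (u ∘ j) A := by
  ext1 p
  have h3 : pullback IP IQ j (α.subst u B) p =
      pull (tangentMapAt IP IQ j p)
        (∑ J ∈ multiIndices m ℓ, monomialWedge (fun k => B.curvature b k (j p)) J
        (pull (B.covDeriv IM u (j p)) fun n => α.coeff J n (u (j p)))) ℓ := rfl
  rw [h3, map_sum, subst_apply]
  refine congrFun (Finset.sum_congr rfl fun J _ => ?_) ℓ
  rw [pull_monomialWedge]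
  have h4 : (fun k => (B.curvature b k (j p)).compContinuousLinearMap (tangentMapAt IP IQ j p)) =
      fun k => A.curvature b k p := funext fun k => congrFun (pullback_curvature_eq hj hA k) p
  rw [h4]
  refine congrArg (monomialWedge _ J) ?_
  rw [← covDeriv_comp hj hA hu p]
  rfl

/-- The zero equivariant form. -/
def EquivForm.zero (IG : ModelWithCorners ℝ EG HG) (IM : ModelWithCorners ℝ EM HM)
    [IM.Boundaryless] (b : Module.Basis (Fin m) ℝ (GroupLieAlgebra IG G)) (M : Type*)
    [TopologicalSpace M] [ChartedSpace HM M] [IsManifold IM ∞ M] [MulAction G M] (ℓ : ℕ) :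
    EquivForm IG IM b M ℓ where
  coeff _ _ := 0
  smooth _ _ := isSmoothForm_zero
  degree _ _ _ := rfl
  equivariant g ξ n := by
    simp only [polyEval, smul_zero, Finset.sum_const_zero]
    rfl

lemma EquivForm.eval_zero (ξ : GroupLieAlgebra IG G) (ℓ : ℕ) :
    (EquivForm.zero IG IM b M ℓ).eval ξ = 0 := by
  ext1 n
  simp [EquivForm.eval, EquivForm.zero, polyEval]

lemma monomialWedge_zero {V : Type*} [NormedAddCommGroup V] [NormedSpace ℝ V]
    (θ : Fin m → V [⋀^Fin 2]→L[ℝ] ℝ) (J : Fin m → ℕ) :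
    monomialWedge θ J (0 : ∀ n : ℕ, V [⋀^Fin n]→L[ℝ] ℝ) = 0 := by
  rw [monomialWedge_eq, map_zero]

lemma EquivForm.subst_zero (u : P → M) (A : Connection IG IP G P) (ℓ : ℕ) :
    (EquivForm.zero IG IM b M ℓ).subst u A = 0 := by
  ext1 p
  refine congrFun (Finset.sum_eq_zero fun J _ => ?_ : (_ : ∀ n, EP [⋀^Fin n]→L[ℝ] ℝ) = 0) ℓ
  exact monomialWedge_zero _ J

end Naturality

end

end EquivariantForms

namespace EquivariantForms

noncomputable section

/-! ### Linearity of α(u,A) in α -/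

section Difference

variable {EG : Type*} [NormedAddCommGroup EG] [NormedSpace ℝ EG]
  {HG : Type*} [TopologicalSpace HG] {IG : ModelWithCorners ℝ EG HG}
  {G : Type*} [TopologicalSpace G] [ChartedSpace HG G] [Group G]
  {EP : Type*} [NormedAddCommGroup EP] [NormedSpace ℝ EP] [FiniteDimensional ℝ EP]
  {HP : Type*} [TopologicalSpace HP] {IP : ModelWithCorners ℝ EP HP}
  {P : Type*} [TopologicalSpace P] [ChartedSpace HP P] [MulAction Gᵐᵒᵖ P]
  {EM : Type*} [NormedAddCommGroup EM] [NormedSpace ℝ EM]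
  {HM : Type*} [TopologicalSpace HM] {IM : ModelWithCorners ℝ EM HM}
  {M : Type*} [TopologicalSpace M] [ChartedSpace HM M] [MulAction G M]
  {m : ℕ} {b : Module.Basis (Fin m) ℝ (GroupLieAlgebra IG G)} {ℓ : ℕ}

lemma polyEval_sub (α β : (Fin m → ℕ) → ∀ n : ℕ, DForm EM M n) (ξ : GroupLieAlgebra IG G) :
    polyEval IG b ℓ (fun J n => α J n - β J n) ξ = polyEval IG b ℓ α ξ - polyEval IG b ℓ β ξ := by
  ext1 n
  simp only [polyEval, Pi.sub_apply, smul_sub, Finset.sum_sub_distrib]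

variable [IM.Boundaryless] [IsManifold IM ∞ M]

/-- The difference of two equivariant forms. -/
def EquivForm.sub (α β : EquivForm IG IM b M ℓ) : EquivForm IG IM b M ℓ where
  coeff J n := α.coeff J n - β.coeff J n
  smooth J n := (α.smooth J n).sub (β.smooth J n)
  degree J n h := by rw [α.degree J n h, β.degree J n h, sub_zero]
  equivariant g ξ n := by
    rw [polyEval_sub, polyEval_sub, Pi.sub_apply, pullback_sub, α.equivariant, β.equivariant,
      Pi.sub_apply]

lemma EquivForm.eval_sub (α β : EquivForm IG IM b M ℓ) (ξ : GroupLieAlgebra IG G) :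
    (α.sub β).eval ξ = α.eval ξ - β.eval ξ :=
  polyEval_sub α.coeff β.coeff ξ

variable [FiniteDimensional ℝ EG] [IG.Boundaryless] [LieGroup IG ∞ G] [IP.Boundaryless]
  [IsManifold IP ∞ P] [ContMDiffSMul IG IM ∞ G M]

lemma EquivForm.subst_sub (α β : EquivForm IG IM b M ℓ) (u : P → M) (A : Connection IG IP G P) :
    (α.sub β).subst u A = α.subst u A - β.subst u A := by
  ext1 p
  rw [Pi.sub_apply, subst_apply, subst_apply, subst_apply]
  refine congrFun (?_ : (_ : ∀ n : ℕ, EP [⋀^Fin n]→L[ℝ] ℝ) = _ - _) ℓ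
  rw [← Finset.sum_sub_distrib]
  refine Finset.sum_congr rfl fun J _ => ?_
  rw [monomialWedge_eq, monomialWedge_eq, monomialWedge_eq, ← map_sub, ← map_sub]
  rfl

/-- `α(u,A)` depends only on the values of the polynomial `α`. -/
lemma EquivForm.subst_congr {α β : EquivForm IG IM b M ℓ} (h : ∀ ξ, α.eval ξ = β.eval ξ)
    (u : P → M) (A : Connection IG IP G P) : α.subst u A = β.subst u A := by
  ext1 p
  obtain ⟨φ, hφ⟩ := exists_algHom_wedgeOp (fun k => A.curvature b k p)
  have h1 : ∀ ξ : Fin m → ℝ,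
      ∑ J ∈ multiIndices m ℓ, MvPolynomial.eval ξ (∏ i, MvPolynomial.X i ^ J i) •
        (fun n => α.coeff J n (u p)) =
      ∑ J ∈ multiIndices m ℓ, MvPolynomial.eval ξ (∏ i, MvPolynomial.X i ^ J i) •
        (fun n => β.coeff J n (u p)) := by
    intro ξ
    ext1 n
    have h2 : polyEval IG b ℓ α.coeff (b.equivFun.symm ξ) n (u p) =
        polyEval IG b ℓ β.coeff (b.equivFun.symm ξ) n (u p) :=
      congrFun (congrFun (h (b.equivFun.symm ξ)) n) (u p)
    rw [polyEval_apply, polyEval_apply] at h2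
    have h3 : ∀ i, b.repr (b.equivFun.symm ξ) i = ξ i := fun i => by
      rw [← b.equivFun_apply, LinearEquiv.apply_symm_apply]
    simp only [h3] at h2
    rw [Finset.sum_apply, Finset.sum_apply]
    simp only [map_prod, map_pow, MvPolynomial.eval_X, Pi.smul_apply]
    exact h2
  have h2 := sum_apply_eq_sum_apply_of_eval _ _ _ _ _ _ h1 φ.toLinearMap
    (pull (A.covDeriv IM u p))
  rw [subst_apply, subst_apply]
  refine congrFun (?_ : (_ : ∀ n : ℕ, EP [⋀^Fin n]→L[ℝ] ℝ) = _) ℓ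
  simp only [monomialWedge_eq_algHom _ MvPolynomial.X φ hφ]
  exact h2

end Difference

/-! ### The cylinder bundle and the interpolating connection -/

section CylinderBundle

/-- The action on the cylinder `ℝ × P` that is trivial on the first factor. -/
@[reducible]
def cylinderAction (K P : Type*) [Monoid K] [MulAction K P] : MulAction K (ℝ × P) where
  smul k q := (q.1, k • q.2)
  one_smul q := Prod.ext rfl (one_smul K q.2)
  mul_smul k k' q := Prod.ext rfl (mul_smul k k' q.2)

attribute [local instance] cylinderAction

variable {EG : Type*} [NormedAddCommGroup EG] [NormedSpace ℝ EG] [FiniteDimensional ℝ EG]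
  {HG : Type*} [TopologicalSpace HG] {IG : ModelWithCorners ℝ EG HG} [IG.Boundaryless]
  {G : Type*} [TopologicalSpace G] [ChartedSpace HG G] [Group G] [LieGroup IG ∞ G]
  {EP : Type*} [NormedAddCommGroup EP] [NormedSpace ℝ EP]
  {HP : Type*} [TopologicalSpace HP] {IP : ModelWithCorners ℝ EP HP}
  {P : Type*} [TopologicalSpace P] [ChartedSpace HP P] [MulAction Gᵐᵒᵖ P]
  {EX : Type*} [NormedAddCommGroup EX] [NormedSpace ℝ EX]
  {HX : Type*} [TopologicalSpace HX] {IX : ModelWithCorners ℝ EX HX}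
  {X : Type*} [TopologicalSpace X] [ChartedSpace HX X] {π : P → X}

/-- Trivializations of P, multiplied by the identity of ℝ and reassociated, trivialize the cylinder.
-/
lemma IsPrincipalBundle.cylinder (hπ : IsPrincipalBundle IG IP IX G π) :
    IsPrincipalBundle IG (𝓘(ℝ, ℝ).prod IP) (𝓘(ℝ, ℝ).prod IX) G
      (Prod.map id π : ℝ × P → ℝ × X) where
  smooth_proj := contMDiff_id.prodMap hπ.smooth_proj
  smooth_act := by
    refine ContMDiff.prodMk (contMDiff_fst.comp contMDiff_fst) ?_
    exact hπ.smooth_act.comp ((contMDiff_snd.comp contMDiff_fst).prodMk contMDiff_snd)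
  proj_act q g := Prod.ext rfl (hπ.proj_act q.2 g)
  locally_trivial := by
    rintro ⟨t, x⟩
    obtain ⟨U, hU, hx, e, hs, ht, h1, h2, h3⟩ := hπ.locally_trivial x
    refine ⟨univ ×ˢ U, isOpen_univ.prod hU, ⟨mem_univ _, hx⟩,
      ((OpenPartialHomeomorph.refl ℝ).prod e).transHomeomorph (Homeomorph.prodAssoc ℝ X G).symm,
      ?_, ?_, ?_, ?_, ?_⟩
    · ext q
      simp [hs]
    · ext q
      simp [ht]
      rfl
    · have h4 : ContMDiffOn (𝓘(ℝ, ℝ).prod IP) (IX.prod IG) ∞ (fun q : ℝ × P => e q.2)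
          (univ ×ˢ e.source) := h1.comp contMDiffOn_snd fun q hq => hq.2
      refine ContMDiffOn.mono (s := univ ×ˢ e.source) ?_ (fun q hq => ⟨mem_univ _, by simpa using hq⟩)
      exact (contMDiffOn_fst.prodMk (contMDiff_fst.comp_contMDiffOn h4)).prodMk
        (contMDiff_snd.comp_contMDiffOn h4)
    · refine ContMDiffOn.mono (s := {q : (ℝ × X) × G | (q.1.2, q.2) ∈ e.target}) ?_
        (fun q hq => by
          simp only [OpenPartialHomeomorph.transHomeomorph_target] at hq
          exact hq.2)
      refine ContMDiffOn.prodMk (contMDiff_fst.comp contMDiff_fst).contMDiffOn ?_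
      exact h2.comp ((contMDiff_snd.comp contMDiff_fst).prodMk contMDiff_snd).contMDiffOn
        fun q hq => hq
    · intro q hq
      have hq' : q.2 ∈ e.source := by simpa using hq
      refine ⟨Prod.ext rfl (h3 _ hq').1, fun g => ?_⟩
      have h4 := (h3 _ hq').2 g
      have h5 := congrArg Prod.fst h4
      have h6 := congrArg Prod.snd h4
      exact Prod.ext (Prod.ext rfl h5) h6

lemma mdifferentiableAt_snd_cylinder (q : ℝ × P) :
    MDifferentiableAt (𝓘(ℝ, ℝ).prod IP) IP (Prod.snd : ℝ × P → P) q :=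
  (contMDiff_snd (n := ∞) q).mdifferentiableAt (by simp)

lemma IsPrincipalBundle.tangentMapAt_snd_translation (hπ : IsPrincipalBundle IG IP IX G π)
    (g : G) (q : ℝ × P) (v : ℝ × EP) :
    tangentMapAt (𝓘(ℝ, ℝ).prod IP) IP Prod.snd (op g • q)
      (tangentMapAt (𝓘(ℝ, ℝ).prod IP) (𝓘(ℝ, ℝ).prod IP) (fun r : ℝ × P => op g • r) q v) =
    tangentMapAt IP IP (fun p : P => op g • p) q.2
      (tangentMapAt (𝓘(ℝ, ℝ).prod IP) IP Prod.snd q v) := by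
  have h1 := tangentMapAt_comp_apply (I := 𝓘(ℝ, ℝ).prod IP) (I' := 𝓘(ℝ, ℝ).prod IP) (I'' := IP)
    (x := q) (mdifferentiableAt_snd_cylinder (IP := IP) (op g • q))
    ((hπ.cylinder.contMDiff_translation g q).mdifferentiableAt (by simp)) v
  have h2 := tangentMapAt_comp_apply (I := 𝓘(ℝ, ℝ).prod IP) (I' := IP) (I'' := IP)
    (x := q) ((hπ.contMDiff_translation g q.2).mdifferentiableAt (by simp))
    (mdifferentiableAt_snd_cylinder (IP := IP) q) v
  exact h1.symm.trans h2

lemma IsPrincipalBundle.tangentMapAt_snd_vert (hπ : IsPrincipalBundle IG IP IX G π)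
    (q : ℝ × P) (ξ : GroupLieAlgebra IG G) :
    tangentMapAt (𝓘(ℝ, ℝ).prod IP) IP Prod.snd q (vert IG (𝓘(ℝ, ℝ).prod IP) G q ξ) =
      vert IG IP G q.2 ξ := by
  have h1 := tangentMapAt_comp_apply (I := IG) (I' := 𝓘(ℝ, ℝ).prod IP) (I'' := IP)
    (x := (1 : G)) (mdifferentiableAt_snd_cylinder (IP := IP) (op (1 : G) • q))
    ((hπ.cylinder.contMDiff_orbit q 1).mdifferentiableAt (by simp)) ξ
  have h2 : tangentMapAt (𝓘(ℝ, ℝ).prod IP) IP Prod.snd (op (1 : G) • q) =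
      tangentMapAt (𝓘(ℝ, ℝ).prod IP) IP Prod.snd q := by rw [op_one, one_smul]
  rw [h2] at h1
  exact h1.symm

lemma tangentMapAt_snd_slice (t : ℝ) (p : P) (v : EP) :
    tangentMapAt (𝓘(ℝ, ℝ).prod IP) IP Prod.snd (t, p)
      (tangentMapAt IP (𝓘(ℝ, ℝ).prod IP) (fun p : P => (t, p)) p v) = v := by
  have h1 := tangentMapAt_comp_apply (I := IP) (I' := 𝓘(ℝ, ℝ).prod IP) (I'' := IP)
    (x := p) (mdifferentiableAt_snd_cylinder (IP := IP) (t, p))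
    ((contMDiff_slice (I := IP) t p).mdifferentiableAt (by simp)) v
  exact h1.symm.trans (DFunLike.congr_fun (tangentMapAt_id (I := IP) p) v)

variable [FiniteDimensional ℝ EP] [IP.Boundaryless] [IsManifold IP ∞ P]

/-- The connection `(1 - t) A₀ + t A₁` on the cylinder. -/
def IsPrincipalBundle.cylinderConnection (hπ : IsPrincipalBundle IG IP IX G π)
    (A₀ A₁ : Connection IG IP G P) : Connection IG (𝓘(ℝ, ℝ).prod IP) G (ℝ × P) where
  form q := ((1 - q.1) • A₀.form q.2 + q.1 • A₁.form q.2).comp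
    (tangentMapAt (𝓘(ℝ, ℝ).prod IP) IP Prod.snd q)
  smooth l := by
    have h0 : ContMDiff (𝓘(ℝ, ℝ).prod IP) 𝓘(ℝ, ℝ) ∞ (fun q : ℝ × P => 1 - q.1) :=
      contMDiff_const.sub contMDiff_fst
    have h1 := (((A₀.smooth l).pullback (I := 𝓘(ℝ, ℝ).prod IP) (f := (Prod.snd : ℝ × P → P))
      contMDiff_snd).fun_smul h0).add
      (((A₁.smooth l).pullback (I := 𝓘(ℝ, ℝ).prod IP) (f := (Prod.snd : ℝ × P → P))
      contMDiff_snd).fun_smul (contMDiff_fst (n := ∞)))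
    convert h1 using 1
    ext q v
    exact (map_add l _ _).trans (congrArg₂ (· + ·) (map_smul l _ _) (map_smul l _ _))
  equivariant g q v := by
    have h1 := hπ.tangentMapAt_snd_translation g q v
    have h2 := A₀.equivariant g q.2 (tangentMapAt (𝓘(ℝ, ℝ).prod IP) IP Prod.snd q v)
    have h3 := A₁.equivariant g q.2 (tangentMapAt (𝓘(ℝ, ℝ).prod IP) IP Prod.snd q v)
    rw [← h1] at h2 h3
    refine (congrArg₂ (fun x y : GroupLieAlgebra IG G => (1 - q.1) • x + q.1 • y) h2 h3).trans ?_
    exact ((map_add (Ad IG g⁻¹) _ _).trans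
      (congrArg₂ (· + ·) (map_smul (Ad IG g⁻¹) _ _) (map_smul (Ad IG g⁻¹) _ _))).symm
  vertical q ξ := by
    have h1 := hπ.tangentMapAt_snd_vert q ξ
    have h2 := A₀.vertical q.2 ξ
    have h3 := A₁.vertical q.2 ξ
    rw [← h1] at h2 h3
    refine (congrArg₂ (fun x y : GroupLieAlgebra IG G => (1 - q.1) • x + q.1 • y) h2 h3).trans ?_
    module

lemma IsPrincipalBundle.cylinderConnection_zero (hπ : IsPrincipalBundle IG IP IX G π)
    (A₀ A₁ : Connection IG IP G P) (p : P) (v : EP) :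
    (hπ.cylinderConnection A₀ A₁).form (0, p)
      (tangentMapAt IP (𝓘(ℝ, ℝ).prod IP) (fun p : P => ((0 : ℝ), p)) p v) = A₀.form p v := by
  have h1 := tangentMapAt_snd_slice (IP := IP) 0 p v
  refine (congrArg ((((1 : ℝ) - 0) • A₀.form p + (0 : ℝ) • A₁.form p :
    EP →L[ℝ] GroupLieAlgebra IG G)) h1).trans ?_
  simp

lemma IsPrincipalBundle.cylinderConnection_one (hπ : IsPrincipalBundle IG IP IX G π)
    (A₀ A₁ : Connection IG IP G P) (p : P) (v : EP) :
    (hπ.cylinderConnection A₀ A₁).form (1, p)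
      (tangentMapAt IP (𝓘(ℝ, ℝ).prod IP) (fun p : P => ((1 : ℝ), p)) p v) = A₁.form p v := by
  have h1 := tangentMapAt_snd_slice (IP := IP) 1 p v
  refine (congrArg ((((1 : ℝ) - 1) • A₀.form p + (1 : ℝ) • A₁.form p :
    EP →L[ℝ] GroupLieAlgebra IG G)) h1).trans ?_
  simp

end CylinderBundle

end

end EquivariantForms

namespace EquivariantForms

noncomputable section

/-! ### Dependence on the connection and on the homotopy class -/

section HomotopyInvariance

attribute [local instance] cylinderAction

variable {EG : Type*} [NormedAddCommGroup EG] [NormedSpace ℝ EG] [FiniteDimensional ℝ EG]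
  {HG : Type*} [TopologicalSpace HG] {IG : ModelWithCorners ℝ EG HG} [IG.Boundaryless]
  {G : Type*} [TopologicalSpace G] [ChartedSpace HG G] [Group G] [LieGroup IG ∞ G]
  {EP : Type*} [NormedAddCommGroup EP] [NormedSpace ℝ EP] [FiniteDimensional ℝ EP]
  {HP : Type*} [TopologicalSpace HP] {IP : ModelWithCorners ℝ EP HP} [IP.Boundaryless]
  {P : Type*} [TopologicalSpace P] [ChartedSpace HP P] [IsManifold IP ∞ P] [MulAction Gᵐᵒᵖ P]
  {EX : Type*} [NormedAddCommGroup EX] [NormedSpace ℝ EX] [FiniteDimensional ℝ EX]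
  {HX : Type*} [TopologicalSpace HX] {IX : ModelWithCorners ℝ EX HX} [IX.Boundaryless]
  {X : Type*} [TopologicalSpace X] [ChartedSpace HX X] [IsManifold IX ∞ X] {π : P → X}
  {EM : Type*} [NormedAddCommGroup EM] [NormedSpace ℝ EM]
  {HM : Type*} [TopologicalSpace HM] {IM : ModelWithCorners ℝ EM HM} [IM.Boundaryless]
  {M : Type*} [TopologicalSpace M] [ChartedSpace HM M] [IsManifold IM ∞ M]
  [MulAction G M] [ContMDiffSMul IG IM ∞ G M]
  {m : ℕ} {b : Module.Basis (Fin m) ℝ (GroupLieAlgebra IG G)}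

lemma IsPrincipalBundle.exists_descendsTo_subst (hπ : IsPrincipalBundle IG IP IX G π) {ℓ : ℕ}
    (α : EquivForm IG IM b M ℓ) (A : Connection IG IP G P) {u : P → M}
    (hu : IsEquivariantMap IM IP G u) : ∃ a : DForm EX X ℓ, DescendsTo IP IX π (α.subst u A) a :=
  hπ.exists_descendsTo (isSmoothForm_subst α A hu.1) (hπ.isEquivariantForm_subst α A hu)
    (hπ.isHorizontalForm_subst α A hu)

/-- The identity is proved on the base, where horizontal sections are available, and is then pulled
back under π. -/
lemma IsPrincipalBundle.extd_subst (hπ : IsPrincipalBundle IG IP IX G π) {ℓ : ℕ}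
    (α : EquivForm IG IM b M ℓ) (β : EquivForm IG IM b M (ℓ + 1)) (A : Connection IG IP G P)
    {u : P → M} (hu : IsEquivariantMap IM IP G u) (h : ∀ ξ, α.dG ξ = β.eval ξ) :
    extd IP (α.subst u A) = β.subst u A := by
  obtain ⟨a, ha⟩ := hπ.exists_descendsTo_subst α A hu
  obtain ⟨a', ha'⟩ := hπ.exists_descendsTo_subst β A hu
  rw [← ha.2, ← ha'.2, extd_pullback ha.1 hπ.smooth_proj,
    hπ.extd_eq_of_descendsTo α β A hu.1 h ha ha']

/-- The case β = 0 of the formula for dα(u,A). -/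
lemma IsPrincipalBundle.extd_eq_zero_of_isClosed (hπ : IsPrincipalBundle IG IP IX G π) {ℓ : ℕ}
    {α : EquivForm IG IM b M ℓ} (hα : α.IsClosed) (A : Connection IG IP G P)
    {u : P → M} (hu : IsEquivariantMap IM IP G u) {a : DForm EX X ℓ}
    (ha : DescendsTo IP IX π (α.subst u A) a) : extd IX a = 0 := by
  refine hπ.extd_eq_of_descendsTo α (EquivForm.zero IG IM b M (ℓ + 1)) A hu.1 (fun ξ => ?_) ha
    ⟨isSmoothForm_zero, ?_⟩
  · rw [hα ξ, EquivForm.eval_zero]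
  · rw [EquivForm.subst_zero]
    rfl

/-- The given homotopy is smooth on [0,1] only. A smooth step function ℝ → [0,1] with values 0 at 0
and 1 at 1 reparametrizes it to a smooth map on ℝ × P with the same ends, which avoids manifolds
with boundary. -/
lemma exists_smooth_homotopy {u₀ u₁ : P → M} (h : EquivariantlyHomotopic IM IP G u₀ u₁) :
    ∃ w : ℝ × P → M, IsEquivariantMap IM (𝓘(ℝ, ℝ).prod IP) G w ∧
      (w ∘ fun p => ((0 : ℝ), p)) = u₀ ∧ (w ∘ fun p => ((1 : ℝ), p)) = u₁ := by
  obtain ⟨k, hk, hk', h0, h1⟩ := h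
  have hI : ∀ t : ℝ, Real.smoothTransition t ∈ Icc (0 : ℝ) 1 := fun t =>
    ⟨Real.smoothTransition.nonneg t, Real.smoothTransition.le_one t⟩
  refine ⟨fun q => k (Real.smoothTransition q.1, q.2), ⟨?_, ?_⟩, ?_, ?_⟩
  · refine hk.comp_contMDiff (ContMDiff.prodMk ?_ contMDiff_snd) fun q => ⟨hI q.1, mem_univ _⟩
    exact (Real.smoothTransition.contDiff (n := ⊤)).contMDiff.comp contMDiff_fst
  · rintro ⟨t, p⟩ g
    exact hk' _ (hI t) p g
  · ext1 p
    simp [Real.smoothTransition.zero, h0]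
  · ext1 p
    simp [Real.smoothTransition.one, h1]

/-- Pullback under π is injective, and upstairs the claim is naturality of α(u,A) under p ↦ (t, p).
-/
lemma IsPrincipalBundle.slice_pullback (hπ : IsPrincipalBundle IG IP IX G π) {ℓ : ℕ}
    (α : EquivForm IG IM b M ℓ) (t : ℝ) {A : Connection IG IP G P}
    {B : Connection IG (𝓘(ℝ, ℝ).prod IP) G (ℝ × P)}
    (hB : ∀ p v, B.form (t, p) (tangentMapAt IP (𝓘(ℝ, ℝ).prod IP) (fun p : P => (t, p)) p v) =
      A.form p v) {w : ℝ × P → M} (hw : ContMDiff (𝓘(ℝ, ℝ).prod IP) IM ∞ w)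
    {a : DForm EX X ℓ} {a' : DForm (ℝ × EX) (ℝ × X) ℓ}
    (ha : DescendsTo IP IX π (α.subst (w ∘ fun p => (t, p)) A) a)
    (ha' : DescendsTo (𝓘(ℝ, ℝ).prod IP) (𝓘(ℝ, ℝ).prod IX) (Prod.map id π) (α.subst w B) a') :
    pullback IX (𝓘(ℝ, ℝ).prod IX) (fun x : X => (t, x)) a' = a := by
  refine hπ.eq_of_pullback_eq ?_
  rw [ha.2, ← pullback_subst_eq (contMDiff_slice t) hB hw α, ← ha'.2]
  ext1 p
  have h1 := pullback_comp_apply (I := IP) (I' := IX) (I'' := 𝓘(ℝ, ℝ).prod IX) (x := p)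
    ((contMDiff_slice (I := IX) t (π p)).mdifferentiableAt (by simp))
    ((hπ.smooth_proj p).mdifferentiableAt (by simp)) a'
  have h2 := pullback_comp_apply (I := IP) (I' := 𝓘(ℝ, ℝ).prod IP) (I'' := 𝓘(ℝ, ℝ).prod IX) (x := p)
    ((hπ.cylinder.smooth_proj (t, p)).mdifferentiableAt (by simp))
    ((contMDiff_slice (I := IP) t p).mdifferentiableAt (by simp)) a'
  exact h1.symm.trans h2

/-- For closed `α`, the form on the base changes by an exact form under a change of the connection
and an equivariant homotopy. -/
lemma IsPrincipalBundle.isExactForm_sub (hπ : IsPrincipalBundle IG IP IX G π) {ℓ : ℕ}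
    {α : EquivForm IG IM b M ℓ} (hα : α.IsClosed) (A₀ A₁ : Connection IG IP G P) {u₀ u₁ : P → M}
    (h : EquivariantlyHomotopic IM IP G u₀ u₁) {a₀ a₁ : DForm EX X ℓ}
    (ha₀ : DescendsTo IP IX π (α.subst u₀ A₀) a₀) (ha₁ : DescendsTo IP IX π (α.subst u₁ A₁) a₁) :
    IsExactForm IX (a₁ - a₀) := by
  obtain ⟨w, hw, rfl, rfl⟩ := exists_smooth_homotopy h
  obtain ⟨a', ha'⟩ := hπ.cylinder.exists_descendsTo_subst α (hπ.cylinderConnection A₀ A₁) hw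
  rw [← hπ.slice_pullback α 0 (hπ.cylinderConnection_zero A₀ A₁) hw.1 ha₀ ha',
    ← hπ.slice_pullback α 1 (hπ.cylinderConnection_one A₀ A₁) hw.1 ha₁ ha']
  exact isExactForm_slice_sub_slice ha'.1 (hπ.cylinder.extd_eq_zero_of_isClosed hα _ hw ha')

end HomotopyInvariance

end

end EquivariantForms

namespace EquivariantForms

noncomputable section

/-! ### Integrals in a chart and change of charts -/

section ChartIntegral

variable {d : ℕ}

/-- The standard frame of Euclidean space. -/
def stdFrame (d : ℕ) : Fin d → EuclideanSpace ℝ (Fin d) := fun i => EuclideanSpace.single i 1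

/-- A form of top degree is a multiple of the determinant. -/
lemma apply_comp_stdFrame (f : EuclideanSpace ℝ (Fin d) [⋀^Fin d]→L[ℝ] ℝ)
    (L : EuclideanSpace ℝ (Fin d) →L[ℝ] EuclideanSpace ℝ (Fin d)) :
    f.compContinuousLinearMap L (stdFrame d) = L.det * f (stdFrame d) := by
  let e := (EuclideanSpace.basisFun (Fin d) ℝ).toBasis
  have he : (e : Fin d → EuclideanSpace ℝ (Fin d)) = stdFrame d := by
    ext1 i
    simp [e, stdFrame]
  have h1 := AlternatingMap.eq_smul_basis_det e f.toAlternatingMap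
  have h2 : f.compContinuousLinearMap L (stdFrame d) = f.toAlternatingMap (L ∘ e) := by
    rw [he]; rfl
  have h3 : f (stdFrame d) = f.toAlternatingMap e := by rw [he]; rfl
  have h4 := e.det_comp (L : EuclideanSpace ℝ (Fin d) →ₗ[ℝ] EuclideanSpace ℝ (Fin d)) e
  rw [h2, h3]
  conv_lhs => rw [h1]
  rw [AlternatingMap.smul_apply, smul_eq_mul, mul_comm]
  congr 1
  rw [e.det_self, mul_one] at h4
  exact h4

lemma apply_stdFrame_ne_zero {f : EuclideanSpace ℝ (Fin d) [⋀^Fin d]→L[ℝ] ℝ} (hf : f ≠ 0) :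
    f (stdFrame d) ≠ 0 := by
  intro h
  let e := (EuclideanSpace.basisFun (Fin d) ℝ).toBasis
  have he : (e : Fin d → EuclideanSpace ℝ (Fin d)) = stdFrame d := by
    ext1 i
    simp [e, stdFrame]
  have h1 := AlternatingMap.eq_smul_basis_det e f.toAlternatingMap
  have h3 : f.toAlternatingMap e = 0 := by rw [he]; exact h
  rw [h3, zero_smul] at h1
  exact hf (ContinuousAlternatingMap.toAlternatingMap_injective h1)

variable {X : Type*} [TopologicalSpace X] [ChartedSpace (EuclideanSpace ℝ (Fin d)) X]

/-- The density of a form in the chart around `c`, with the sign given by the orientation. -/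
def chartDensity (vol : DForm (EuclideanSpace ℝ (Fin d)) X d) (c : X)
    (θ : DForm (EuclideanSpace ℝ (Fin d)) X d) (y : EuclideanSpace ℝ (Fin d)) : ℝ :=
  (SignType.sign (inChart (𝓡 d) vol c y (stdFrame d)) : ℝ) * inChart (𝓡 d) θ c y (stdFrame d)

/-- The integral of a form over the domain of the chart around `c`. -/
def chartIntegral (vol : DForm (EuclideanSpace ℝ (Fin d)) X d) (c : X)
    (θ : DForm (EuclideanSpace ℝ (Fin d)) X d) : ℝ :=
  ∫ y in (extChartAt (𝓡 d) c).target, chartDensity vol c θ y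

lemma formIntegral_eq (vol : DForm (EuclideanSpace ℝ (Fin d)) X d)
    (f : SmoothPartitionOfUnity X (𝓡 d) X univ) (θ : DForm (EuclideanSpace ℝ (Fin d)) X d) :
    formIntegral vol f θ = ∑ᶠ c : X, chartIntegral vol c (fun x => f c x • θ x) := by
  refine finsum_congr fun c => ?_
  refine MeasureTheory.integral_congr_ae (Eventually.of_forall fun y => ?_)
  have h1 : inChart (𝓡 d) (fun x => f c x • θ x) c y (stdFrame d) =
    f c ((extChartAt (𝓡 d) c).symm y) * inChart (𝓡 d) θ c y (stdFrame d) := rfl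
  change _ = chartDensity vol c _ y
  rw [chartDensity, h1]
  change f c ((extChartAt (𝓡 d) c).symm y) * _ * inChart (𝓡 d) θ c y (stdFrame d) = _
  rw [mul_left_comm, mul_assoc]
  rfl

lemma chartDensity_eq_zero {vol : DForm (EuclideanSpace ℝ (Fin d)) X d} {c : X}
    {θ : DForm (EuclideanSpace ℝ (Fin d)) X d} {y : EuclideanSpace ℝ (Fin d)}
    (h : θ ((extChartAt (𝓡 d) c).symm y) = 0) : chartDensity vol c θ y = 0 := by
  have h1 : inChart (𝓡 d) θ c y = 0 := by
    rw [inChart, pullback_apply, h]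
    rfl
  rw [chartDensity, h1]
  exact mul_zero _

variable [IsManifold (𝓡 d) ∞ X]

lemma inChart_transition {n : ℕ} (θ : DForm (EuclideanSpace ℝ (Fin d)) X n) {c c' : X}
    {y : EuclideanSpace ℝ (Fin d)} (hy : y ∈ (extChartAt (𝓡 d) c).target)
    (hy' : (extChartAt (𝓡 d) c).symm y ∈ (extChartAt (𝓡 d) c').source) :
    inChart (𝓡 d) θ c y = (inChart (𝓡 d) θ c' (extChartAt (𝓡 d) c'
      ((extChartAt (𝓡 d) c).symm y))).compContinuousLinearMap
      (fderiv ℝ (extChartAt (𝓡 d) c' ∘ (extChartAt (𝓡 d) c).symm) y) :=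
  (pullback_eventuallyEq_chart (contMDiffAt_chart_symm hy) hy' θ).self_of_nhds

/-- Under a change of charts θ is multiplied by the Jacobian determinant and the orientation sign by
its sign; together they give the absolute value required by the change of variables formula. -/
lemma chartDensity_transition (vol θ : DForm (EuclideanSpace ℝ (Fin d)) X d) {c c' : X}
    {y : EuclideanSpace ℝ (Fin d)} (hy : y ∈ (extChartAt (𝓡 d) c).target)
    (hy' : (extChartAt (𝓡 d) c).symm y ∈ (extChartAt (𝓡 d) c').source) :
    chartDensity vol c θ y =
      |(fderiv ℝ (extChartAt (𝓡 d) c' ∘ (extChartAt (𝓡 d) c).symm) y).det| •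
        chartDensity vol c' θ ((extChartAt (𝓡 d) c' ∘ (extChartAt (𝓡 d) c).symm) y) := by
  rw [chartDensity, inChart_transition vol hy hy', inChart_transition θ hy hy',
    apply_comp_stdFrame, apply_comp_stdFrame, chartDensity, sign_mul, ← sign_mul_self,
    SignType.coe_mul, smul_eq_mul]
  simp only [Function.comp_apply]
  ring

/-- The densities vanish outside the overlap of the two charts; there the integrals agree by change
of variables under the transition map φ, which maps s bijectively onto s'. -/
lemma chartIntegral_eq_of_support (vol : DForm (EuclideanSpace ℝ (Fin d)) X d) {c c' : X}
    {θ : DForm (EuclideanSpace ℝ (Fin d)) X d}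
    (h : ∀ x, θ x ≠ 0 → x ∈ (extChartAt (𝓡 d) c).source ∧ x ∈ (extChartAt (𝓡 d) c').source) :
    chartIntegral vol c θ = chartIntegral vol c' θ := by
  set s := (extChartAt (𝓡 d) c).target ∩
    (extChartAt (𝓡 d) c).symm ⁻¹' (extChartAt (𝓡 d) c').source with hs
  set s' := (extChartAt (𝓡 d) c').target ∩
    (extChartAt (𝓡 d) c').symm ⁻¹' (extChartAt (𝓡 d) c).source with hs'
  set φ := extChartAt (𝓡 d) c' ∘ (extChartAt (𝓡 d) c).symm with hφ
  have hso : IsOpen s := (continuousOn_extChartAt_symm c).isOpen_inter_preimage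
    (isOpen_extChartAt_target c) (isOpen_extChartAt_source c')
  have himg : φ '' s = s' := by
    ext z
    constructor
    · rintro ⟨y, hy, rfl⟩
      refine ⟨(extChartAt (𝓡 d) c').map_source hy.2, ?_⟩
      rw [mem_preimage, hφ, Function.comp_apply, (extChartAt (𝓡 d) c').left_inv hy.2]
      exact (extChartAt (𝓡 d) c).map_target hy.1
    · intro hz
      refine ⟨extChartAt (𝓡 d) c ((extChartAt (𝓡 d) c').symm z),
        ⟨(extChartAt (𝓡 d) c).map_source hz.2, ?_⟩, ?_⟩
      · rw [mem_preimage, (extChartAt (𝓡 d) c).left_inv hz.2]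
        exact (extChartAt (𝓡 d) c').map_target hz.1
      · rw [hφ, Function.comp_apply, (extChartAt (𝓡 d) c).left_inv hz.2,
          (extChartAt (𝓡 d) c').right_inv hz.1]
  have hinj : InjOn φ s := by
    intro y hy z hz hyz
    refine (extChartAt (𝓡 d) c).symm.injOn hy.1 hz.1 ?_
    exact (extChartAt (𝓡 d) c').injOn hy.2 hz.2 hyz
  have hder : ∀ y ∈ s, HasFDerivWithinAt φ (fderiv ℝ φ y) s y := fun y hy =>
    ((contDiffAt_chart_comp (contMDiffAt_chart_symm hy.1) hy.2).differentiableAt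
      (by simp)).hasFDerivAt.hasFDerivWithinAt
  have h1 : ∫ y in (extChartAt (𝓡 d) c).target, chartDensity vol c θ y =
      ∫ y in s, chartDensity vol c θ y :=
    MeasureTheory.setIntegral_eq_of_subset_of_forall_diff_eq_zero
      (isOpen_extChartAt_target c).measurableSet inter_subset_left fun y hy =>
      chartDensity_eq_zero (by_contra fun h0 => hy.2 ⟨hy.1, (h _ h0).2⟩)
  have h2 : ∫ y in (extChartAt (𝓡 d) c').target, chartDensity vol c' θ y =
      ∫ y in s', chartDensity vol c' θ y :=
    MeasureTheory.setIntegral_eq_of_subset_of_forall_diff_eq_zero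
      (isOpen_extChartAt_target c').measurableSet inter_subset_left fun y hy =>
      chartDensity_eq_zero (by_contra fun h0 => hy.2 ⟨hy.1, (h _ h0).1⟩)
  rw [chartIntegral, chartIntegral, h1, h2, ← himg,
    MeasureTheory.integral_image_eq_integral_abs_det_fderiv_smul _ hso.measurableSet hder hinj]
  exact MeasureTheory.setIntegral_congr_fun hso.measurableSet fun y hy =>
    chartDensity_transition vol θ hy.1 hy.2

end ChartIntegral

end

end EquivariantForms

namespace EquivariantForms

noncomputable section

/-! ### Stokes' theorem for compactly supported forms on a vector space -/

section EuclideanStokes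

variable {E : Type*} [NormedAddCommGroup E] [NormedSpace ℝ E] [FiniteDimensional ℝ E]
  [MeasurableSpace E] [BorelSpace E] (μ : MeasureTheory.Measure E) [μ.IsAddHaarMeasure]

/-- Integration by parts against the constant function 1. -/
lemma integral_fderiv_eq_zero {g : E → ℝ} (hg : ContDiff ℝ 1 g) (hc : HasCompactSupport g)
    (w : E) : MeasureTheory.Integrable (fun x => fderiv ℝ g x w) μ ∧
      ∫ x, fderiv ℝ g x w ∂μ = 0 := by
  have h1 : MeasureTheory.Integrable (fun x => fderiv ℝ g x w) μ :=
    ((hg.continuous_fderiv (by simp)).clm_apply continuous_const).integrable_of_hasCompactSupport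
      (hc.fderiv_apply (𝕜 := ℝ) w)
  have h2 : MeasureTheory.Integrable g μ := hg.continuous.integrable_of_hasCompactSupport hc
  refine ⟨h1, ?_⟩
  have h := integral_mul_fderiv_eq_neg_fderiv_mul_of_integrable (μ := μ) (f := fun _ : E => (1 : ℝ))
    (g := g) (v := w) (by simp) (by simpa using h1) (by simpa using h2)
    (fun _ _ => differentiableAt_const _) (fun x _ => hg.differentiable (by simp) x)
  simpa using h

lemma integral_extDeriv_eq_zero {n : ℕ} {η : E → E [⋀^Fin n]→L[ℝ] ℝ} (hη : ContDiff ℝ 1 η)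
    (hc : HasCompactSupport η) (v : Fin (n + 1) → E) : ∫ x, extDeriv η x v ∂μ = 0 := by
  have h1 : ∀ i : Fin (n + 1), ContDiff ℝ 1 (fun x => η x (i.removeNth v)) := fun i =>
    (ContinuousAlternatingMap.apply ℝ E ℝ (i.removeNth v)).contDiff.comp hη
  have h2 : ∀ i : Fin (n + 1), HasCompactSupport (fun x => η x (i.removeNth v)) := fun i =>
    hc.comp_left (g := fun f : E [⋀^Fin n]→L[ℝ] ℝ => f (i.removeNth v)) rfl
  have h3 : ∀ x, extDeriv η x v =
      ∑ i : Fin (n + 1), (-1 : ℝ) ^ i.val * fderiv ℝ (fun x => η x (i.removeNth v)) x (v i) :=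
    fun x => by
      rw [extDeriv_apply (hη.differentiable (by simp) x)]
      simp
  simp only [h3]
  rw [MeasureTheory.integral_finsetSum]
  · refine Finset.sum_eq_zero fun i _ => ?_
    rw [MeasureTheory.integral_const_mul, (integral_fderiv_eq_zero μ (h1 i) (h2 i) (v i)).2,
      mul_zero]
  · exact fun i _ => (integral_fderiv_eq_zero μ (h1 i) (h2 i) (v i)).1.const_mul _

end EuclideanStokes

/-! ### Supports of forms and of their expressions in charts -/

section Support

variable {E : Type*} [NormedAddCommGroup E] [NormedSpace ℝ E]
  {H : Type*} [TopologicalSpace H] {I : ModelWithCorners ℝ E H} [I.Boundaryless]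
  {M : Type*} [TopologicalSpace M] [ChartedSpace H M] [IsManifold I ∞ M]

lemma extd_eq_zero_of_eventuallyEq {n : ℕ} {θ : DForm E M n} {x : M} (h : θ =ᶠ[𝓝 x] 0) :
    extd I θ x = 0 := by
  have hx := mem_extChartAt_target (I := I) x
  have h1 : inChart I θ x =ᶠ[𝓝 (extChartAt I x x)] fun _ => 0 := by
    have h2 := (contMDiffAt_chart_symm (I := I) hx).continuousAt.tendsto
    rw [extChartAt_to_inv] at h2
    filter_upwards [h2.eventually h] with z hz
    rw [inChart, pullback_apply, hz]
    rfl
  have h3 : extDeriv (inChart I θ x) (extChartAt I x x) = 0 := by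
    rw [h1.extDeriv_eq, extDeriv, fderiv_fun_const]
    exact (ContinuousAlternatingMap.alternatizeUncurryFinCLM ℝ E ℝ).map_zero
  rw [extd, h3]
  rfl

variable (I) in
lemma tsupport_extd_subset {n : ℕ} (θ : DForm E M n) : tsupport (extd I θ) ⊆ tsupport θ := by
  refine closure_minimal (fun x hx => ?_) (isClosed_tsupport θ)
  by_contra h
  exact hx (extd_eq_zero_of_eventuallyEq (notMem_tsupport_iff_eventuallyEq.1 h))

lemma inChart_eq_zero {n : ℕ} {θ : DForm E M n} {c : M} {y : E}
    (h : θ ((extChartAt I c).symm y) = 0) : inChart I θ c y = 0 := by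
  rw [inChart, pullback_apply, h]
  rfl

lemma inChart_ne_zero {n : ℕ} {θ : DForm E M n} {c : M} {y : E}
    (hy : y ∈ (extChartAt I c).target) (h : θ ((extChartAt I c).symm y) ≠ 0) :
    inChart I θ c y ≠ 0 := by
  intro h0
  refine h ?_
  have h1 := tangentMapAt_symm_comp_chart (I := I) ((extChartAt I c).map_target hy)
  rw [(extChartAt I c).right_inv hy] at h1
  have h2 : (inChart I θ c y).compContinuousLinearMap
      (tangentMapAt I 𝓘(ℝ, E) (extChartAt I c) ((extChartAt I c).symm y)) =
      θ ((extChartAt I c).symm y) := by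
    rw [inChart, pullback_apply, comp_comp, h1, comp_id]
  rw [← h2, h0]
  rfl

lemma isCompact_chart_image [CompactSpace M] {n : ℕ} {θ : DForm E M n} {c : M}
    (h : tsupport θ ⊆ (extChartAt I c).source) : IsCompact (extChartAt I c '' tsupport θ) :=
  (isClosed_tsupport θ).isCompact.image_of_continuousOn ((continuousOn_extChartAt c).mono h)

lemma eq_zero_of_notMem_chart_image {n : ℕ} {θ : DForm E M n} {c : M} {y : E}
    (hy : y ∈ (extChartAt I c).target) (h : y ∉ extChartAt I c '' tsupport θ) :
    θ ((extChartAt I c).symm y) = 0 := by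
  by_contra h0
  exact h ⟨_, subset_tsupport θ h0, (extChartAt I c).right_inv hy⟩

end Support

/-! ### Orientation signs and integrability -/

section FormIntegral

variable {d : ℕ} {X : Type*} [TopologicalSpace X] [ChartedSpace (EuclideanSpace ℝ (Fin d)) X]
  [IsManifold (𝓡 d) ∞ X] {vol : DForm (EuclideanSpace ℝ (Fin d)) X d}

/-- The orientation form has no zeros, so its coefficient in the chart is continuous and nonzero and
its sign is locally constant. Locally is enough; the chart domain may be disconnected. -/
lemma IsOrientationForm.eventually_sign_eq (hvol : IsOrientationForm vol) {c : X}
    {y : EuclideanSpace ℝ (Fin d)} (hy : y ∈ (extChartAt (𝓡 d) c).target) :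
    ∀ᶠ z in 𝓝 y, SignType.sign (inChart (𝓡 d) vol c z (stdFrame d)) =
      SignType.sign (inChart (𝓡 d) vol c y (stdFrame d)) := by
  have h1 : inChart (𝓡 d) vol c y (stdFrame d) ≠ 0 :=
    apply_stdFrame_ne_zero (inChart_ne_zero hy (hvol.2 _))
  have h2 : ContinuousAt (fun z => inChart (𝓡 d) vol c z (stdFrame d)) y :=
    (ContinuousAlternatingMap.apply ℝ (EuclideanSpace ℝ (Fin d)) ℝ
      (stdFrame d)).continuous.continuousAt.comp (hvol.1.contDiffAt_inChart hy).continuousAt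
  have h3 := ContinuousAt.comp (g := SignType.sign)
    (f := fun z => inChart (𝓡 d) vol c z (stdFrame d)) (x := y) (continuousAt_sign_of_ne_zero h1) h2
  exact h3.eventually ((isOpen_discrete {SignType.sign _}).mem_nhds rfl)

lemma IsOrientationForm.continuousOn_chartDensity (hvol : IsOrientationForm vol) (c : X)
    {θ : DForm (EuclideanSpace ℝ (Fin d)) X d} (hθ : IsSmoothForm (𝓡 d) θ) :
    ContinuousOn (chartDensity vol c θ) (extChartAt (𝓡 d) c).target := by
  intro y hy
  have h2 : ContinuousAt (fun z => (SignType.sign (inChart (𝓡 d) vol c y (stdFrame d)) : ℝ) *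
      inChart (𝓡 d) θ c z (stdFrame d)) y :=
    continuousAt_const.mul ((ContinuousAlternatingMap.apply ℝ (EuclideanSpace ℝ (Fin d)) ℝ
      (stdFrame d)).continuous.continuousAt.comp (hθ.contDiffAt_inChart hy).continuousAt)
  refine (h2.congr ?_).continuousWithinAt
  filter_upwards [hvol.eventually_sign_eq hy] with z hz
  rw [chartDensity, hz]

variable [CompactSpace X]

lemma IsOrientationForm.integrableOn_chartDensity (hvol : IsOrientationForm vol) {c : X}
    {θ : DForm (EuclideanSpace ℝ (Fin d)) X d} (hθ : IsSmoothForm (𝓡 d) θ)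
    (h : tsupport θ ⊆ (extChartAt (𝓡 d) c).source) :
    MeasureTheory.IntegrableOn (chartDensity vol c θ) (extChartAt (𝓡 d) c).target := by
  have hK := isCompact_chart_image h
  have hKt : extChartAt (𝓡 d) c '' tsupport θ ⊆ (extChartAt (𝓡 d) c).target := by
    rintro _ ⟨x, hx, rfl⟩
    exact (extChartAt (𝓡 d) c).map_source (h hx)
  have h1 : MeasureTheory.IntegrableOn (chartDensity vol c θ) (extChartAt (𝓡 d) c '' tsupport θ) :=
    ((hvol.continuousOn_chartDensity c hθ).mono hKt).integrableOn_compact hK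
  exact h1.of_forall_diff_eq_zero (isOpen_extChartAt_target c).measurableSet fun y hy =>
    chartDensity_eq_zero (eq_zero_of_notMem_chart_image hy.1 hy.2)

lemma IsOrientationForm.chartIntegral_sum (hvol : IsOrientationForm vol) {c : X} {ι : Type*}
    (s : Finset ι) {θ : ι → DForm (EuclideanSpace ℝ (Fin d)) X d}
    (hθ : ∀ k ∈ s, IsSmoothForm (𝓡 d) (θ k))
    (h : ∀ k ∈ s, tsupport (θ k) ⊆ (extChartAt (𝓡 d) c).source) :
    chartIntegral vol c (∑ k ∈ s, θ k) = ∑ k ∈ s, chartIntegral vol c (θ k) := by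
  have h1 : chartDensity vol c (∑ k ∈ s, θ k) = fun y => ∑ k ∈ s, chartDensity vol c (θ k) y := by
    ext1 y
    simp only [chartDensity, inChart]
    rw [pullback_sum, Finset.sum_apply, ContinuousAlternatingMap.sum_apply, Finset.mul_sum]
  rw [chartIntegral, h1]
  exact MeasureTheory.integral_finsetSum s fun k hk =>
    hvol.integrableOn_chartDensity (hθ k hk) (h k hk)

end FormIntegral

end

end EquivariantForms

namespace EquivariantForms

noncomputable section

/-! ### Independence of the partition of unity -/

section PartitionIndependence

variable {d : ℕ} {X : Type*} [TopologicalSpace X] [ChartedSpace (EuclideanSpace ℝ (Fin d)) X]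
  [IsManifold (𝓡 d) ∞ X] [CompactSpace X] {vol : DForm (EuclideanSpace ℝ (Fin d)) X d}

/-- By compactness only finitely many members of a locally finite partition are nonzero. One finite
set serves all forms, so the integral becomes a finite sum. -/
lemma exists_finset_formIntegral_eq (f : SmoothPartitionOfUnity X (𝓡 d) X univ) :
    ∃ S : Finset X, (∀ x, ∑ c ∈ S, f c x = 1) ∧
      ∀ vol θ, formIntegral vol f θ = ∑ c ∈ S, chartIntegral vol c (fun x => f c x • θ x) := by
  have hfin : {c | (Function.support (f c)).Nonempty}.Finite :=
    f.locallyFinite.finite_nonempty_of_compact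
  have h0 : ∀ c ∉ hfin.toFinset, ∀ x, f c x = 0 := by
    intro c hc x
    by_contra hx
    exact hc (hfin.mem_toFinset.2 ⟨x, hx⟩)
  refine ⟨hfin.toFinset, fun x => ?_, fun vol θ => ?_⟩
  · rw [← f.sum_eq_one (mem_univ x)]
    refine (finsum_eq_sum_of_support_subset _ fun c hc => ?_).symm
    by_contra h
    exact hc (h0 c h x)
  · rw [formIntegral_eq]
    refine finsum_eq_sum_of_support_subset _ fun c hc => ?_
    by_contra h
    refine hc (MeasureTheory.integral_eq_zero_of_ae (Eventually.of_forall fun y => ?_))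
    refine chartDensity_eq_zero ?_
    simp only [h0 c h, zero_smul]

lemma tsupport_fun_smul_subset_left (f : X → ℝ) {n : ℕ}
    (θ : DForm (EuclideanSpace ℝ (Fin d)) X n) : tsupport (fun x => f x • θ x) ⊆ tsupport f :=
  closure_mono (Function.support_smul_subset_left f θ)

lemma tsupport_fun_smul_subset_right (f : X → ℝ) {n : ℕ}
    (θ : DForm (EuclideanSpace ℝ (Fin d)) X n) : tsupport (fun x => f x • θ x) ⊆ tsupport θ :=
  closure_mono (Function.support_smul_subset_right f θ)

lemma subordinate_subset {f : SmoothPartitionOfUnity X (𝓡 d) X univ}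
    (hf : f.IsSubordinate (fun c => (chartAt (EuclideanSpace ℝ (Fin d)) c).source)) (c : X) :
    tsupport (f c) ⊆ (extChartAt (𝓡 d) c).source := by
  rw [extChartAt_source]
  exact hf c

/-- The integral of a form supported in a chart domain can be computed in that chart. -/
lemma IsOrientationForm.formIntegral_eq_chartIntegral (hvol : IsOrientationForm vol)
    {f : SmoothPartitionOfUnity X (𝓡 d) X univ}
    (hf : f.IsSubordinate (fun c => (chartAt (EuclideanSpace ℝ (Fin d)) c).source))
    {θ : DForm (EuclideanSpace ℝ (Fin d)) X d} (hθ : IsSmoothForm (𝓡 d) θ) {c' : X}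
    (h : tsupport θ ⊆ (extChartAt (𝓡 d) c').source) :
    formIntegral vol f θ = chartIntegral vol c' θ := by
  obtain ⟨S, hS, hI⟩ := exists_finset_formIntegral_eq f
  have h1 : θ = ∑ c ∈ S, fun x => f c x • θ x := by
    ext1 x
    rw [Finset.sum_apply, ← Finset.sum_smul, hS, one_smul]
  have h2 : ∀ c, chartIntegral vol c (fun x => f c x • θ x) =
      chartIntegral vol c' (fun x => f c x • θ x) := fun c =>
    chartIntegral_eq_of_support vol fun x hx =>
      ⟨subordinate_subset hf c (tsupport_fun_smul_subset_left _ θ (subset_tsupport _ hx)),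
        h (tsupport_fun_smul_subset_right (f c) θ (subset_tsupport _ hx))⟩
  rw [hI]
  simp only [h2]
  conv_rhs => rw [h1]
  exact (hvol.chartIntegral_sum S (fun c _ => hθ.fun_smul (f c).contMDiff)
    fun c _ => (tsupport_fun_smul_subset_right _ θ).trans h).symm

lemma IsOrientationForm.formIntegral_sum (hvol : IsOrientationForm vol)
    {f : SmoothPartitionOfUnity X (𝓡 d) X univ}
    (hf : f.IsSubordinate (fun c => (chartAt (EuclideanSpace ℝ (Fin d)) c).source)) {ι : Type*}
    (s : Finset ι) {θ : ι → DForm (EuclideanSpace ℝ (Fin d)) X d}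
    (hθ : ∀ k ∈ s, IsSmoothForm (𝓡 d) (θ k)) :
    formIntegral vol f (∑ k ∈ s, θ k) = ∑ k ∈ s, formIntegral vol f (θ k) := by
  obtain ⟨S, hS, hI⟩ := exists_finset_formIntegral_eq f
  simp only [hI]
  rw [Finset.sum_comm]
  refine Finset.sum_congr rfl fun c _ => ?_
  rw [← hvol.chartIntegral_sum s (θ := fun k x => f c x • θ k x)
    (fun k hk => (hθ k hk).fun_smul (f c).contMDiff)
    fun k _ => (tsupport_fun_smul_subset_left _ (θ k)).trans (subordinate_subset hf c)]
  congr 1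
  ext1 x
  rw [Finset.sum_apply, Finset.sum_apply, Finset.smul_sum]

lemma IsOrientationForm.formIntegral_add (hvol : IsOrientationForm vol)
    {f : SmoothPartitionOfUnity X (𝓡 d) X univ}
    (hf : f.IsSubordinate (fun c => (chartAt (EuclideanSpace ℝ (Fin d)) c).source))
    {θ θ' : DForm (EuclideanSpace ℝ (Fin d)) X d} (hθ : IsSmoothForm (𝓡 d) θ)
    (hθ' : IsSmoothForm (𝓡 d) θ') :
    formIntegral vol f (θ + θ') = formIntegral vol f θ + formIntegral vol f θ' := by
  have h := hvol.formIntegral_sum hf (Finset.univ : Finset (Fin 2)) (θ := ![θ, θ'])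
    (fun k _ => by fin_cases k <;> assumption)
  simpa [Fin.sum_univ_two] using h

/-- The integral does not depend on the partition of unity. -/
lemma IsOrientationForm.formIntegral_eq_formIntegral (hvol : IsOrientationForm vol)
    {f f' : SmoothPartitionOfUnity X (𝓡 d) X univ}
    (hf : f.IsSubordinate (fun c => (chartAt (EuclideanSpace ℝ (Fin d)) c).source))
    (hf' : f'.IsSubordinate (fun c => (chartAt (EuclideanSpace ℝ (Fin d)) c).source))
    {θ : DForm (EuclideanSpace ℝ (Fin d)) X d} (hθ : IsSmoothForm (𝓡 d) θ) :
    formIntegral vol f θ = formIntegral vol f' θ := by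
  obtain ⟨S, hS, hI⟩ := exists_finset_formIntegral_eq f
  have h1 : θ = ∑ c ∈ S, fun x => f c x • θ x := by
    ext1 x
    rw [Finset.sum_apply, ← Finset.sum_smul, hS, one_smul]
  have h2 : ∀ c, IsSmoothForm (𝓡 d) fun x => f c x • θ x := fun c => hθ.fun_smul (f c).contMDiff
  conv_rhs => rw [h1]
  rw [hI, hvol.formIntegral_sum hf' S fun c _ => h2 c]
  exact Finset.sum_congr rfl fun c _ => (hvol.formIntegral_eq_chartIntegral hf' (h2 c)
    ((tsupport_fun_smul_subset_left _ θ).trans (subordinate_subset hf c))).symm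

end PartitionIndependence

/-! ### Stokes' theorem on a compact oriented manifold -/

section Stokes

variable {n : ℕ} {X : Type*} [TopologicalSpace X]
  [ChartedSpace (EuclideanSpace ℝ (Fin (n + 1))) X] [IsManifold (𝓡 (n + 1)) ∞ X] [CompactSpace X]
  {vol : DForm (EuclideanSpace ℝ (Fin (n + 1))) X (n + 1)}

open scoped Classical in
/-- The chart expression of a form around `c`, with the sign given by the orientation, extended by
zero. -/
def orientedExtension (vol : DForm (EuclideanSpace ℝ (Fin (n + 1))) X (n + 1)) (c : X)
    (γ : DForm (EuclideanSpace ℝ (Fin (n + 1))) X n) :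
    DForm (EuclideanSpace ℝ (Fin (n + 1))) (EuclideanSpace ℝ (Fin (n + 1))) n := fun y =>
  if y ∈ (extChartAt (𝓡 (n + 1)) c).target then
    (SignType.sign (inChart (𝓡 (n + 1)) vol c y (stdFrame (n + 1))) : ℝ) •
      inChart (𝓡 (n + 1)) γ c y
  else 0

lemma IsOrientationForm.orientedExtension_eventuallyEq (hvol : IsOrientationForm vol) {c : X}
    (γ : DForm (EuclideanSpace ℝ (Fin (n + 1))) X n) {y : EuclideanSpace ℝ (Fin (n + 1))}
    (hy : y ∈ (extChartAt (𝓡 (n + 1)) c).target) :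
    orientedExtension vol c γ =ᶠ[𝓝 y] fun z =>
      (SignType.sign (inChart (𝓡 (n + 1)) vol c y (stdFrame (n + 1))) : ℝ) •
        inChart (𝓡 (n + 1)) γ c z := by
  filter_upwards [hvol.eventually_sign_eq hy, extChartAt_target_mem_nhds' hy] with z hz hz'
  rw [orientedExtension, if_pos hz', hz]

lemma orientedExtension_eq_zero {c : X} {γ : DForm (EuclideanSpace ℝ (Fin (n + 1))) X n}
    {y : EuclideanSpace ℝ (Fin (n + 1))} (hy : y ∉ extChartAt (𝓡 (n + 1)) c '' tsupport γ) :
    orientedExtension vol c γ y = 0 := by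
  rw [orientedExtension]
  split_ifs with h
  · rw [inChart_eq_zero (eq_zero_of_notMem_chart_image h hy), smul_zero]
  · rfl

lemma orientedExtension_eventuallyEq_zero {c : X} {γ : DForm (EuclideanSpace ℝ (Fin (n + 1))) X n}
    (h : tsupport γ ⊆ (extChartAt (𝓡 (n + 1)) c).source) {y : EuclideanSpace ℝ (Fin (n + 1))}
    (hy : y ∉ (extChartAt (𝓡 (n + 1)) c).target) :
    orientedExtension vol c γ =ᶠ[𝓝 y] fun _ => 0 := by
  have h1 : y ∉ extChartAt (𝓡 (n + 1)) c '' tsupport γ := by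
    rintro ⟨x, hx, rfl⟩
    exact hy ((extChartAt (𝓡 (n + 1)) c).map_source (h hx))
  filter_upwards [(isCompact_chart_image h).isClosed.isOpen_compl.mem_nhds h1] with z hz
  exact orientedExtension_eq_zero hz

/-- On the chart image the sign is locally constant. At any other point the extension vanishes
nearby, because the image of the support is compact, hence closed. -/
lemma IsOrientationForm.contDiff_orientedExtension (hvol : IsOrientationForm vol) {c : X}
    {γ : DForm (EuclideanSpace ℝ (Fin (n + 1))) X n} (hγ : IsSmoothForm (𝓡 (n + 1)) γ)
    (h : tsupport γ ⊆ (extChartAt (𝓡 (n + 1)) c).source) :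
    ContDiff ℝ 1 (orientedExtension vol c γ) := by
  refine contDiff_iff_contDiffAt.2 fun y => ?_
  by_cases hy : y ∈ (extChartAt (𝓡 (n + 1)) c).target
  · exact (((hγ.contDiffAt_inChart hy).of_le (by simp)).const_smul _).congr_of_eventuallyEq
      (hvol.orientedExtension_eventuallyEq γ hy)
  · exact contDiffAt_const.congr_of_eventuallyEq (orientedExtension_eventuallyEq_zero h hy)

/-- The locally constant sign commutes with d, so the density of dγ is the exterior derivative of
the oriented extension, whose integral over the whole space vanishes. -/
lemma IsOrientationForm.chartIntegral_extd (hvol : IsOrientationForm vol) {c : X}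
    {γ : DForm (EuclideanSpace ℝ (Fin (n + 1))) X n} (hγ : IsSmoothForm (𝓡 (n + 1)) γ)
    (h : tsupport γ ⊆ (extChartAt (𝓡 (n + 1)) c).source) :
    chartIntegral vol c (extd (𝓡 (n + 1)) γ) = 0 := by
  have h1 : ∀ y ∈ (extChartAt (𝓡 (n + 1)) c).target, chartDensity vol c (extd (𝓡 (n + 1)) γ) y =
      extDeriv (orientedExtension vol c γ) y (stdFrame (n + 1)) := fun y hy => by
    rw [(hvol.orientedExtension_eventuallyEq γ hy).extDeriv_eq, chartDensity, inChart_extd hγ hy]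
    exact (DFunLike.congr_fun (extDeriv_smul
      (SignType.sign (inChart (𝓡 (n + 1)) vol c y (stdFrame (n + 1))) : ℝ)
      (inChart (𝓡 (n + 1)) γ c)) (stdFrame (n + 1))).symm
  have h2 : ∀ y ∉ (extChartAt (𝓡 (n + 1)) c).target,
      extDeriv (orientedExtension vol c γ) y (stdFrame (n + 1)) = 0 := fun y hy => by
    have h3 : extDeriv (orientedExtension vol c γ) y = 0 := by
      rw [(orientedExtension_eventuallyEq_zero h hy).extDeriv_eq, extDeriv, fderiv_fun_const]
      exact (ContinuousAlternatingMap.alternatizeUncurryFinCLM ℝ _ ℝ).map_zero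
    rw [h3]
    rfl
  rw [chartIntegral, MeasureTheory.setIntegral_congr_fun
    (isOpen_extChartAt_target c).measurableSet h1,
    MeasureTheory.setIntegral_eq_integral_of_forall_compl_eq_zero h2]
  exact integral_extDeriv_eq_zero _ (hvol.contDiff_orientedExtension hγ h)
    (HasCompactSupport.intro (isCompact_chart_image h) fun y hy => orientedExtension_eq_zero hy) _

/-- Stokes' theorem on a compact oriented manifold without boundary. -/
lemma IsOrientationForm.formIntegral_extd (hvol : IsOrientationForm vol)
    {f : SmoothPartitionOfUnity X (𝓡 (n + 1)) X univ}
    (hf : f.IsSubordinate (fun c => (chartAt (EuclideanSpace ℝ (Fin (n + 1))) c).source))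
    {γ : DForm (EuclideanSpace ℝ (Fin (n + 1))) X n} (hγ : IsSmoothForm (𝓡 (n + 1)) γ) :
    formIntegral vol f (extd (𝓡 (n + 1)) γ) = 0 := by
  obtain ⟨S, hS, -⟩ := exists_finset_formIntegral_eq f
  have h1 : γ = ∑ c ∈ S, fun x => f c x • γ x := by
    ext1 x
    rw [Finset.sum_apply, ← Finset.sum_smul, hS, one_smul]
  have h2 : ∀ c, IsSmoothForm (𝓡 (n + 1)) fun x => f c x • γ x := fun c =>
    hγ.fun_smul (f c).contMDiff
  have h3 : ∀ c, tsupport (fun x => f c x • γ x) ⊆ (extChartAt (𝓡 (n + 1)) c).source := fun c =>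
    (tsupport_fun_smul_subset_left _ γ).trans (subordinate_subset hf c)
  rw [h1, extd_sum S fun c _ => h2 c, hvol.formIntegral_sum hf S fun c _ => (h2 c).extd]
  refine Finset.sum_eq_zero fun c _ => ?_
  rw [hvol.formIntegral_eq_chartIntegral hf (h2 c).extd ((tsupport_extd_subset _ _).trans (h3 c)),
    hvol.chartIntegral_extd (h2 c) (h3 c)]

end Stokes

lemma IsOrientationForm.formIntegral_eq_zero_of_isExactForm {d : ℕ} {X : Type*} [TopologicalSpace X]
    [ChartedSpace (EuclideanSpace ℝ (Fin d)) X] [IsManifold (𝓡 d) ∞ X] [CompactSpace X]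
    {vol : DForm (EuclideanSpace ℝ (Fin d)) X d} (hvol : IsOrientationForm vol)
    {f : SmoothPartitionOfUnity X (𝓡 d) X univ}
    (hf : f.IsSubordinate (fun c => (chartAt (EuclideanSpace ℝ (Fin d)) c).source))
    {θ : DForm (EuclideanSpace ℝ (Fin d)) X d} (h : IsExactForm (𝓡 d) θ) :
    formIntegral vol f θ = 0 := by
  cases d with
  | zero =>
    have h1 : θ = 0 := h
    rw [h1]
    -- The zero form is the empty sum.
    simpa using hvol.formIntegral_sum hf (∅ : Finset X) (θ := fun _ => 0) (by simp)
  | succ n =>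
    obtain ⟨γ, hγ, rfl⟩ := h
    exact hvol.formIntegral_extd hf hγ

end

end EquivariantForms

namespace EquivariantForms

noncomputable section

/-! ### The pairing with homotopy classes -/

section Pairing

variable {EG : Type*} [NormedAddCommGroup EG] [NormedSpace ℝ EG] [FiniteDimensional ℝ EG]
  {HG : Type*} [TopologicalSpace HG] {IG : ModelWithCorners ℝ EG HG} [IG.Boundaryless]
  {G : Type*} [TopologicalSpace G] [ChartedSpace HG G] [Group G] [LieGroup IG ∞ G]
  {EP : Type*} [NormedAddCommGroup EP] [NormedSpace ℝ EP] [FiniteDimensional ℝ EP]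
  {HP : Type*} [TopologicalSpace HP] {IP : ModelWithCorners ℝ EP HP} [IP.Boundaryless]
  {P : Type*} [TopologicalSpace P] [ChartedSpace HP P] [IsManifold IP ∞ P] [MulAction Gᵐᵒᵖ P]
  {EX : Type*} [NormedAddCommGroup EX] [NormedSpace ℝ EX] [FiniteDimensional ℝ EX]
  {HX : Type*} [TopologicalSpace HX] {IX : ModelWithCorners ℝ EX HX} [IX.Boundaryless]
  {X : Type*} [TopologicalSpace X] [ChartedSpace HX X] [IsManifold IX ∞ X] {π : P → X}
  {EM : Type*} [NormedAddCommGroup EM] [NormedSpace ℝ EM]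
  {HM : Type*} [TopologicalSpace HM] {IM : ModelWithCorners ℝ EM HM} [IM.Boundaryless]
  {M : Type*} [TopologicalSpace M] [ChartedSpace HM M] [IsManifold IM ∞ M]
  [MulAction G M] [ContMDiffSMul IG IM ∞ G M]
  {m : ℕ} {b : Module.Basis (Fin m) ℝ (GroupLieAlgebra IG G)}

/-- From d_G γ = α' - α, the formula for the differential makes γ(u,A) a primitive of the
difference. In degree 0 the two polynomials have the same values, which already determine the forms
on X. -/
lemma IsPrincipalBundle.isExactForm_sub_of_cohomologous (hπ : IsPrincipalBundle IG IP IX G π)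
    {ℓ : ℕ} {α α' : EquivForm IG IM b M ℓ} (h : α.Cohomologous α') (A : Connection IG IP G P)
    {u : P → M} (hu : IsEquivariantMap IM IP G u) {a a' : DForm EX X ℓ}
    (ha : DescendsTo IP IX π (α.subst u A) a) (ha' : DescendsTo IP IX π (α'.subst u A) a') :
    IsExactForm IX (a' - a) := by
  cases ℓ with
  | zero =>
    have h1 : a' = a := hπ.eq_of_pullback_eq (by
      rw [ha.2, ha'.2]
      exact EquivForm.subst_congr h u A)
    exact sub_eq_zero.2 h1
  | succ ℓ =>
    obtain ⟨γ, hγ⟩ := h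
    obtain ⟨c, hc⟩ := hπ.exists_descendsTo_subst γ A hu
    refine ⟨c, hc.1, ?_⟩
    refine (hπ.extd_eq_of_descendsTo γ (α'.sub α) A hu.1 (fun ξ => ?_) hc
      ⟨ha'.1.sub ha.1, ?_⟩).symm
    · rw [EquivForm.eval_sub, hγ ξ, add_sub_cancel_left]
    · rw [pullback_sub, ha.2, ha'.2, EquivForm.subst_sub]

lemma IsOrientationForm.formIntegral_eq_of_isExactForm_sub {d : ℕ} {X : Type*} [TopologicalSpace X]
    [ChartedSpace (EuclideanSpace ℝ (Fin d)) X] [IsManifold (𝓡 d) ∞ X] [CompactSpace X]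
    {vol : DForm (EuclideanSpace ℝ (Fin d)) X d} (hvol : IsOrientationForm vol)
    {f : SmoothPartitionOfUnity X (𝓡 d) X univ}
    (hf : f.IsSubordinate (fun c => (chartAt (EuclideanSpace ℝ (Fin d)) c).source))
    {θ θ' : DForm (EuclideanSpace ℝ (Fin d)) X d} (hθ : IsSmoothForm (𝓡 d) θ)
    (hθ' : IsSmoothForm (𝓡 d) θ') (h : IsExactForm (𝓡 d) (θ' - θ)) :
    formIntegral vol f θ = formIntegral vol f θ' := by
  have h1 := hvol.formIntegral_add hf hθ (hθ'.sub hθ)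
  rw [hvol.formIntegral_eq_zero_of_isExactForm hf h, add_zero, add_sub_cancel] at h1
  exact h1.symm

end Pairing

end

end EquivariantForms

theorem mainTheorem5
    -- the Lie group `G`
    {EG : Type*} [NormedAddCommGroup EG] [NormedSpace ℝ EG] [FiniteDimensional ℝ EG]
    {HG : Type*} [TopologicalSpace HG] (IG : ModelWithCorners ℝ EG HG) [IG.Boundaryless]
    (G : Type*) [TopologicalSpace G] [ChartedSpace HG G] [Group G] [LieGroup IG ∞ G]
    -- the `G`-manifold `M`
    {EM : Type*} [NormedAddCommGroup EM] [NormedSpace ℝ EM] [FiniteDimensional ℝ EM]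
    {HM : Type*} [TopologicalSpace HM] (IM : ModelWithCorners ℝ EM HM) [IM.Boundaryless]
    (M : Type*) [TopologicalSpace M] [ChartedSpace HM M] [IsManifold IM ∞ M]
    [MulAction G M] [ContMDiffSMul IG IM ∞ G M]
    -- the compact base manifold `X` of dimension `d`
    (d : ℕ) (X : Type*) [TopologicalSpace X] [ChartedSpace (EuclideanSpace ℝ (Fin d)) X]
    [IsManifold (𝓡 d) ∞ X] [CompactSpace X] [T2Space X]
    -- the principal bundle `π : P → X`
    {EP : Type*} [NormedAddCommGroup EP] [NormedSpace ℝ EP] [FiniteDimensional ℝ EP]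
    {HP : Type*} [TopologicalSpace HP] (IP : ModelWithCorners ℝ EP HP) [IP.Boundaryless]
    (P : Type*) [TopologicalSpace P] [ChartedSpace HP P] [IsManifold IP ∞ P]
    [MulAction Gᵐᵒᵖ P] (π : P → X) (hπ : IsPrincipalBundle IG IP (𝓡 d) G π)
    -- a basis of the Lie algebra
    {m : ℕ} (b : Module.Basis (Fin m) ℝ (GroupLieAlgebra IG G)) :
    -- `α(u,A)` is a smooth, equivariant and horizontal form, and descends to `X`
    (∀ (ℓ : ℕ) (α : EquivForm IG IM b M ℓ) (A : Connection IG IP G P) (u : P → M),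
      IsEquivariantMap IM IP G u →
        IsSmoothForm IP (α.subst u A) ∧ IsEquivariantForm IP G (α.subst u A) ∧
        IsHorizontalForm IG IP G (α.subst u A) ∧
        ∃! a : DForm (EuclideanSpace ℝ (Fin d)) X ℓ, DescendsTo IP (𝓡 d) π (α.subst u A) a) ∧
    -- if `d_G α = β` then `d α(u,A) = β(u,A)`, on `P` and on `X`
    (∀ (ℓ : ℕ) (α : EquivForm IG IM b M ℓ) (β : EquivForm IG IM b M (ℓ + 1))
      (A : Connection IG IP G P) (u : P → M), IsEquivariantMap IM IP G u →
      (∀ ξ, α.dG ξ = β.eval ξ) →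
        extd IP (α.subst u A) = β.subst u A ∧
        ∀ a a', DescendsTo IP (𝓡 d) π (α.subst u A) a → DescendsTo IP (𝓡 d) π (β.subst u A) a' →
          extd (𝓡 d) a = a') ∧
    -- for `G`-closed `α`, the form on `X` changes by an exact form under a change of the connection
    -- and an equivariant homotopy
    (∀ (ℓ : ℕ) (α : EquivForm IG IM b M ℓ), α.IsClosed →
      ∀ (A₀ A₁ : Connection IG IP G P) (u₀ u₁ : P → M),
      IsEquivariantMap IM IP G u₀ → IsEquivariantMap IM IP G u₁ →
      EquivariantlyHomotopic IM IP G u₀ u₁ →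
      ∀ a₀ a₁, DescendsTo IP (𝓡 d) π (α.subst u₀ A₀) a₀ →
        DescendsTo IP (𝓡 d) π (α.subst u₁ A₁) a₁ → IsExactForm (𝓡 d) (a₁ - a₀)) ∧
    -- the pairing `∫_X α(u,A)` is well defined for oriented `X` and `α` of degree `dim X`
    (∀ vol : DForm (EuclideanSpace ℝ (Fin d)) X d, IsOrientationForm vol →
      ∀ f f' : SmoothPartitionOfUnity X (𝓡 d) X univ,
      f.IsSubordinate (fun c => (chartAt (EuclideanSpace ℝ (Fin d)) c).source) →
      f'.IsSubordinate (fun c => (chartAt (EuclideanSpace ℝ (Fin d)) c).source) →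
      ∀ α α' : EquivForm IG IM b M d, α.IsClosed → α.Cohomologous α' →
      ∀ (A₀ A₁ : Connection IG IP G P) (u₀ u₁ : P → M),
      IsEquivariantMap IM IP G u₀ → IsEquivariantMap IM IP G u₁ →
      EquivariantlyHomotopic IM IP G u₀ u₁ →
      ∀ a₀ a₁, DescendsTo IP (𝓡 d) π (α.subst u₀ A₀) a₀ →
        DescendsTo IP (𝓡 d) π (α'.subst u₁ A₁) a₁ →
        formIntegral vol f a₀ = formIntegral vol f' a₁) := by
  refine ⟨fun ℓ α A u hu => ⟨isSmoothForm_subst α A hu.1, hπ.isEquivariantForm_subst α A hu,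
    hπ.isHorizontalForm_subst α A hu, ?_⟩, fun ℓ α β A u hu h => ⟨hπ.extd_subst α β A hu h,
    fun a a' ha ha' => hπ.extd_eq_of_descendsTo α β A hu.1 h ha ha'⟩,
    fun ℓ α hα A₀ A₁ u₀ u₁ _ _ h a₀ a₁ ha₀ ha₁ => hπ.isExactForm_sub hα A₀ A₁ h ha₀ ha₁, ?_⟩
  · obtain ⟨a, ha⟩ := hπ.exists_descendsTo_subst α A hu
    exact ⟨a, ha, fun a' ha' => hπ.eq_of_pullback_eq (ha'.2.trans ha.2.symm)⟩
  · intro vol hvol f f' hf hf' α α' hα hαα' A₀ A₁ u₀ u₁ _ hu₁ h a₀ a₁ ha₀ ha₁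
    -- The intermediate form α(u₁,A₁): it differs from a₀ by an exact form because of the homotopy
    -- and the change of connection, and from a₁ because α and α' are cohomologous.
    obtain ⟨a, ha⟩ := hπ.exists_descendsTo_subst α A₁ hu₁
    have h1 := hπ.isExactForm_sub hα A₀ A₁ h ha₀ ha
    have h2 := hπ.isExactForm_sub_of_cohomologous hαα' A₁ hu₁ ha ha₁
    rw [hvol.formIntegral_eq_formIntegral hf hf' ha₀.1,
      hvol.formIntegral_eq_of_isExactForm_sub hf' ha₀.1 ha.1 h1,
      hvol.formIntegral_eq_of_isExactForm_sub hf' ha.1 ha₁.1 h2]
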